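/- Let $\mathbb{k}$ be an algebraically closed field of characteristic zero, and let $\mathscr{A}$ be the connected cochain DG algebra whose underlying graded algebra is the free algebra $\mathbb{k}\langle x_1,x_2,x_3\rangle$ with $|x_1|=|x_2|=|x_3|=1$ and whose differential is determined by $\partial(x_1)=x_2x_3$, $\partial(x_2)=\partial(x_3)=0$ and the graded Leibniz rule. Write $\lceil z\rceil$ for the cohomology class of a cocycle $z$. Then: 1. There is an isomorphism of $\mathbb{k}$-algebras $\mathbb{k}\langle y_1,y_2\rangle/(y_1y_2)\cong H(\mathscr{A})$ with $y_1\mapsto\lceil x_2\rceil$ and $y_2\mapsto\lceil x_3\rceil$; that is, $H(\mathscr{A})=\mathbb{k}\langle\lceil x_2\rceil,\lceil x_3\rceil\rangle/(\lceil x_2\rceil\cdot\lceil x_3\rceil)$. 2. $\mathscr{A}$ is Koszul: the trivial left DG module $\mathbb{k}$ has a minimal semi-free resolution with a semi-basis concentrated in degree $0$. 3. $\mathscr{A}$ is homologically smooth: $\mathscr{A}$ is a compact object of the derived category $\mathscr{D}(\mathscr{A}^e)$ of left DG modules over the enveloping DG algebra $\mathscr{A}^e=\mathscr{A}\otimes\mathscr{A}^{op}$.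 4. $\mathscr{A}$ is not Gorenstein: it is not the case that both $\dim_{\mathbb{k}}H(R\mathrm{Hom}_{\mathscr{A}}(\mathbb{k},\mathscr{A}))=1$ and $\dim_{\mathbb{k}}H(R\mathrm{Hom}_{\mathscr{A}^{op}}(\mathbb{k},\mathscr{A}))=1$. 5. The Ext-algebra $H(R\mathrm{Hom}_{\mathscr{A}}(\mathbb{k},\mathbb{k}))$, computed as $H(\mathrm{Hom}_{\mathscr{A}}(F,F))$ for any semi-free resolution $F$ of $\mathbb{k}$, has dimension $4$ over $\mathbb{k}$ and is not a Frobenius algebra, i.e. it carries no nondegenerate bilinear form with $\langle ab,c\rangle=\langle a,bc\rangle$. -/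

import Mathlib

namespace DG

universe u

open scoped DirectSum TensorProduct

noncomputable section

/-- A (cochain) differential graded algebra over the field `k`. -/
structure DGAlgebra (k : Type u) [Field k] where
  carrier : Type u
  [ring : Ring carrier]
  [algebra : Algebra k carrier]
  grading : ℤ → Submodule k carrier
  [graded : GradedAlgebra grading]
  d : carrier →ₗ[k] carrier
  d_mem : ∀ {n : ℤ} {a : carrier}, a ∈ grading n → d a ∈ grading (n + 1)
  d_d : ∀ a : carrier, d (d a) = 0
  leibniz : ∀ {n : ℤ} {a : carrier} (b : carrier), a ∈ grading n →
    d (a * b) = d a * b + (-1 : k) ^ n • (a * d b)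

attribute [instance] DGAlgebra.ring DGAlgebra.algebra DGAlgebra.graded

instance (k : Type u) [Field k] : CoeSort (DGAlgebra k) (Type u) := ⟨DGAlgebra.carrier⟩

/-- A left differential graded module over the differential graded algebra `A`. -/
structure DGModule {k : Type u} [Field k] (A : DGAlgebra k) where
  carrier : Type u
  [addCommGroup : AddCommGroup carrier]
  [module : Module k carrier]
  [moduleA : Module A carrier]
  [tower : IsScalarTower k A carrier]
  grading : ℤ → Submodule k carrier
  [decomposition : DirectSum.Decomposition grading]
  smul_mem : ∀ {i j : ℤ} {a : A} {x : carrier}, a ∈ A.grading i → x ∈ grading j →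
    a • x ∈ grading (i + j)
  d : carrier →ₗ[k] carrier
  d_mem : ∀ {n : ℤ} {x : carrier}, x ∈ grading n → d x ∈ grading (n + 1)
  d_d : ∀ x : carrier, d (d x) = 0
  leibniz : ∀ {n : ℤ} {a : A} (x : carrier), a ∈ A.grading n →
    d (a • x) = A.d a • x + (-1 : k) ^ n • (a • d x)

attribute [instance] DGModule.addCommGroup DGModule.module DGModule.moduleA DGModule.tower
  DGModule.decomposition

instance {k : Type u} [Field k] (A : DGAlgebra k) : CoeSort (DGModule A) (Type u) :=
  ⟨DGModule.carrier⟩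

section Signs

variable {k : Type u} [Field k]

theorem sign_sq (n : ℤ) : (-1 : k) ^ n * (-1 : k) ^ n = 1 := by
  rw [← mul_zpow]; simp

theorem sign_add (m n : ℤ) : (-1 : k) ^ (m + n) = (-1 : k) ^ m * (-1 : k) ^ n :=
  zpow_add₀ (by simp) m n

theorem sign_units_smul {M : Type*} [AddCommGroup M] [Module k M] (n : ℤ) (x : M) :
    ((-1 : ℤˣ) ^ n) • x = ((-1 : k) ^ n) • x := by
  rcases Int.even_or_odd n with h | h
  · rw [h.neg_one_zpow, h.neg_one_zpow]; simp
  · rw [h.neg_one_zpow, h.neg_one_zpow]; simp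

variable {M : Type u} [AddCommGroup M] [Module k M] (ℳ : ℤ → Submodule k M)
  [DirectSum.Decomposition ℳ]

/-- The map `x ↦ (-1) ^ (i * |x|) x` on a graded vector space. -/
def signTwist (i : ℤ) : M →ₗ[k] M :=
  (DirectSum.toModule k ℤ M fun j => ((-1 : k) ^ (i * j)) • (ℳ j).subtype) ∘ₗ
    (DirectSum.decomposeLinearEquiv ℳ).toLinearMap

theorem signTwist_of_mem {i j : ℤ} {x : M} (hx : x ∈ ℳ j) :
    signTwist ℳ i x = (-1 : k) ^ (i * j) • x := by
  lift x to ℳ j using hx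
  simp [signTwist]

end Signs

namespace DGAlgebra

variable {k : Type u} [Field k] (A : DGAlgebra k)

/-! ### The opposite differential graded algebra -/

/-- The underlying vector space of the opposite algebra. -/
def OpCarrier : Type u := A.carrier

instance : AddCommGroup A.OpCarrier := inferInstanceAs (AddCommGroup A.carrier)
instance : Module k A.OpCarrier := inferInstanceAs (Module k A.carrier)

/-- The linear identification of `A` with the vector space underlying the opposite algebra. -/
def toOp : A ≃ₗ[k] A.OpCarrier := LinearEquiv.refl k A.carrier

/-- The multiplication `(a, b) ↦ (-1) ^ (|a| |b|) b a`. -/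
def opMul : A →ₗ[k] A →ₗ[k] A :=
  (DirectSum.toModule k ℤ (A →ₗ[k] A) fun i =>
    LinearMap.lcomp k A (signTwist A.grading i) ∘ₗ (LinearMap.mul k A).flip ∘ₗ
      (A.grading i).subtype) ∘ₗ (DirectSum.decomposeLinearEquiv A.grading).toLinearMap

theorem opMul_of_mem_left {i : ℤ} {a : A} (b : A) (ha : a ∈ A.grading i) :
    A.opMul a b = signTwist A.grading i b * a := by
  lift a to A.grading i using ha
  simp [opMul]

theorem opMul_of_mem {i j : ℤ} {a b : A} (ha : a ∈ A.grading i) (hb : b ∈ A.grading j) :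
    A.opMul a b = (-1 : k) ^ (i * j) • (b * a) := by
  rw [opMul_of_mem_left A b ha, signTwist_of_mem A.grading hb, smul_mul_assoc]

variable {A} in
/-- Two linear maps on a graded vector space agree if they agree on homogeneous elements. -/
theorem hom_induction {M : Type*} {N : Type*} [AddCommGroup M] [Module k M] [AddCommGroup N]
    [Module k N] (ℳ : ℤ → Submodule k M) [DirectSum.Decomposition ℳ] {f g : M →ₗ[k] N}
    (h : ∀ i, ∀ x ∈ ℳ i, f x = g x) (x : M) : f x = g x := by
  induction x using DirectSum.Decomposition.inductionOn ℳ with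
  | zero => simp
  | homogeneous x => exact h _ _ x.2
  | add x y hx hy => rw [map_add, map_add, hx, hy]

theorem opMul_mem {i j : ℤ} {a b : A} (ha : a ∈ A.grading i) (hb : b ∈ A.grading j) :
    A.opMul a b ∈ A.grading (i + j) := by
  rw [opMul_of_mem A ha hb, add_comm]
  exact Submodule.smul_mem _ _ (SetLike.mul_mem_graded hb ha)

theorem opMul_assoc (a b c : A) : A.opMul (A.opMul a b) c = A.opMul a (A.opMul b c) := by
  induction a using DirectSum.Decomposition.inductionOn A.grading with
  | zero => simp
  | add x y hx hy => simp only [map_add, LinearMap.add_apply, hx, hy]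
  | @homogeneous i a =>
  induction b using DirectSum.Decomposition.inductionOn A.grading with
  | zero => simp
  | add x y hx hy => simp only [map_add, LinearMap.add_apply, hx, hy]
  | @homogeneous j b =>
  induction c using DirectSum.Decomposition.inductionOn A.grading with
  | zero => simp
  | add x y hx hy => simp only [map_add, hx, hy]
  | @homogeneous l c =>
  rw [opMul_of_mem A (opMul_mem A a.2 b.2) c.2, opMul_of_mem A a.2 (opMul_mem A b.2 c.2),
    opMul_of_mem A a.2 b.2, opMul_of_mem A b.2 c.2, mul_smul_comm, smul_mul_assoc, smul_smul,
    smul_smul, mul_assoc, ← sign_add, ← sign_add]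
  congr 2
  ring

theorem one_opMul (a : A) : A.opMul 1 a = a := by
  rw [opMul_of_mem_left A a (SetLike.one_mem_graded A.grading), mul_one]
  refine hom_induction (g := LinearMap.id) A.grading (fun j x hx => ?_) a
  rw [signTwist_of_mem A.grading hx]; simp

theorem opMul_one (a : A) : A.opMul a 1 = a := by
  refine hom_induction (f := A.opMul.flip 1) (g := LinearMap.id) A.grading (fun j x hx => ?_) a
  rw [LinearMap.flip_apply, opMul_of_mem A hx (SetLike.one_mem_graded A.grading)]; simp

instance : Ring A.OpCarrier where
  __ := (inferInstance : AddCommGroup A.OpCarrier)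
  mul a b := A.toOp (A.opMul (A.toOp.symm a) (A.toOp.symm b))
  one := A.toOp 1
  left_distrib a b c := congrArg A.toOp ((A.opMul (A.toOp.symm a)).map_add _ _)
  right_distrib a b c := congrArg A.toOp (A.opMul.map_add₂ _ _ _)
  zero_mul a := congrArg A.toOp (A.opMul.map_zero₂ _)
  mul_zero a := congrArg A.toOp ((A.opMul (A.toOp.symm a)).map_zero)
  mul_assoc a b c := congrArg A.toOp (A.opMul_assoc _ _ _)
  one_mul a := congrArg A.toOp (A.one_opMul _)
  mul_one a := congrArg A.toOp (A.opMul_one _)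

theorem toOp_mul (a b : A) : A.toOp a * A.toOp b = A.toOp (A.opMul a b) := rfl

theorem toOp_one : A.toOp 1 = 1 := rfl

instance : Algebra k A.OpCarrier :=
  Algebra.ofModule (fun r _ _ => congrArg A.toOp (A.opMul.map_smul₂ r _ _))
    (fun r a _ => congrArg A.toOp ((A.opMul (A.toOp.symm a)).map_smul r _))

/-- The grading of the opposite algebra. -/
def opGrading (n : ℤ) : Submodule k A.OpCarrier := A.grading n

instance : DirectSum.Decomposition A.opGrading :=
  inferInstanceAs (DirectSum.Decomposition A.grading)

instance : SetLike.GradedMonoid A.opGrading where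
  one_mem := SetLike.one_mem_graded A.grading
  mul_mem _ _ _ _ ha hb := A.opMul_mem ha hb

instance : GradedAlgebra A.opGrading where

/-- The opposite differential graded algebra: the product of `a` and `b` is
`(-1) ^ (|a| |b|) b a`. -/
abbrev op : DGAlgebra k where
  carrier := A.OpCarrier
  grading := A.opGrading
  d := A.toOp.toLinearMap ∘ₗ A.d ∘ₗ A.toOp.symm.toLinearMap
  d_mem h := A.d_mem h
  d_d a := A.d_d a
  leibniz {n a} b ha := by
    change A.d (A.opMul a b) = A.opMul (A.d a) b + (-1 : k) ^ n • (A.opMul a (A.d b))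
    refine hom_induction (f := A.d ∘ₗ A.opMul a)
      (g := A.opMul (A.d a) + (-1 : k) ^ n • (A.opMul a ∘ₗ A.d)) A.grading (fun j b hb => ?_) b
    have ha' : a ∈ A.grading n := ha
    simp only [LinearMap.comp_apply, LinearMap.add_apply, LinearMap.smul_apply]
    rw [opMul_of_mem A ha' hb, opMul_of_mem A (A.d_mem ha') hb, opMul_of_mem A ha' (A.d_mem hb),
      map_smul, A.leibniz a hb, smul_add, smul_smul, smul_smul, add_comm]
    congr 2
    · rw [← sign_add]; congr 1; ring
    · rw [← sign_add, mul_add, mul_one, add_comm, sign_add, sign_add, mul_assoc, sign_sq, mul_one]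


/-! ### The tensor product of two differential graded algebras -/

variable (B : DGAlgebra k)

/-- The underlying algebra of the tensor product, with the product
`(a ⊗ b) (a' ⊗ b') = (-1) ^ (|b| |a'|) a a' ⊗ b b'`. -/
def TensorCarrier : Type u := A.grading ᵍ⊗[k] B.grading

instance : Ring (A.TensorCarrier B) := inferInstanceAs (Ring (A.grading ᵍ⊗[k] B.grading))
instance : Algebra k (A.TensorCarrier B) :=
  inferInstanceAs (Algebra k (A.grading ᵍ⊗[k] B.grading))

/-- The linear identification of the underlying vector space with the usual tensor product. -/
def tensorEquiv : A ⊗[k] B ≃ₗ[k] A.TensorCarrier B where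
  toFun x := GradedTensorProduct.of k A.grading B.grading x
  invFun x := (GradedTensorProduct.of k A.grading B.grading).symm x
  map_add' _ _ := rfl
  map_smul' _ _ := rfl
  left_inv _ := rfl
  right_inv _ := rfl

variable {A B} in
/-- The pure tensor `a ⊗ b`. -/
def tmul (a : A) (b : B) : A.TensorCarrier B := A.tensorEquiv B (a ⊗ₜ b)

/-- The total grading on the tensor product. -/
def tensorGrading (n : ℤ) : Submodule k (A.TensorCarrier B) :=
  Submodule.span k {x | ∃ i j : ℤ, ∃ a ∈ A.grading i, ∃ b ∈ B.grading j, i + j = n ∧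
    x = tmul a b}

variable {A B} in
theorem tmul_mem {i j : ℤ} {a : A} {b : B} (ha : a ∈ A.grading i) (hb : b ∈ B.grading j) :
    (tmul a b : A.TensorCarrier B) ∈ A.tensorGrading B (i + j) :=
  Submodule.subset_span ⟨i, j, a, ha, b, hb, rfl, rfl⟩

variable {A B} in
theorem tmul_mul_tmul {i j : ℤ} (a : A) {b : B} {a' : A} (b' : B) (hb : b ∈ B.grading j)
    (ha' : a' ∈ A.grading i) :
    (tmul a b * tmul a' b' : A.TensorCarrier B) =
      (-1 : k) ^ (j * i) • tmul (a * a') (b * b') := by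
  rw [← sign_units_smul]
  exact GradedTensorProduct.tmul_coe_mul_coe_tmul A.grading B.grading a ⟨b, hb⟩ ⟨a', ha'⟩ b'

instance : SetLike.GradedMonoid (A.tensorGrading B) where
  one_mem := by
    have h := tmul_mem (SetLike.one_mem_graded A.grading) (SetLike.one_mem_graded B.grading)
    exact h
  mul_mem m n x y hx hy := by
    induction hx using Submodule.span_induction with
    | zero => rw [zero_mul]; exact Submodule.zero_mem _
    | add x x' _ _ h h' => rw [add_mul]; exact Submodule.add_mem _ h h'
    | smul r x _ h => rw [Algebra.smul_mul_assoc]; exact Submodule.smul_mem _ _ h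
    | mem x hx =>
    induction hy using Submodule.span_induction with
    | zero => rw [mul_zero]; exact Submodule.zero_mem _
    | add x x' _ _ h h' => rw [mul_add]; exact Submodule.add_mem _ h h'
    | smul r x _ h => rw [Algebra.mul_smul_comm]; exact Submodule.smul_mem _ _ h
    | mem y hy =>
    obtain ⟨i, j, a, ha, b, hb, rfl, rfl⟩ := hx
    obtain ⟨i', j', a', ha', b', hb', rfl, rfl⟩ := hy
    rw [tmul_mul_tmul a b' hb ha', add_add_add_comm]
    exact Submodule.smul_mem _ _
      (tmul_mem (SetLike.mul_mem_graded ha ha') (SetLike.mul_mem_graded hb hb'))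

/-- The decomposition of a tensor into its homogeneous components. -/
def tensorDecompose : A.TensorCarrier B →ₗ[k] ⨁ n, A.tensorGrading B n :=
  (TensorProduct.lift
    (DirectSum.toModule k ℤ ((⨁ j, B.grading j) →ₗ[k] ⨁ n, A.tensorGrading B n) fun i =>
      LinearMap.flip (DirectSum.toModule k ℤ (A.grading i →ₗ[k] ⨁ n, A.tensorGrading B n) fun j =>
        LinearMap.mk₂ k (fun (b : B.grading j) (a : A.grading i) =>
          DirectSum.lof k ℤ (fun n => A.tensorGrading B n) (i + j)
            ⟨tmul (a : A) (b : B), tmul_mem a.2 b.2⟩)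
          (fun b b' a => by
            rw [← map_add]; congr 1; ext
            simp [tmul, TensorProduct.tmul_add])
          (fun r b a => by
            rw [← map_smul]; congr 1; ext
            simp [tmul, TensorProduct.tmul_smul])
          (fun b a a' => by
            rw [← map_add]; congr 1; ext
            simp [tmul, TensorProduct.add_tmul])
          (fun r b a => by
            rw [← map_smul]; congr 1)))) ∘ₗ
    (TensorProduct.map (DirectSum.decomposeLinearEquiv A.grading).toLinearMap
      (DirectSum.decomposeLinearEquiv B.grading).toLinearMap) ∘ₗ
      (A.tensorEquiv B).symm.toLinearMap

theorem tensorDecompose_tmul {i j : ℤ} {a : A} {b : B} (ha : a ∈ A.grading i)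
    (hb : b ∈ B.grading j) :
    A.tensorDecompose B (tmul a b) =
      DirectSum.lof k ℤ (fun n => A.tensorGrading B n) (i + j)
        ⟨tmul a b, tmul_mem ha hb⟩ := by
  lift a to A.grading i using ha
  lift b to B.grading j using hb
  rw [tensorDecompose, LinearMap.comp_apply, LinearMap.comp_apply, LinearEquiv.coe_coe,
    show (A.tensorEquiv B).symm (tmul (a : A) (b : B)) = (a : A) ⊗ₜ[k] (b : B) from rfl,
    TensorProduct.map_tmul, LinearEquiv.coe_coe, LinearEquiv.coe_coe, DirectSum.decomposeLinearEquiv_apply,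
    DirectSum.decomposeLinearEquiv_apply, DirectSum.decompose_coe, DirectSum.decompose_coe,
    TensorProduct.lift.tmul, ← DirectSum.lof_eq_of k, ← DirectSum.lof_eq_of k,
    DirectSum.toModule_lof, LinearMap.flip_apply, DirectSum.toModule_lof]
  rfl

variable {A B} in
/-- Two linear maps on a tensor product agree if they agree on tensors of homogeneous elements. -/
theorem tensor_induction {N : Type*} [AddCommGroup N] [Module k N]
    {f g : A.TensorCarrier B →ₗ[k] N}
    (h : ∀ i, ∀ a ∈ A.grading i, ∀ j, ∀ b ∈ B.grading j,
      f (tmul a b) = g (tmul a b)) : f = g := by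
  suffices H : f ∘ₗ (A.tensorEquiv B).toLinearMap = g ∘ₗ (A.tensorEquiv B).toLinearMap by
    ext x
    simpa using LinearMap.congr_fun H ((A.tensorEquiv B).symm x)
  apply TensorProduct.ext
  ext a b
  refine hom_induction (f := (TensorProduct.AlgebraTensorModule.curry
    (f ∘ₗ (A.tensorEquiv B).toLinearMap)).flip b)
    (g := (TensorProduct.AlgebraTensorModule.curry
    (g ∘ₗ (A.tensorEquiv B).toLinearMap)).flip b)
    A.grading (fun i a ha => ?_) a
  refine hom_induction (f := (TensorProduct.AlgebraTensorModule.curry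
    (f ∘ₗ (A.tensorEquiv B).toLinearMap)) a)
    (g := (TensorProduct.AlgebraTensorModule.curry
    (g ∘ₗ (A.tensorEquiv B).toLinearMap)) a)
    B.grading (fun j b hb => ?_) b
  exact h i a ha j b hb

instance : DirectSum.Decomposition (A.tensorGrading B) :=
  DirectSum.Decomposition.ofLinearMap _ (A.tensorDecompose B)
    (by
      refine tensor_induction fun i a ha j b hb => ?_
      rw [LinearMap.comp_apply, tensorDecompose_tmul A B ha hb, DirectSum.coeLinearMap_lof]
      rfl)
    (by
      ext n ⟨x, hx⟩ : 2
      simp only [LinearMap.comp_apply, DirectSum.coeLinearMap_lof, LinearMap.id_apply]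
      induction hx using Submodule.span_induction with
      | zero => rw [map_zero]; exact (map_zero _).symm
      | add x y hx hy h h' =>
        rw [map_add, h, h', ← map_add]; rfl
      | smul r x hx h => rw [map_smul, h, ← map_smul]; rfl
      | mem x hx =>
        obtain ⟨i, j, a, ha, b, hb, rfl, rfl⟩ := hx
        exact tensorDecompose_tmul A B ha hb)

instance : GradedAlgebra (A.tensorGrading B) where

/-- The differential `a ⊗ b ↦ ∂a ⊗ b + (-1) ^ |a| a ⊗ ∂b` on the tensor product. -/
def tensorD : A.TensorCarrier B →ₗ[k] A.TensorCarrier B :=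
  (A.tensorEquiv B).toLinearMap ∘ₗ
    (TensorProduct.map A.d LinearMap.id + TensorProduct.map (signTwist A.grading 1) B.d) ∘ₗ
    (A.tensorEquiv B).symm.toLinearMap

theorem tensorD_tmul {i : ℤ} {a : A} (b : B) (ha : a ∈ A.grading i) :
    A.tensorD B (tmul a b) = tmul (A.d a) b +
      (-1 : k) ^ i • tmul a (B.d b) := by
  simp [tensorD, tmul, signTwist_of_mem A.grading ha, ← TensorProduct.smul_tmul']

/-- The tensor product of two differential graded algebras. -/
abbrev tensor : DGAlgebra k where
  carrier := A.TensorCarrier B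
  grading := A.tensorGrading B
  d := A.tensorD B
  d_mem {n x} hx := by
    induction hx using Submodule.span_induction with
    | zero => rw [map_zero]; exact Submodule.zero_mem _
    | add x y hx hy h h' => rw [map_add]; exact Submodule.add_mem _ h h'
    | smul r x hx h => rw [map_smul]; exact Submodule.smul_mem _ _ h
    | mem x hx =>
      obtain ⟨i, j, a, ha, b, hb, rfl, rfl⟩ := hx
      rw [tensorD_tmul A B b ha]
      refine Submodule.add_mem _ ?_ (Submodule.smul_mem _ _ ?_)
      · rw [add_right_comm]; exact tmul_mem (A.d_mem ha) hb
      · rw [add_assoc]; exact tmul_mem ha (B.d_mem hb)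
  d_d x := by
    refine LinearMap.congr_fun (f := A.tensorD B ∘ₗ A.tensorD B) (g := 0)
      (tensor_induction fun i a ha j b hb => ?_) x
    rw [LinearMap.comp_apply, tensorD_tmul A B b ha, map_add, map_smul,
      tensorD_tmul A B b (A.d_mem ha), tensorD_tmul A B _ ha, A.d_d, B.d_d]
    simp [sign_add, tmul]
  leibniz {n x} y hx := by
    induction hx using Submodule.span_induction with
    | zero => simp
    | add x x' hx hx' h h' =>
      rw [add_mul, map_add, h, h', map_add, add_mul, add_mul, smul_add]; abel
    | smul r x hx h =>
      rw [Algebra.smul_mul_assoc, map_smul, h, map_smul, Algebra.smul_mul_assoc,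
        Algebra.smul_mul_assoc, smul_add, smul_comm r]
    | mem x hx =>
      obtain ⟨i, j, a, ha, b, hb, rfl, rfl⟩ := hx
      refine LinearMap.congr_fun (f := A.tensorD B ∘ₗ LinearMap.mulLeft k _)
        (g := LinearMap.mulLeft k (A.tensorD B (tmul a b)) +
          (-1 : k) ^ (i + j) • (LinearMap.mulLeft k (tmul a b) ∘ₗ
            A.tensorD B)) (tensor_induction fun i' a' ha' j' b' hb' => ?_) y
      simp only [LinearMap.comp_apply, LinearMap.mulLeft_apply, LinearMap.add_apply,
        LinearMap.smul_apply]
      rw [tmul_mul_tmul a b' hb ha', map_smul, tensorD_tmul A B _ (SetLike.mul_mem_graded ha ha'),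
        tensorD_tmul A B b ha, tensorD_tmul A B b' ha', add_mul, mul_add, Algebra.smul_mul_assoc,
        Algebra.mul_smul_comm, tmul_mul_tmul _ _ hb ha', tmul_mul_tmul _ _ (B.d_mem hb) ha',
        tmul_mul_tmul _ _ hb (A.d_mem ha'), tmul_mul_tmul _ _ hb ha', A.leibniz _ ha,
        B.leibniz _ hb]
      have h₁ : (-1 : k) ^ (i + j) * (-1 : k) ^ (j * (i' + 1)) =
          (-1 : k) ^ (j * i') * (-1 : k) ^ i := by
        rw [mul_add, mul_one, sign_add, sign_add]
        linear_combination (-1 : k) ^ i * (-1 : k) ^ (j * i') * sign_sq (k := k) j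
      simp only [tmul, TensorProduct.add_tmul, TensorProduct.tmul_add, TensorProduct.tmul_smul,
        ← TensorProduct.smul_tmul', map_add, map_smul, smul_add, smul_smul, h₁]
      have h₂ : (-1 : k) ^ i * (-1 : k) ^ ((j + 1) * i') =
          (-1 : k) ^ (j * i') * (-1 : k) ^ (i + i') := by
        rw [add_mul, one_mul, sign_add, sign_add]; ring
      have h₃ : (-1 : k) ^ (i + j) * ((-1 : k) ^ i' * (-1 : k) ^ (j * i')) =
          (-1 : k) ^ (j * i') * ((-1 : k) ^ (i + i') * (-1 : k) ^ j) := by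
        rw [sign_add, sign_add]; ring
      simp only [h₂, h₃]
      abel

/-- The enveloping differential graded algebra `A ⊗ Aᵒᵖ`. -/
abbrev env : DGAlgebra k := A.tensor A.op

/-! ### Some standard modules -/

/-- `A` as a left differential graded module over itself. -/
abbrev regular : DGModule A where
  carrier := A.carrier
  grading := A.grading
  smul_mem ha hx := SetLike.mul_mem_graded ha hx
  d := A.d
  d_mem := A.d_mem
  d_d := A.d_d
  leibniz := A.leibniz

/-- The left action of the opposite algebra on `A`, `b ↦ (m ↦ (-1) ^ (|b| |m|) m b)`. -/
def opAct : A.op →ₐ[k] Module.End k A :=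
  AlgHom.ofLinearMap (A.opMul ∘ₗ A.toOp.symm.toLinearMap)
    (LinearMap.ext fun m => A.one_opMul m)
    (fun a b => LinearMap.ext fun m => A.opMul_assoc (A.toOp.symm a) (A.toOp.symm b) m)

theorem opAct_apply (b m : A) : A.opAct (A.toOp b) m = A.opMul b m := rfl

/-- The action of the enveloping algebra on `A`,
`a ⊗ b ↦ (m ↦ (-1) ^ (|b| |m|) a m b)`. -/
def envAct : A.env →ₐ[k] Module.End k A :=
  GradedTensorProduct.lift A.grading A.op.grading (Algebra.lmul k A) A.opAct (by
    rintro i j ⟨a, ha⟩ ⟨b, hb⟩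
    obtain ⟨b, rfl⟩ := A.toOp.surjective b
    have hb' : b ∈ A.grading j := hb
    rw [sign_units_smul (k := k)]
    refine LinearMap.ext fun m => ?_
    refine hom_induction (f := Algebra.lmul k A a * A.opAct (A.toOp b))
      (g := (-1 : k) ^ (j * i) • (A.opAct (A.toOp b) * Algebra.lmul k A a)) A.grading (fun l m hm => ?_) m
    change a * A.opMul b m = (-1 : k) ^ (j * i) • A.opMul b (a * m)
    rw [opMul_of_mem A hb' hm, opMul_of_mem A hb' (SetLike.mul_mem_graded ha hm), mul_smul_comm,
      smul_smul, mul_add, sign_add, ← mul_assoc a, ← mul_assoc ((-1 : k) ^ (j * i)), sign_sq,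
      one_mul])

theorem envAct_tmul (a b m : A) :
    A.envAct (tmul (B := A.op) a (A.toOp b)) m = a * A.opMul b m := by
  have h := GradedTensorProduct.lift_tmul A.grading A.op.grading (Algebra.lmul k A) A.opAct
  exact LinearMap.congr_fun (h _ a (A.toOp b)) m

/-- `A` as a left differential graded module over its enveloping algebra. -/
abbrev diagonal : DGModule A.env where
  carrier := A.carrier
  moduleA := Module.compHom A.carrier A.envAct.toRingHom
  tower := by
    let _ := Module.compHom A.carrier A.envAct.toRingHom
    refine ⟨fun r x m => ?_⟩
    change A.envAct (r • x) m = r • A.envAct x m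
    rw [map_smul]; rfl
  grading := A.grading
  smul_mem {i j x m} hx hm := by
    change A.envAct x m ∈ A.grading (i + j)
    induction hx using Submodule.span_induction with
    | zero => rw [map_zero]; exact Submodule.zero_mem _
    | add x y hx hy h h' => rw [map_add]; exact Submodule.add_mem _ h h'
    | smul r x hx h => rw [map_smul]; exact Submodule.smul_mem _ _ h
    | mem x hx =>
      obtain ⟨i, j', a, ha, b, hb, rfl, rfl⟩ := hx
      obtain ⟨b, rfl⟩ := A.toOp.surjective b
      have hb' : b ∈ A.grading j' := hb
      rw [envAct_tmul, add_assoc]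
      exact SetLike.mul_mem_graded ha (opMul_mem A hb' hm)
  d := A.d
  d_mem := A.d_mem
  d_d := A.d_d
  leibniz {n x} m hx := by
    change A.d (A.envAct x m) = A.envAct (A.env.d x) m + (-1 : k) ^ n • A.envAct x (A.d m)
    induction hx using Submodule.span_induction with
    | zero => simp
    | add x y hx hy h h' =>
      simp only [map_add, LinearMap.add_apply, h, h', smul_add]; abel
    | smul r x hx h =>
      simp only [map_smul, LinearMap.smul_apply, h, smul_add, smul_comm r]
    | mem x hx =>
      obtain ⟨i, j, a, ha, b, hb, rfl, rfl⟩ := hx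
      obtain ⟨b, rfl⟩ := A.toOp.surjective b
      have hb' : b ∈ A.grading j := hb
      have hd : A.env.d (tmul (B := A.op) a (A.toOp b)) = tmul (B := A.op) (A.d a) (A.toOp b) +
          (-1 : k) ^ i • tmul (B := A.op) a (A.toOp (A.d b)) := A.tensorD_tmul A.op _ ha
      rw [hd, map_add, map_smul, LinearMap.add_apply, LinearMap.smul_apply, envAct_tmul,
        envAct_tmul, envAct_tmul, envAct_tmul, A.leibniz _ ha]
      have hl : A.d (A.opMul b m) = A.opMul (A.d b) m + (-1 : k) ^ j • A.opMul b (A.d m) :=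
        A.op.leibniz (A.toOp m) hb
      rw [hl, mul_add, smul_add, mul_smul_comm, smul_smul, sign_add, add_assoc]

/-! ### Connected differential graded algebras -/

/-- `A` is connected: it is concentrated in nonnegative degrees and its component of degree `0`
consists of the scalars. -/
class IsConnected : Prop where
  nontrivial : Nontrivial A
  grading_neg : ∀ n : ℤ, n < 0 → A.grading n = ⊥
  grading_zero : ∀ a ∈ A.grading 0, ∃ c : k, algebraMap k A c = a

instance [h : A.IsConnected] : A.op.IsConnected where
  nontrivial := h.nontrivial
  grading_neg := h.grading_neg
  grading_zero a ha := by
    obtain ⟨c, hc⟩ := h.grading_zero (A.toOp.symm a) ha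
    refine ⟨c, ?_⟩
    rw [Algebra.algebraMap_eq_smul_one] at hc ⊢
    exact hc

variable [A.IsConnected]

/-- The identification of the scalars with the component of degree `0`. -/
def scalarEquiv : k ≃ₗ[k] A.grading 0 :=
  LinearEquiv.ofBijective
    ((Algebra.linearMap k A).codRestrict (A.grading 0) fun c =>
      SetLike.algebraMap_mem_graded A.grading c)
    ⟨fun c c' h => by
      have := IsConnected.nontrivial (A := A)
      exact (algebraMap k A).injective (congrArg Subtype.val h),
    fun ⟨a, ha⟩ => by
      obtain ⟨c, hc⟩ := IsConnected.grading_zero a ha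
      exact ⟨c, Subtype.ext hc⟩⟩

/-- The linear map underlying the augmentation of a connected algebra. -/
def augLinear : A →ₗ[k] k :=
  (A.scalarEquiv).symm.toLinearMap ∘ₗ DirectSum.component k ℤ (fun i => A.grading i) 0 ∘ₗ
    (DirectSum.decomposeLinearEquiv A.grading).toLinearMap

theorem augLinear_algebraMap (c : k) : A.augLinear (algebraMap k A c) = c := by
  have h : DirectSum.decompose A.grading (algebraMap k A c) =
      DirectSum.of (fun i => A.grading i) 0 (A.scalarEquiv c) :=
    DirectSum.decompose_of_mem A.grading (SetLike.algebraMap_mem_graded A.grading c)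
  simp only [augLinear, LinearMap.comp_apply, LinearEquiv.coe_coe,
    DirectSum.decomposeLinearEquiv_apply]
  rw [h, ← DirectSum.lof_eq_of k, DirectSum.component.lof_self, LinearEquiv.symm_apply_apply]

theorem augLinear_of_ne {i : ℤ} (hi : i ≠ 0) {a : A} (ha : a ∈ A.grading i) :
    A.augLinear a = 0 := by
  simp only [augLinear, LinearMap.comp_apply, LinearEquiv.coe_coe,
    DirectSum.decomposeLinearEquiv_apply]
  rw [DirectSum.decompose_of_mem A.grading ha, ← DirectSum.lof_eq_of k,
    DirectSum.component.of, dif_neg hi, map_zero]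

theorem augLinear_mul (a b : A) : A.augLinear (a * b) = A.augLinear a * A.augLinear b := by
  induction a using DirectSum.Decomposition.inductionOn A.grading with
  | zero => simp
  | add x y hx hy => rw [add_mul, map_add, hx, hy, map_add, add_mul]
  | @homogeneous i a =>
  induction b using DirectSum.Decomposition.inductionOn A.grading with
  | zero => simp
  | add x y hx hy => rw [mul_add, map_add, hx, hy, map_add, mul_add]
  | @homogeneous j b =>
  rcases eq_or_ne i 0 with rfl | hi
  · obtain ⟨c, hc⟩ := IsConnected.grading_zero (A := A) a a.2
    rw [← hc, augLinear_algebraMap, ← Algebra.smul_def, map_smul, smul_eq_mul]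
  rcases eq_or_ne j 0 with rfl | hj
  · obtain ⟨c, hc⟩ := IsConnected.grading_zero (A := A) b b.2
    rw [← hc, augLinear_algebraMap, ← Algebra.commutes, ← Algebra.smul_def, map_smul, smul_eq_mul,
      mul_comm]
  rw [augLinear_of_ne A hi a.2, zero_mul]
  rcases eq_or_ne (i + j) 0 with hij | hij
  · rcases lt_or_gt_of_ne hi with h | h
    · have : (a : A) = 0 := by
        rw [← Submodule.mem_bot k, ← IsConnected.grading_neg i h]; exact a.2
      rw [this, zero_mul, map_zero]
    · have : (b : A) = 0 := by
        rw [← Submodule.mem_bot k, ← IsConnected.grading_neg j (by omega)]; exact b.2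
      rw [this, mul_zero, map_zero]
  · exact augLinear_of_ne A hij (SetLike.mul_mem_graded a.2 b.2)

/-- The augmentation of a connected differential graded algebra: the projection to the component
of degree `0`, with kernel the maximal ideal of elements without component of degree `0`. -/
def aug : A →ₐ[k] k :=
  AlgHom.ofLinearMap A.augLinear
    (by rw [← map_one (algebraMap k A), augLinear_algebraMap]) A.augLinear_mul

/-- The field `k` as a graded vector space concentrated in degree `0`. -/
def trivialGrading (k : Type u) [Field k] (n : ℤ) : Submodule k k := if n = 0 then ⊤ else ⊥

instance (k : Type u) [Field k] : DirectSum.Decomposition (trivialGrading k) :=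
  DirectSum.Decomposition.ofLinearMap _
    (DirectSum.lof k ℤ (fun n => trivialGrading k n) 0 ∘ₗ
      LinearMap.codRestrict (trivialGrading k 0) LinearMap.id (fun c => by simp [trivialGrading]))
    (by ext; simp)
    (by
      ext n ⟨x, hx⟩ : 2
      simp only [LinearMap.comp_apply, DirectSum.coeLinearMap_lof, LinearMap.id_apply]
      rcases eq_or_ne n 0 with rfl | hn
      · rfl
      · have h0 : x = 0 := by simpa [trivialGrading, hn] using hx
        subst h0
        rw [map_zero, map_zero]
        exact (map_zero _).symm)

/-- The trivial left differential graded module `k` over a connected differential graded algebra: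
it is concentrated in degree `0`, and `A` acts through its augmentation. -/
abbrev trivialModule : DGModule A where
  carrier := k
  moduleA := Module.compHom k A.aug.toRingHom
  tower := by
    let _ := Module.compHom k A.aug.toRingHom
    refine ⟨fun r a c => ?_⟩
    change A.aug (r • a) * c = r • (A.aug a * c)
    rw [map_smul, smul_mul_assoc]
  grading := trivialGrading k
  smul_mem {i j a c} ha hc := by
    change A.aug a * c ∈ _
    rcases eq_or_ne j 0 with rfl | hj
    · rcases eq_or_ne i 0 with rfl | hi
      · simp [trivialGrading]
      · rw [show A.aug a = 0 from augLinear_of_ne A hi ha, zero_mul]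
        exact Submodule.zero_mem _
    · have h0 : c = 0 := by simpa [trivialGrading, hj] using hc
      rw [h0, mul_zero]
      exact Submodule.zero_mem _
  d := 0
  d_mem _ := Submodule.zero_mem _
  d_d _ := rfl
  leibniz {n a} c ha := by
    change (0 : k) = A.aug (A.d a) * c + (-1 : k) ^ n • (A.aug a * 0)
    have h : A.aug (A.d a) = 0 := by
      rcases eq_or_ne (n + 1) 0 with hn | hn
      · rw [IsConnected.grading_neg n (by omega), Submodule.mem_bot] at ha
        rw [ha, map_zero, map_zero]
      · exact augLinear_of_ne A hn (A.d_mem ha)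
    rw [h]; simp

end DGAlgebra

/-! ### Morphisms, cohomology, and semi-free resolutions -/

section Modules

variable {k : Type u} [Field k] {A : DGAlgebra k}

/-- A morphism of differential graded modules. -/
structure DGHom (M N : DGModule A) where
  toLinearMap : M →ₗ[A] N
  map_mem : ∀ {n : ℤ} {x : M}, x ∈ M.grading n → toLinearMap x ∈ N.grading n
  comm : ∀ x : M, toLinearMap (M.d x) = N.d (toLinearMap x)

namespace DGModule

/-- The cohomology `ker ∂ / im ∂` of a differential graded module. -/
abbrev Cohomology (M : DGModule A) : Type u :=
  LinearMap.ker M.d ⧸ (LinearMap.range M.d).submoduleOf (LinearMap.ker M.d)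

end DGModule

namespace DGHom

variable {M N : DGModule A} (f : DGHom M N)

/-- The map induced by a morphism on cocycles. -/
def mapCocycles : LinearMap.ker M.d →ₗ[k] LinearMap.ker N.d :=
  (f.toLinearMap.restrictScalars k).restrict fun x hx => by
    rw [LinearMap.mem_ker] at hx ⊢
    rw [LinearMap.restrictScalars_apply, ← f.comm, hx, map_zero]

/-- The map induced by a morphism on cohomology. -/
def mapCohomology : M.Cohomology →ₗ[k] N.Cohomology :=
  Submodule.mapQ _ _ f.mapCocycles (by
    rintro ⟨x, hx⟩ ⟨y, rfl⟩
    exact ⟨f.toLinearMap y, (f.comm y).symm⟩)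

/-- A quasi-isomorphism is a morphism that induces an isomorphism on cohomology. -/
def IsQuasiIso : Prop := Function.Bijective f.mapCohomology

end DGHom

/-- The `A`-basis `b` of `F`, with `b i` homogeneous of degree `deg i`, is a semi-basis: it is a
disjoint union of subsets `E⁰, E¹, …` such that `∂` vanishes on `E⁰` and maps `Eᵘ` to the submodule
spanned by the `Eᵛ` with `v < u`. The function `r` sends an index to the number of its subset. -/
structure IsSemiBasis {F : DGModule A} {I : Type u} (b : Module.Basis I A F) (deg : I → ℤ) :
    Prop where
  mem_grading : ∀ i, b i ∈ F.grading (deg i)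
  filtration : ∃ r : I → ℕ, ∀ i, F.d (b i) ∈ Submodule.span A {x | ∃ j, r j < r i ∧ x = b j}

/-- A differential graded module is semi-free if it has a semi-basis. -/
def DGModule.IsSemiFree (F : DGModule A) : Prop :=
  ∃ (I : Type u) (b : Module.Basis I A F) (deg : I → ℤ), IsSemiBasis b deg

/-- `ε : F → M` is a semi-free resolution of `M`. -/
structure IsSemiFreeResolution {F M : DGModule A} (ε : DGHom F M) : Prop where
  semiFree : F.IsSemiFree
  quasiIso : ε.IsQuasiIso

/-- `F` is minimal: `∂ F ⊆ 𝔪 F`, where `𝔪` is the ideal of elements of positive degree. -/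
def DGModule.IsMinimal (F : DGModule A) : Prop :=
  ∀ x : F, F.d x ∈ Submodule.span k {y : F | ∃ n : ℤ, 0 < n ∧ ∃ a ∈ A.grading n, ∃ z : F,
    y = a • z}

/-! ### The complex of homomorphisms -/

/-- The homomorphisms of degree `n` of graded modules, with `f (a x) = (-1) ^ (n |a|) a f x`. -/
def homDeg (M N : DGModule A) (n : ℤ) : Submodule k (M →ₗ[k] N) where
  carrier := {f | (∀ (i : ℤ), ∀ x ∈ M.grading i, f x ∈ N.grading (i + n)) ∧
    ∀ (i : ℤ), ∀ a ∈ A.grading i, ∀ x : M, f (a • x) = (-1 : k) ^ (n * i) • (a • f x)}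
  zero_mem' := ⟨fun _ _ _ => Submodule.zero_mem _, fun _ _ _ _ => by simp⟩
  add_mem' hf hg := ⟨fun i x hx => Submodule.add_mem _ (hf.1 i x hx) (hg.1 i x hx),
    fun i a ha x => by
      rw [LinearMap.add_apply, LinearMap.add_apply, hf.2 i a ha, hg.2 i a ha, smul_add, smul_add]⟩
  smul_mem' c f hf := ⟨fun i x hx => Submodule.smul_mem _ _ (hf.1 i x hx), fun i a ha x => by
    rw [LinearMap.smul_apply, LinearMap.smul_apply, hf.2 i a ha, smul_comm c, smul_comm c a]⟩

/-- The formula `f ↦ ∂ f - (-1) ^ n f ∂` for the differential on homomorphisms of degree `n`. -/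
def homDiff (M N : DGModule A) (n : ℤ) : (M →ₗ[k] N) →ₗ[k] (M →ₗ[k] N) :=
  LinearMap.llcomp k M N N N.d - (-1 : k) ^ n • LinearMap.lcomp k N M.d

theorem homDiff_apply (M N : DGModule A) (n : ℤ) (f : M →ₗ[k] N) :
    homDiff M N n f = N.d ∘ₗ f - (-1 : k) ^ n • (f ∘ₗ M.d) := rfl

theorem homDiff_mem {M N : DGModule A} {n : ℤ} {f : M →ₗ[k] N} (hf : f ∈ homDeg M N n) :
    homDiff M N n f ∈ homDeg M N (n + 1) := by
  refine ⟨fun i x hx => ?_, fun i a ha x => ?_⟩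
  · rw [homDiff_apply]
    refine Submodule.sub_mem _ ?_ (Submodule.smul_mem _ _ ?_)
    · rw [← add_assoc]; exact N.d_mem (hf.1 i x hx)
    · rw [add_comm n, ← add_assoc]; exact hf.1 _ _ (M.d_mem hx)
  · simp only [homDiff_apply, LinearMap.sub_apply, LinearMap.comp_apply, LinearMap.smul_apply]
    rw [M.leibniz x ha, map_add, LinearMap.map_smul f, hf.2 i a ha, hf.2 _ _ (A.d_mem ha),
      hf.2 i a ha, LinearMap.map_smul N.d, N.leibniz _ ha]
    simp only [smul_sub, smul_add, smul_smul, smul_comm a]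
    have h₁ : (-1 : k) ^ n * (-1 : k) ^ (n * (i + 1)) = (-1 : k) ^ (n * i) := by
      rw [mul_add, mul_one, sign_add]
      linear_combination (-1 : k) ^ (n * i) * sign_sq (k := k) n
    have h₂ : (-1 : k) ^ ((n + 1) * i) = (-1 : k) ^ (n * i) * (-1 : k) ^ i := by
      rw [← sign_add]; congr 1; ring
    have h₃ : (-1 : k) ^ n * ((-1 : k) ^ i * (-1 : k) ^ (n * i)) =
      (-1 : k) ^ (n * i) * (-1 : k) ^ i * (-1 : k) ^ n := by ring
    rw [h₁, h₂, h₃]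
    abel

theorem homDiff_homDiff (M N : DGModule A) (n : ℤ) (f : M →ₗ[k] N) :
    homDiff M N (n + 1) (homDiff M N n f) = 0 := by
  ext x
  simp only [homDiff_apply, LinearMap.sub_apply, LinearMap.comp_apply, LinearMap.smul_apply,
    map_sub, map_smul, N.d_d, M.d_d, map_zero, smul_zero, LinearMap.zero_apply, sign_add]
  simp

/-- The cocycles of degree `n` in the complex of homomorphisms. -/
def homCocycles (M N : DGModule A) (n : ℤ) : Submodule k (M →ₗ[k] N) :=
  homDeg M N n ⊓ LinearMap.ker (homDiff M N n)

/-- The coboundaries of degree `n` in the complex of homomorphisms. -/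
def homCoboundaries (M N : DGModule A) (n : ℤ) : Submodule k (M →ₗ[k] N) :=
  (homDeg M N (n - 1)).map (homDiff M N (n - 1))

/-- The cohomology `Hⁿ(Hom_A(M, N))`. -/
abbrev HomCohomology (M N : DGModule A) (n : ℤ) : Type u :=
  homCocycles M N n ⧸ (homCoboundaries M N n).submoduleOf (homCocycles M N n)

/-- The map `Hⁿ(Hom_A(M, N)) → Hⁿ(Hom_A(M, N'))` induced by a morphism `N → N'`. -/
def homCohomologyMap (M : DGModule A) {N N' : DGModule A} (g : DGHom N N') (n : ℤ) :
    HomCohomology M N n →ₗ[k] HomCohomology M N' n :=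
  let φ : (M →ₗ[k] N) →ₗ[k] (M →ₗ[k] N') :=
    LinearMap.llcomp k M N N' (g.toLinearMap.restrictScalars k)
  have hφ (m : ℤ) (f : M →ₗ[k] N) (hf : f ∈ homDeg M N m) : φ f ∈ homDeg M N' m :=
    ⟨fun i x hx => g.map_mem (hf.1 i x hx), fun i a ha x => by
      change g.toLinearMap (f (a • x)) = (-1 : k) ^ (m * i) • (a • g.toLinearMap (f x))
      rw [hf.2 i a ha, ← map_smul g.toLinearMap]
      exact (g.toLinearMap.restrictScalars k).map_smul _ _⟩
  have hd (m : ℤ) (f : M →ₗ[k] N) : homDiff M N' m (φ f) = φ (homDiff M N m f) := by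
    ext x
    change N'.d (g.toLinearMap (f x)) - (-1 : k) ^ m • (g.toLinearMap (f (M.d x))) =
      (g.toLinearMap.restrictScalars k) (N.d (f x) - (-1 : k) ^ m • f (M.d x))
    rw [map_sub, map_smul, ← g.comm]; rfl
  Submodule.mapQ _ _
    (φ.restrict (p := homCocycles M N n) (q := homCocycles M N' n) fun f hf => by
      refine ⟨hφ n f hf.1, ?_⟩
      exact ((hd n f).trans (congrArg φ (LinearMap.mem_ker.1 hf.2))).trans (map_zero φ))
    (by
      rintro ⟨f, hf⟩ ⟨h, hh, hfh⟩
      refine ⟨φ h, hφ _ h hh, ?_⟩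
      rw [hd, hfh]; rfl)

end Modules

/-! ### Direct sums and compact modules -/

section Compact

variable {k : Type u} [Field k] {A : DGAlgebra k} {ι : Type u} (N : ι → DGModule A)

/-- The grading on a direct sum of differential graded modules. -/
def sumGrading (n : ℤ) : Submodule k (⨁ i, N i) where
  carrier := {x | ∀ i, x i ∈ (N i).grading n}
  zero_mem' _ := Submodule.zero_mem _
  add_mem' hx hy i := Submodule.add_mem _ (hx i) (hy i)
  smul_mem' c _ hx i := Submodule.smul_mem _ c (hx i)

open Classical in
theorem lof_mem_sumGrading {n : ℤ} (i : ι) {x : N i} (hx : x ∈ (N i).grading n) :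
    DirectSum.lof k ι (fun i => N i) i x ∈ sumGrading N n := by
  intro j
  rcases eq_or_ne i j with rfl | h
  · rw [DirectSum.lof_apply]; exact hx
  · rw [DirectSum.lof_eq_of, DirectSum.of_eq_of_ne _ _ _ h.symm]; exact Submodule.zero_mem _

open Classical in
instance : DirectSum.Decomposition (sumGrading N) :=
  let ψ (i : ι) (n : ℤ) : (N i).grading n →ₗ[k] sumGrading N n :=
    (DirectSum.lof k ι (fun i => N i) i).restrict fun _ hx => lof_mem_sumGrading N i hx
  let dec : (⨁ i, N i) →ₗ[k] ⨁ n, sumGrading N n :=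
    DirectSum.toModule k ι _ fun i =>
      DirectSum.toModule k ℤ _ (fun n => DirectSum.lof k ℤ (fun n => sumGrading N n) n ∘ₗ ψ i n) ∘ₗ
        (DirectSum.decomposeLinearEquiv (N i).grading).toLinearMap
  have hdec (i : ι) (n : ℤ) (x : N i) (hx : x ∈ (N i).grading n) :
      dec (DirectSum.lof k ι (fun i => N i) i x) =
        DirectSum.lof k ℤ (fun n => sumGrading N n) n
          ⟨DirectSum.lof k ι (fun i => N i) i x, lof_mem_sumGrading N i hx⟩ := by
    lift x to (N i).grading n using hx
    simp only [dec, DirectSum.toModule_lof, LinearMap.comp_apply, LinearEquiv.coe_coe,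
      DirectSum.decomposeLinearEquiv_apply, DirectSum.decompose_coe]
    rw [← DirectSum.lof_eq_of k, DirectSum.toModule_lof]
    rfl
  DirectSum.Decomposition.ofLinearMap _ dec
    (by
      refine DirectSum.linearMap_ext k fun i => LinearMap.ext fun x => ?_
      refine DGAlgebra.hom_induction (N i).grading
        (f := (DirectSum.coeLinearMap (sumGrading N) ∘ₗ dec) ∘ₗ
          DirectSum.lof k ι (fun i => N i) i)
        (g := LinearMap.id ∘ₗ DirectSum.lof k ι (fun i => N i) i) (fun n x hx => ?_) x
      simp only [LinearMap.comp_apply]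
      rw [hdec i n x hx, DirectSum.coeLinearMap_lof]
      rfl)
    (by
      ext n ⟨x, hx⟩ : 2
      simp only [LinearMap.comp_apply, DirectSum.coeLinearMap_lof, LinearMap.id_apply]
      have hx' : x = ∑ i ∈ DFinsupp.support x, DirectSum.lof k ι (fun i => N i) i (x i) :=
        (DirectSum.sum_support_of x).symm
      have hs : (⟨x, hx⟩ : sumGrading N n) = ∑ i ∈ DFinsupp.support x,
          ⟨DirectSum.lof k ι (fun i => N i) i (x i), lof_mem_sumGrading N i (hx i)⟩ := by
        ext1
        rw [AddSubmonoidClass.coe_finsetSum]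
        exact hx'
      rw [hs, map_sum]
      refine (congrArg dec hx').trans ((map_sum dec _ _).trans ?_)
      exact Finset.sum_congr rfl fun i _ => hdec i n (x i) (hx i))

/-- The direct sum of a family of differential graded modules. -/
abbrev directSum : DGModule A where
  carrier := ⨁ i, N i
  tower := ⟨fun r a x => by ext i; exact smul_assoc r a (x i)⟩
  grading := sumGrading N
  smul_mem ha hx i := (N i).smul_mem ha (hx i)
  d := DFinsupp.mapRange.linearMap fun i => (N i).d
  d_mem hx i := (N i).d_mem (hx i)
  d_d x := by ext i; exact (N i).d_d (x i)
  leibniz x ha := by ext i; exact (N i).leibniz (x i) ha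

open Classical in
/-- The inclusion of a summand in a direct sum. -/
def directSumIncl (i : ι) : DGHom (N i) (directSum N) where
  toLinearMap := DirectSum.lof A ι (fun i => N i) i
  map_mem hx := lof_mem_sumGrading N i hx
  comm x := by
    change DFinsupp.single i _ = DFinsupp.mapRange.linearMap (fun i => (N i).d)
      (DFinsupp.single i x)
    exact (DFinsupp.mapRange_single (hf := fun i => map_zero (N i).d)).symm

open Classical in
/-- `M` is a compact object of the derived category `D(A)`: morphisms in `D(A)` from `M` to `N` are
the elements of `H⁰(Hom_A(F, N))` for a semi-free resolution `F` of `M`, and the functor that they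
define preserves all coproducts. -/
def DGModule.IsCompact (M : DGModule A) : Prop :=
  ∃ (F : DGModule A) (ε : DGHom F M), IsSemiFreeResolution ε ∧
    ∀ (ι : Type u) (N : ι → DGModule A),
      Function.Bijective (DirectSum.toModule k ι (HomCohomology F (directSum N) 0) fun i =>
        homCohomologyMap F (directSumIncl N i) 0)

end Compact

/-! ### The cohomology algebra -/

namespace DGAlgebra

section CohomologyAlgebra

variable {k : Type u} [Field k] (A : DGAlgebra k)

theorem leibniz_signTwist (a b : A) :
    A.d (a * b) = A.d a * b + signTwist A.grading 1 a * A.d b := by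
  refine hom_induction A.grading (f := A.d ∘ₗ LinearMap.mulRight k b)
    (g := LinearMap.mulRight k b ∘ₗ A.d + LinearMap.mulRight k (A.d b) ∘ₗ signTwist A.grading 1)
    (fun n a ha => ?_) a
  simp only [LinearMap.comp_apply, LinearMap.add_apply, LinearMap.mulRight_apply]
  rw [A.leibniz b ha, signTwist_of_mem A.grading ha, one_mul, Algebra.smul_mul_assoc]

theorem d_signTwist (a : A) : A.d (signTwist A.grading 1 a) = - signTwist A.grading 1 (A.d a) := by
  refine hom_induction A.grading (f := A.d ∘ₗ signTwist A.grading 1)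
    (g := - (signTwist A.grading 1 ∘ₗ A.d)) (fun n a ha => ?_) a
  simp only [LinearMap.comp_apply, LinearMap.neg_apply]
  rw [signTwist_of_mem A.grading ha, signTwist_of_mem A.grading (A.d_mem ha), map_smul, one_mul,
    one_mul, sign_add]
  simp

theorem signTwist_signTwist (a : A) : signTwist A.grading 1 (signTwist A.grading 1 a) = a := by
  refine hom_induction A.grading (f := signTwist A.grading 1 ∘ₗ signTwist A.grading 1)
    (g := LinearMap.id) (fun n a ha => ?_) a
  rw [LinearMap.comp_apply, signTwist_of_mem A.grading ha, map_smul,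
    signTwist_of_mem A.grading ha, smul_smul, sign_sq, one_smul, LinearMap.id_apply]

theorem d_one : A.d 1 = 0 := by
  have h := A.leibniz (n := 0) (1 : A) (SetLike.one_mem_graded A.grading)
  simpa using h

/-- The subalgebra of cocycles. -/
def cocycles : Subalgebra k A where
  carrier := {a | A.d a = 0}
  mul_mem' {a b} ha hb := by
    change A.d (a * b) = 0
    rw [leibniz_signTwist, show A.d a = 0 from ha, show A.d b = 0 from hb, zero_mul, mul_zero,
      add_zero]
  add_mem' {a b} ha hb := by
    change A.d (a + b) = 0
    rw [map_add, show A.d a = 0 from ha, show A.d b = 0 from hb, add_zero]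
  algebraMap_mem' r := by
    change A.d (algebraMap k A r) = 0
    rw [Algebra.algebraMap_eq_smul_one, map_smul, d_one, smul_zero]

/-- The ideal of coboundaries in the algebra of cocycles. -/
def coboundaries : Ideal A.cocycles where
  carrier := {z | ∃ x : A, A.d x = z}
  add_mem' := by
    rintro a b ⟨x, hx⟩ ⟨y, hy⟩
    exact ⟨x + y, by rw [map_add, hx, hy]; rfl⟩
  zero_mem' := ⟨0, by rw [map_zero]; rfl⟩
  smul_mem' := by
    rintro ⟨c, hc⟩ ⟨z, hz⟩ ⟨x, hx⟩
    refine ⟨signTwist A.grading 1 c * x, ?_⟩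
    have hx' : A.d x = z := hx
    rw [leibniz_signTwist, d_signTwist, show A.d c = 0 from hc, signTwist_signTwist, hx', map_zero,
      neg_zero, zero_mul, zero_add]
    rfl

instance : A.coboundaries.IsTwoSided where
  mul_mem_of_left := by
    rintro ⟨z, hz⟩ ⟨c, hc⟩ ⟨x, hx⟩
    refine ⟨x * c, ?_⟩
    have hx' : A.d x = z := hx
    rw [leibniz_signTwist, show A.d c = 0 from hc, hx', mul_zero, add_zero]
    rfl

/-- The cohomology algebra `H(A) = ker ∂ / im ∂`. -/
def Cohomology : Type u := A.cocycles ⧸ A.coboundaries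

instance : Ring A.Cohomology := inferInstanceAs (Ring (A.cocycles ⧸ A.coboundaries))
instance : Algebra k A.Cohomology :=
  inferInstanceAs (Algebra k (A.cocycles ⧸ A.coboundaries))

/-- The cohomology class of a cocycle. -/
def cohomologyClass (z : A) (hz : A.d z = 0) : A.Cohomology :=
  Ideal.Quotient.mk A.coboundaries ⟨z, hz⟩

end CohomologyAlgebra

end DGAlgebra

/-! ### The endomorphism algebra of a differential graded module -/

section EndAlgebra

variable {k : Type u} [Field k]

section ExternalGrading

variable {R : Type u} [Ring R] [Algebra k R] (S : ℤ → Submodule k R) [SetLike.GradedMonoid S]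

/-- The external direct sum of the components of a graded family of subspaces of an algebra. -/
def ExtSum : Type u := ⨁ n, S n

instance : Ring (ExtSum S) := inferInstanceAs (Ring (⨁ n, S n))
instance : Algebra k (ExtSum S) := inferInstanceAs (Algebra k (⨁ n, S n))

/-- The inclusion of a component in the external direct sum. -/
def extOf (n : ℤ) : S n →ₗ[k] ExtSum S where
  toFun x := DirectSum.of (fun n => S n) n x
  map_add' x y := map_add (DirectSum.of (fun n => S n) n) x y
  map_smul' c x := (DirectSum.lof k ℤ (fun n => S n) n).map_smul c x

theorem extOf_mul {m n : ℤ} (x : S m) (y : S n) (h : (x : R) * (y : R) ∈ S (m + n)) :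
    extOf S m x * extOf S n y = extOf S (m + n) ⟨(x : R) * y, h⟩ := by
  have e : DirectSum.of (fun n => S n) m x * DirectSum.of (fun n => S n) n y =
      DirectSum.of (fun n => S n) (m + n) ⟨(x : R) * y, h⟩ := by
    rw [DirectSum.of_mul_of]; rfl
  exact e

theorem extOf_one : extOf S 0 ⟨1, SetLike.one_mem_graded S⟩ = 1 := rfl

theorem extOf_congr {m n : ℤ} (h : m = n) {x y : R} (hxy : x = y) (hx : x ∈ S m) (hy : y ∈ S n) :
    extOf S m ⟨x, hx⟩ = extOf S n ⟨y, hy⟩ := by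
  subst h hxy; rfl

variable {S} in
/-- The linear map on an external direct sum defined by linear maps on the components. -/
def extLift {M : Type u} [AddCommMonoid M] [Module k M] (f : ∀ n, S n →ₗ[k] M) :
    ExtSum S →ₗ[k] M where
  toFun x := DirectSum.toModule k ℤ M f x
  map_add' x y := map_add (DirectSum.toModule k ℤ M f) x y
  map_smul' c x := (DirectSum.toModule k ℤ M f).map_smul c x

theorem extLift_extOf {M : Type u} [AddCommMonoid M] [Module k M] (f : ∀ n, S n →ₗ[k] M) {n : ℤ}
    (x : S n) : extLift f (extOf S n x) = f n x :=
  DirectSum.toModule_lof k (M := fun n => S n) (φ := f) n x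

variable {S} in
theorem ext_induction {M : Type u} [AddCommMonoid M] [Module k M] {f g : ExtSum S →ₗ[k] M}
    (h : ∀ n x, f (extOf S n x) = g (extOf S n x)) (x : ExtSum S) : f x = g x := by
  induction x using DirectSum.induction_on with
  | zero => exact (map_zero f).trans (map_zero g).symm
  | of n x => exact h n x
  | add x y hx hy => exact (map_add f x y).trans ((congrArg₂ _ hx hy).trans (map_add g x y).symm)

/-- The grading of an external direct sum. -/
def extGrading (n : ℤ) : Submodule k (ExtSum S) := LinearMap.range (extOf S n)

instance : SetLike.GradedMonoid (extGrading S) where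
  one_mem := ⟨_, extOf_one S⟩
  mul_mem := by
    rintro m n _ _ ⟨x, rfl⟩ ⟨y, rfl⟩
    exact ⟨_, (extOf_mul S x y (SetLike.mul_mem_graded x.2 y.2)).symm⟩

instance : DirectSum.Decomposition (extGrading S) :=
  DirectSum.Decomposition.ofLinearMap _
    (extLift fun n => DirectSum.lof k ℤ (fun n => extGrading S n) n ∘ₗ
      (extOf S n).codRestrict (extGrading S n) fun x => ⟨x, rfl⟩)
    (by
      refine LinearMap.ext fun x => ext_induction (fun n x => ?_) x
      rw [LinearMap.comp_apply, extLift_extOf, LinearMap.comp_apply, DirectSum.coeLinearMap_lof]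
      rfl)
    (by
      refine DirectSum.linearMap_ext k fun n => LinearMap.ext ?_
      rintro ⟨_, x, rfl⟩
      rw [LinearMap.comp_apply, LinearMap.comp_apply, DirectSum.coeLinearMap_lof, extLift_extOf]
      rfl)

instance : GradedAlgebra (extGrading S) where

end ExternalGrading

variable {A : DGAlgebra k} (F : DGModule A)

/-- The endomorphisms of degree `n`, inside the algebra of all linear endomorphisms. -/
abbrev endDeg (n : ℤ) : Submodule k (Module.End k F) := homDeg F F n

instance : SetLike.GradedMonoid (endDeg F) where
  one_mem := ⟨fun i x hx => by rw [add_zero]; exact hx, fun i a _ x => by simp⟩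
  mul_mem m n f g hf hg := by
    refine ⟨fun i x hx => ?_, fun i a ha x => ?_⟩
    · rw [add_comm m, ← add_assoc]
      exact hf.1 _ _ (hg.1 i x hx)
    · change f (g (a • x)) = (-1 : k) ^ ((m + n) * i) • (a • f (g x))
      rw [hg.2 i a ha, LinearMap.map_smul f, hf.2 i a ha, smul_smul, add_mul, add_comm, sign_add]

/-- The graded algebra of endomorphisms `⨁ n, Homⁿ_A(F, F)`, whose product is composition. -/
abbrev EndCarrier : Type u := ExtSum (endDeg F)

/-- The differential on the algebra of endomorphisms. -/
def endD : EndCarrier F →ₗ[k] EndCarrier F :=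
  extLift fun n => extOf (endDeg F) (n + 1) ∘ₗ
    (homDiff F F n).restrict fun _ hf => homDiff_mem hf

theorem endD_extOf {n : ℤ} {f : Module.End k F} (hf : f ∈ endDeg F n) :
    endD F (extOf (endDeg F) n ⟨f, hf⟩) =
      extOf (endDeg F) (n + 1) ⟨homDiff F F n f, homDiff_mem hf⟩ := by
  rw [endD, extLift_extOf]
  rfl

theorem endDeg_mul_mem {m n : ℤ} {f g : Module.End k F} (hf : f ∈ endDeg F m)
    (hg : g ∈ endDeg F n) : f * g ∈ endDeg F (m + n) :=
  SetLike.mul_mem_graded (A := endDeg F) hf hg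

/-- The differential graded algebra `Hom_A(F, F)` of endomorphisms of `F`. -/
abbrev endAlgebra : DGAlgebra k where
  carrier := EndCarrier F
  grading := extGrading (endDeg F)
  d := endD F
  d_mem := by
    rintro n _ ⟨⟨f, hf⟩, rfl⟩
    rw [endD_extOf]
    exact ⟨_, rfl⟩
  d_d x := by
    refine ext_induction (f := endD F ∘ₗ endD F) (g := 0) (fun n x => ?_) x
    obtain ⟨f, hf⟩ := x
    rw [LinearMap.comp_apply, endD_extOf, endD_extOf, LinearMap.zero_apply]
    exact (congrArg (extOf (endDeg F) (n + 1 + 1))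
      (Subtype.ext (homDiff_homDiff F F n f))).trans (map_zero _)
  leibniz := by
    rintro m _ y ⟨⟨f, hf⟩, rfl⟩
    refine ext_induction (f := endD F ∘ₗ LinearMap.mulLeft k (extOf (endDeg F) m ⟨f, hf⟩))
      (g := LinearMap.mulLeft k (endD F (extOf (endDeg F) m ⟨f, hf⟩)) +
        (-1 : k) ^ m • (LinearMap.mulLeft k (extOf (endDeg F) m ⟨f, hf⟩) ∘ₗ endD F))
      (fun n x => ?_) y
    obtain ⟨g, hg⟩ := x
    have hDf : homDiff F F m f ∈ endDeg F (m + 1) := homDiff_mem hf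
    have hDg : homDiff F F n g ∈ endDeg F (n + 1) := homDiff_mem hg
    simp only [LinearMap.comp_apply, LinearMap.add_apply, LinearMap.smul_apply,
      LinearMap.mulLeft_apply]
    rw [endD_extOf F hf, endD_extOf F hg, extOf_mul _ _ _ (endDeg_mul_mem F hf hg),
      extOf_mul _ _ _ (endDeg_mul_mem F hDf hg), extOf_mul _ _ _ (endDeg_mul_mem F hf hDg),
      endD_extOf F (endDeg_mul_mem F hf hg)]
    have h₁ : m + 1 + n = m + n + 1 := by ring
    have h₂ : m + (n + 1) = m + n + 1 := by ring
    rw [extOf_congr (endDeg F) h₁ rfl (endDeg_mul_mem F hDf hg)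
      (h₁ ▸ endDeg_mul_mem F hDf hg), extOf_congr (endDeg F) h₂ rfl (endDeg_mul_mem F hf hDg)
      (h₂ ▸ endDeg_mul_mem F hf hDg), ← map_smul, ← map_add]
    congr 1
    refine Subtype.ext (LinearMap.ext fun x => ?_)
    change F.d (f (g x)) - (-1 : k) ^ (m + n) • f (g (F.d x)) =
      (F.d (f (g x)) - (-1 : k) ^ m • f (F.d (g x))) +
        (-1 : k) ^ m • f (F.d (g x) - (-1 : k) ^ n • g (F.d x))
    rw [map_sub, map_smul, smul_sub, smul_smul, sign_add]
    abel

end EndAlgebra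

/-! ### Homological properties of connected differential graded algebras -/

/-- A finite-dimensional algebra is Frobenius if it carries a nondegenerate associative bilinear
form. -/
def IsFrobenius (k E : Type u) [Field k] [Ring E] [Algebra k E] : Prop :=
  FiniteDimensional k E ∧ ∃ B : E →ₗ[k] E →ₗ[k] k, B.Nondegenerate ∧
    ∀ x y z : E, B (x * y) z = B x (y * z)

namespace DGAlgebra

variable {k : Type u} [Field k] (A : DGAlgebra k)

/-- `A` is Koszul: the trivial module `k` has a minimal semi-free resolution with a semi-basis
concentrated in degree `0`. -/
def IsKoszul [A.IsConnected] : Prop :=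
  ∃ (F : DGModule A) (ε : DGHom F A.trivialModule), ε.IsQuasiIso ∧ F.IsMinimal ∧
    ∃ (I : Type u) (b : Module.Basis I A F), IsSemiBasis b fun _ => 0

/-- `A` is homologically smooth: `A` is a compact object of the derived category of left
differential graded modules over the enveloping algebra of `A`. -/
def IsHomologicallySmooth : Prop := A.diagonal.IsCompact

/-- `A` is left Gorenstein: the total dimension of `H(RHom_A(k, A))` is `1`, where
`RHom_A(k, A) = Hom_A(F, A)` for a semi-free resolution `F` of the trivial module `k`. -/
def IsLeftGorenstein [A.IsConnected] : Prop :=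
  ∃ (F : DGModule A) (ε : DGHom F A.trivialModule), IsSemiFreeResolution ε ∧
    Module.finrank k (⨁ n : ℤ, HomCohomology F A.regular n) = 1

/-- `A` is Gorenstein: both `A` and its opposite algebra are left Gorenstein. -/
def IsGorenstein [A.IsConnected] : Prop := A.IsLeftGorenstein ∧ A.op.IsLeftGorenstein

end DGAlgebra

/-! ### Differential graded free algebras -/

section Free

variable (k : Type u) [Field k] (X : Type)

/-- The grading of the free algebra by the length of words: all generators have degree `1`. -/
def freeGrading (n : ℤ) : Submodule k (FreeAlgebra k X) :=
  Submodule.span k {w | ∃ l : List X, (l.length : ℤ) = n ∧ w = (l.map (FreeAlgebra.ι k)).prod}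

variable {X} in
theorem word_mem (l : List X) :
    (l.map (FreeAlgebra.ι k)).prod ∈ freeGrading k X (l.length : ℤ) :=
  Submodule.subset_span ⟨l, rfl, rfl⟩

variable {X} in
theorem ι_mem (x : X) : FreeAlgebra.ι k x ∈ freeGrading k X 1 :=
  Submodule.subset_span ⟨[x], rfl, by simp⟩

instance : SetLike.GradedMonoid (freeGrading k X) where
  one_mem := word_mem k []
  mul_mem m n x y hx hy := by
    induction hx using Submodule.span_induction with
    | zero => rw [zero_mul]; exact Submodule.zero_mem _
    | add x x' _ _ h h' => rw [add_mul]; exact Submodule.add_mem _ h h'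
    | smul r x _ h => rw [smul_mul_assoc]; exact Submodule.smul_mem _ _ h
    | mem x hx =>
    induction hy using Submodule.span_induction with
    | zero => rw [mul_zero]; exact Submodule.zero_mem _
    | add x x' _ _ h h' => rw [mul_add]; exact Submodule.add_mem _ h h'
    | smul r x _ h => rw [mul_smul_comm]; exact Submodule.smul_mem _ _ h
    | mem y hy =>
    obtain ⟨l, rfl, rfl⟩ := hx
    obtain ⟨l', rfl, rfl⟩ := hy
    exact Submodule.subset_span ⟨l ++ l', by simp, by simp⟩

/-- The decomposition of an element of the free algebra into homogeneous components. -/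
def freeDecompose : FreeAlgebra k X →ₐ[k] ⨁ n, freeGrading k X n :=
  FreeAlgebra.lift k fun x =>
    DirectSum.of (fun n => freeGrading k X n) 1 ⟨FreeAlgebra.ι k x, ι_mem k x⟩

variable {X} in
theorem freeDecompose_word (l : List X) :
    freeDecompose k X (l.map (FreeAlgebra.ι k)).prod =
      DirectSum.of (fun n => freeGrading k X n) (l.length : ℤ)
        ⟨(l.map (FreeAlgebra.ι k)).prod, word_mem k l⟩ := by
  induction l with
  | nil => exact map_one _
  | cons x l ih =>
    have e : ((x :: l).map (FreeAlgebra.ι k)).prod =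
        FreeAlgebra.ι k x * (l.map (FreeAlgebra.ι k)).prod := by simp
    refine (congrArg (freeDecompose k X) e).trans ?_
    rw [map_mul, ih, freeDecompose, FreeAlgebra.lift_ι_apply, DirectSum.of_mul_of]
    refine DirectSum.of_eq_of_gradedMonoid_eq (Sigma.subtype_ext ?_ ?_)
    · change (1 : ℤ) + (l.length : ℤ) = ((l.length + 1 : ℕ) : ℤ)
      push_cast; ring
    · exact e.symm

instance : GradedAlgebra (freeGrading k X) :=
  GradedAlgebra.ofAlgHom _ (freeDecompose k X)
    (by
      ext x
      simp only [AlgHom.comp_apply, Function.comp_apply, freeDecompose, FreeAlgebra.lift_ι_apply,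
        DirectSum.coeAlgHom_of, AlgHom.id_apply])
    (by
      rintro n ⟨w, hw⟩
      induction hw using Submodule.span_induction with
      | zero => exact (map_zero _).trans (map_zero _).symm
      | add x y hx hy h h' =>
        change freeDecompose k X (x + y) = _
        rw [map_add, h, h', ← map_add]; rfl
      | smul r x hx h =>
        change freeDecompose k X (r • x) = _
        rw [map_smul, h, ← DirectSum.lof_eq_of k, ← map_smul]; rfl
      | mem w hw =>
        obtain ⟨l, rfl, rfl⟩ := hw
        exact freeDecompose_word k l)

variable {X}

/-- The algebra homomorphism whose upper right entry is the differential given by `D` on the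
generators. -/
def freeDiffHom (D : X → FreeAlgebra k X) :
    FreeAlgebra k X →ₐ[k] Matrix (Fin 2) (Fin 2) (FreeAlgebra k X) :=
  FreeAlgebra.lift k fun x => !![-FreeAlgebra.ι k x, D x; 0, FreeAlgebra.ι k x]

/-- The differential on the free algebra with the values `D` on the generators. -/
def freeDiff (D : X → FreeAlgebra k X) : FreeAlgebra k X →ₗ[k] FreeAlgebra k X where
  toFun a := freeDiffHom k D a 0 1
  map_add' a b := by rw [map_add]; rfl
  map_smul' r a := by rw [map_smul]; rfl

theorem freeDiff_ι (D : X → FreeAlgebra k X) (x : X) : freeDiff k D (FreeAlgebra.ι k x) = D x := by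
  change freeDiffHom k D (FreeAlgebra.ι k x) 0 1 = _
  rw [freeDiffHom, FreeAlgebra.lift_ι_apply]; rfl

theorem freeDiff_one (D : X → FreeAlgebra k X) : freeDiff k D 1 = 0 := by
  change freeDiffHom k D 1 0 1 = _
  rw [map_one]; rfl

theorem freeDiff_ι_mul (D : X → FreeAlgebra k X) (x : X) (a : FreeAlgebra k X) :
    freeDiff k D (FreeAlgebra.ι k x * a) = D x * a - FreeAlgebra.ι k x * freeDiff k D a := by
  have h (a : FreeAlgebra k X) : freeDiffHom k D a 1 0 = 0 ∧ freeDiffHom k D a 1 1 = a := by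
    induction a using FreeAlgebra.induction with
    | grade0 r => rw [AlgHom.commutes]; simp [Matrix.algebraMap_matrix_apply]
    | grade1 x => rw [freeDiffHom, FreeAlgebra.lift_ι_apply]; simp
    | mul a b ha hb => rw [map_mul]; simp [Matrix.mul_apply, ha, hb]
    | add a b ha hb => rw [map_add]; simp [ha, hb]
  change freeDiffHom k D (FreeAlgebra.ι k x * a) 0 1 = _ * _ - _ * freeDiffHom k D a 0 1
  rw [map_mul, Matrix.mul_apply, Fin.sum_univ_two, (h a).2]
  rw [freeDiffHom, FreeAlgebra.lift_ι_apply]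
  simp [sub_eq_add_neg, add_comm]

theorem freeDiff_word_mul (D : X → FreeAlgebra k X) (l : List X) (b : FreeAlgebra k X) :
    freeDiff k D ((l.map (FreeAlgebra.ι k)).prod * b) =
      freeDiff k D (l.map (FreeAlgebra.ι k)).prod * b +
        (-1 : k) ^ (l.length : ℤ) • ((l.map (FreeAlgebra.ι k)).prod * freeDiff k D b) := by
  induction l with
  | nil => simp [freeDiff_one]
  | cons x l ih =>
    rw [List.map_cons, List.prod_cons, mul_assoc, freeDiff_ι_mul, ih, freeDiff_ι_mul, mul_add,
      sub_mul, mul_assoc, mul_assoc, mul_assoc, List.length_cons, Nat.cast_succ, sign_add,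
      mul_smul_comm]
    simp only [zpow_one, mul_neg, mul_one, neg_smul]
    abel

theorem freeDiff_mul (D : X → FreeAlgebra k X) {n : ℤ} {a : FreeAlgebra k X}
    (b : FreeAlgebra k X) (ha : a ∈ freeGrading k X n) :
    freeDiff k D (a * b) = freeDiff k D a * b + (-1 : k) ^ n • (a * freeDiff k D b) := by
  induction ha using Submodule.span_induction with
  | zero => simp
  | add x y hx hy h h' => rw [add_mul, map_add, h, h', map_add, add_mul, add_mul, smul_add]; abel
  | smul r x hx h =>
    rw [smul_mul_assoc, map_smul, h, map_smul, smul_mul_assoc, smul_mul_assoc, smul_add,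
      smul_comm r]
  | mem x hx =>
    obtain ⟨l, rfl, rfl⟩ := hx
    exact freeDiff_word_mul k D l b

theorem freeDiff_mem (D : X → FreeAlgebra k X) (hD : ∀ x, D x ∈ freeGrading k X 2) {n : ℤ}
    {a : FreeAlgebra k X} (ha : a ∈ freeGrading k X n) :
    freeDiff k D a ∈ freeGrading k X (n + 1) := by
  induction ha using Submodule.span_induction with
  | zero => rw [map_zero]; exact Submodule.zero_mem _
  | add x y hx hy h h' => rw [map_add]; exact Submodule.add_mem _ h h'
  | smul r x hx h => rw [map_smul]; exact Submodule.smul_mem _ _ h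
  | mem x hx =>
    obtain ⟨l, rfl, rfl⟩ := hx
    induction l with
    | nil => simp [freeDiff_one]
    | cons x l ih =>
      rw [List.map_cons, List.prod_cons, freeDiff_ι_mul, List.length_cons, Nat.cast_succ]
      refine Submodule.sub_mem _ ?_ ?_
      · have h := SetLike.mul_mem_graded (hD x) (word_mem k l)
        rwa [show (2 : ℤ) + (l.length : ℤ) = (l.length : ℤ) + 1 + 1 by ring] at h
      · have h := SetLike.mul_mem_graded (ι_mem k x) ih
        rwa [show (1 : ℤ) + ((l.length : ℤ) + 1) = (l.length : ℤ) + 1 + 1 by ring] at h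

theorem freeDiff_freeDiff (D : X → FreeAlgebra k X) (hD : ∀ x, D x ∈ freeGrading k X 2)
    (hDD : ∀ x, freeDiff k D (D x) = 0) (a : FreeAlgebra k X) :
    freeDiff k D (freeDiff k D a) = 0 := by
  refine DGAlgebra.hom_induction (freeGrading k X) (f := freeDiff k D ∘ₗ freeDiff k D) (g := 0)
    (fun n a ha => ?_) a
  simp only [LinearMap.comp_apply, LinearMap.zero_apply]
  induction ha using Submodule.span_induction with
  | zero => simp
  | add x y hx hy h h' => rw [map_add, map_add, h, h', add_zero]
  | smul r x hx h => rw [map_smul, map_smul, h, smul_zero]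
  | mem x hx =>
    obtain ⟨l, rfl, rfl⟩ := hx
    induction l with
    | nil => simp [freeDiff_one]
    | cons x l ih =>
      rw [List.map_cons, List.prod_cons, freeDiff_ι_mul, map_sub, freeDiff_mul k D _ (hD x), hDD,
        freeDiff_ι_mul, ih]
      simp

/-- The differential graded free algebra on generators of degree `1`, with the differential that
has the values `D` on the generators. -/
abbrev freeDGAlgebra (D : X → FreeAlgebra k X) (hD : ∀ x, D x ∈ freeGrading k X 2)
    (hDD : ∀ x, freeDiff k D (D x) = 0) : DGAlgebra k where
  carrier := FreeAlgebra k X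
  grading := freeGrading k X
  d := freeDiff k D
  d_mem := freeDiff_mem k D hD
  d_d := freeDiff_freeDiff k D hD hDD
  leibniz := freeDiff_mul k D

instance (D : X → FreeAlgebra k X) (hD : ∀ x, D x ∈ freeGrading k X 2)
    (hDD : ∀ x, freeDiff k D (D x) = 0) : (freeDGAlgebra k D hD hDD).IsConnected where
  nontrivial := inferInstanceAs (Nontrivial (FreeAlgebra k X))
  grading_neg n hn := by
    refine Submodule.span_eq_bot.2 ?_
    rintro w ⟨l, hl, -⟩
    omega
  grading_zero a ha := by
    induction ha using Submodule.span_induction with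
    | zero => exact ⟨0, map_zero _⟩
    | add x y hx hy h h' =>
      obtain ⟨c, rfl⟩ := h
      obtain ⟨c', rfl⟩ := h'
      exact ⟨c + c', map_add _ _ _⟩
    | smul r x hx h =>
      obtain ⟨c, rfl⟩ := h
      exact ⟨r * c, by rw [map_mul, Algebra.smul_def]⟩
    | mem x hx =>
      obtain ⟨l, hl, rfl⟩ := hx
      have : l = [] := List.length_eq_zero_iff.1 (by omega)
      subst this
      exact ⟨1, map_one _⟩

/-- The values on `x₁, x₂, x₃` (with indices `0, 1, 2`) of the differential
`∂x₁ = x₂x₃`, `∂x₂ = 0`, `∂x₃ = 0`. -/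
def exampleDiff : Fin 3 → FreeAlgebra k (Fin 3) :=
  ![FreeAlgebra.ι k 1 * FreeAlgebra.ι k 2, 0, 0]

theorem exampleDiff_mem (x : Fin 3) : exampleDiff k x ∈ freeGrading k (Fin 3) 2 := by
  have h := SetLike.mul_mem_graded (ι_mem k (1 : Fin 3)) (ι_mem k (2 : Fin 3))
  rw [one_add_one_eq_two] at h
  match x with
  | 0 => exact h
  | 1 => exact Submodule.zero_mem _
  | 2 => exact Submodule.zero_mem _

theorem freeDiff_exampleDiff (x : Fin 3) : freeDiff k (exampleDiff k) (exampleDiff k x) = 0 := by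
  have h : freeDiff k (exampleDiff k) (FreeAlgebra.ι k 1 * FreeAlgebra.ι k 2) = 0 := by
    rw [freeDiff_ι_mul, freeDiff_ι]
    simp [exampleDiff]
  match x with
  | 0 => exact h
  | 1 => exact map_zero _
  | 2 => exact map_zero _

/-- The differential graded free algebra `k⟨x₁, x₂, x₃⟩` with `|xᵢ| = 1`,
`∂x₁ = x₂x₃` and `∂x₂ = ∂x₃ = 0`. -/
abbrev exampleAlgebra : DGAlgebra k :=
  freeDGAlgebra k (exampleDiff k) (exampleDiff_mem k) (freeDiff_exampleDiff k)

theorem exampleAlgebra_d_x₂ : (exampleAlgebra k).d (FreeAlgebra.ι k 1) = 0 :=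
  (freeDiff_ι k (exampleDiff k) 1).trans rfl

theorem exampleAlgebra_d_x₃ : (exampleAlgebra k).d (FreeAlgebra.ι k 2) = 0 :=
  (freeDiff_ι k (exampleDiff k) 2).trans rfl

theorem exampleAlgebra_d_x₁ :
    (exampleAlgebra k).d (FreeAlgebra.ι k 0) = FreeAlgebra.ι k 1 * FreeAlgebra.ι k 2 :=
  (freeDiff_ι k (exampleDiff k) 0).trans rfl

/-- The relation `y₁ y₂ = 0` on the free algebra `k⟨y₁, y₂⟩` (with indices `0, 1`). -/
def ExampleRel (a b : FreeAlgebra k (Fin 2)) : Prop :=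
  a = FreeAlgebra.ι k 0 * FreeAlgebra.ι k 1 ∧ b = 0

end Free

end

end DG

/-!
Everything is deduced from two explicit semi-free resolutions with a finite semi-basis
`e₀, e₁, e₂, e₃` in degree `0`, instances of a free module with the differential `∂eᵢ = ∑ⱼ δᵢⱼ eⱼ`
for a Maurer–Cartan matrix `δ` (`twistedFree`).

The trivial module `k` has the resolution `∂e₀ = 0`, `∂e₁ = x₁e₀ + x₂e₃`, `∂e₂ = x₂e₀`,
`∂e₃ = x₃e₀` (`trivialRes`). It is exact because the free algebra carries the skew derivation `D`
with `D(xᵢa) = ε(a)eᵢ - xᵢD(a)`, which contracts it. The entries of `δ` lie in the augmentation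
ideal, so that the resolution is minimal, and the algebra is Koszul. The diagonal bimodule has the
resolution with `∂eᵢ = xᵢe₀ - e₀xᵢ` and the two further terms `-e₂x₃ + x₂e₃` in `∂e₁`
(`diagRes`), contracted by the universal graded derivation of the free algebra. As this resolution
has a finite semi-basis, the diagonal bimodule is compact
(`DGModule.isCompact_of_finite_semiBasis`).

For the cohomology algebra, the relation `x₂x₃ = ∂x₁` makes the words `x₃ᵃx₂ᵇ` candidates for a
basis. They are independent modulo coboundaries by the action of the algebra on their span, through
the quotient by `x₁` and `x₂x₃`. They span the cohomology by induction on the degree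
(`mem_normalSpace_of_mem_grading`): a cocycle `z` of positive degree satisfies `ze₀ = ∂f` for
`f = D(z)`, and this equation expresses `z` by cocycles of smaller degree.

The other two assertions concern arbitrary semi-free resolutions. Any two are homotopy equivalent
(`IsSemiFreeResolution.exists_homotopyEquiv`), because `Hom(F, -)` preserves quasi-isomorphisms for
semi-free `F`, which is proved by recursion on the layers of a semi-basis. In `Hom(F, A)`, for the
resolution `F` of `k`, no differential of a basis element involves `e₁`. The cocycles `e₁ ↦ 1` and
`e₁ ↦ x₃` are not coboundaries, hence the cohomology has dimension at least two, and the algebra is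
not left Gorenstein. The differential of `Hom(F, k)` vanishes by minimality, so that the Ext-algebra
has a basis of four classes, dual to the elements `eᵢ` (`extPairing`). The classes dual to `e₁`
and `e₂` are represented by endomorphisms with values in `Ae₀`. Each class `c` therefore acts on
both from the left by the same scalar, and two linearly independent elements with this property do
not exist in a Frobenius algebra (`not_isFrobenius_of_common_scalar`).
-/

namespace DG

universe u

open scoped DirectSum TensorProduct

noncomputable section

/-! ### Homogeneous components -/

section Components

variable {k : Type u} [Field k] {A : DGAlgebra k}

namespace DGModule

/-- The projection of a differential graded module onto its component of degree `m`, as an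
endomorphism of the underlying vector space. -/
def proj (M : DGModule A) (m : ℤ) : M →ₗ[k] M :=
  (M.grading m).subtype ∘ₗ DirectSum.component k ℤ (fun i => M.grading i) m ∘ₗ
    (DirectSum.decomposeLinearEquiv M.grading).toLinearMap

variable (M : DGModule A)

theorem proj_apply (m : ℤ) (x : M) : M.proj m x = (DirectSum.decompose M.grading x m : M) := rfl

theorem proj_mem (m : ℤ) (x : M) : M.proj m x ∈ M.grading m :=
  (DirectSum.decompose M.grading x m).2

variable {M} in
theorem proj_of_mem {m : ℤ} {x : M} (hx : x ∈ M.grading m) : M.proj m x = x :=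
  DirectSum.decompose_of_mem_same M.grading hx

variable {M} in
theorem proj_of_mem_ne {m n : ℤ} {x : M} (hx : x ∈ M.grading m) (h : m ≠ n) :
    M.proj n x = 0 :=
  DirectSum.decompose_of_mem_ne M.grading hx h

theorem d_proj (m : ℤ) (x : M) : M.d (M.proj m x) = M.proj (m + 1) (M.d x) := by
  refine DGAlgebra.hom_induction M.grading (f := M.d ∘ₗ M.proj m) (g := M.proj (m + 1) ∘ₗ M.d)
    (fun i x hx => ?_) x
  simp only [LinearMap.comp_apply]
  by_cases h : i = m
  · subst h
    rw [proj_of_mem hx, proj_of_mem (M.d_mem hx)]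
  · rw [proj_of_mem_ne hx h, proj_of_mem_ne (M.d_mem hx) (by omega), map_zero]

variable {M} in
/-- A homogeneous coboundary is the differential of a homogeneous element. -/
theorem exists_homogeneous_primitive {m : ℤ} {x y : M} (hy : y ∈ M.grading (m + 1))
    (h : M.d x = y) : ∃ x' ∈ M.grading m, M.d x' = y :=
  ⟨M.proj m x, M.proj_mem m x, by rw [d_proj, h, proj_of_mem hy]⟩

end DGModule

namespace DGHom

variable {M N : DGModule A} (g : DGHom M N)

theorem map_proj (m : ℤ) (x : M) : g.toLinearMap (M.proj m x) = N.proj m (g.toLinearMap x) := by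
  refine DGAlgebra.hom_induction M.grading (f := g.toLinearMap.restrictScalars k ∘ₗ M.proj m)
    (g := N.proj m ∘ₗ g.toLinearMap.restrictScalars k) (fun i x hx => ?_) x
  simp only [LinearMap.comp_apply, LinearMap.restrictScalars_apply]
  by_cases h : i = m
  · subst h
    rw [DGModule.proj_of_mem hx, DGModule.proj_of_mem (g.map_mem hx)]
  · rw [DGModule.proj_of_mem_ne hx h, DGModule.proj_of_mem_ne (g.map_mem hx) h, map_zero]

variable {g} in
/-- The cone of a quasi-isomorphism is acyclic, in terms of homogeneous elements. -/
theorem IsQuasiIso.exists_cone_primitive (hg : g.IsQuasiIso) {m : ℤ} {x : M} {y : N}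
    (hx : x ∈ M.grading (m + 1)) (hy : y ∈ N.grading m) (hdx : M.d x = 0)
    (hxy : g.toLinearMap x = N.d y) :
    ∃ u ∈ M.grading m, ∃ v ∈ N.grading (m - 1), M.d u = x ∧ N.d v = y - g.toLinearMap u := by
  have hx0 : g.mapCohomology (Submodule.Quotient.mk ⟨x, hdx⟩) = 0 := by
    refine (Submodule.Quotient.mk_eq_zero _).2 ⟨y, ?_⟩
    exact hxy.symm
  have hx1 := hg.1 (hx0.trans (map_zero _).symm)
  obtain ⟨u₀, hu₀⟩ := (Submodule.Quotient.mk_eq_zero _).1 hx1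
  obtain ⟨u₁, hu₁, hdu₁⟩ := DGModule.exists_homogeneous_primitive hx hu₀
  have hc : N.d (y - g.toLinearMap u₁) = 0 := by
    rw [map_sub, ← hxy, ← g.comm, hdu₁, sub_self]
  obtain ⟨w, hw⟩ := hg.2 (Submodule.Quotient.mk ⟨y - g.toLinearMap u₁, hc⟩)
  obtain ⟨⟨w, hdw⟩, rfl⟩ := Submodule.Quotient.mk_surjective _ w
  obtain ⟨v, hv⟩ := (Submodule.Quotient.eq _).1 hw.symm
  have hv' : N.d v = y - g.toLinearMap u₁ - g.toLinearMap w := hv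
  refine ⟨u₁ + M.proj m w, Submodule.add_mem _ hu₁ (M.proj_mem _ _), N.proj (m - 1) v,
    N.proj_mem _ _, ?_, ?_⟩
  · rw [map_add, hdu₁, M.d_proj, show M.d w = 0 from hdw, map_zero, add_zero]
  · rw [N.d_proj, sub_add_cancel, hv', map_sub, DGModule.proj_of_mem, map_add, g.map_proj,
      sub_add_eq_sub_sub]
    exact Submodule.sub_mem _ hy (g.map_mem hu₁)

/-- A morphism with a homotopy inverse, possibly one that is only linear over the ground field, is
a quasi-isomorphism. -/
theorem isQuasiIso_of_contraction (σ : N →ₗ[k] M) (h : M →ₗ[k] M)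
    (hσ : ∀ y, M.d (σ y) = σ (N.d y)) (hgσ : ∀ y, g.toLinearMap (σ y) = y)
    (hh : ∀ x, M.d (h x) + h (M.d x) = x - σ (g.toLinearMap x)) : g.IsQuasiIso := by
  constructor
  · rw [← LinearMap.ker_eq_bot, LinearMap.ker_eq_bot']
    intro x hx
    obtain ⟨⟨x, hdx⟩, rfl⟩ := Submodule.Quotient.mk_surjective _ x
    obtain ⟨y, hy⟩ := (Submodule.Quotient.mk_eq_zero _).1 hx
    have hy' : N.d y = g.toLinearMap x := hy
    refine (Submodule.Quotient.mk_eq_zero _).2 ⟨h x + σ y, ?_⟩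
    have hx' := hh x
    rw [show M.d x = 0 from hdx, map_zero, add_zero] at hx'
    rw [map_add, hx', hσ, hy']
    exact sub_add_cancel _ _
  · intro y
    obtain ⟨⟨y, hdy⟩, rfl⟩ := Submodule.Quotient.mk_surjective _ y
    refine ⟨Submodule.Quotient.mk ⟨σ y, ?_⟩, ?_⟩
    · rw [LinearMap.mem_ker, hσ, show N.d y = 0 from hdy, map_zero]
    · exact congrArg Submodule.Quotient.mk (Subtype.ext (hgσ y))

end DGHom

end Components

/-! ### The calculus of homomorphism complexes -/

section HomCalculus

variable {k : Type u} [Field k] {A : DGAlgebra k} {M N P : DGModule A}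

/-- The rule `f (a x) = (-1) ^ (n |a|) a f x` for an element `a` that need not be homogeneous. -/
theorem homDeg_map_smul {n : ℤ} {f : M →ₗ[k] N} (hf : f ∈ homDeg M N n) (a : A) (x : M) :
    f (a • x) = signTwist A.grading n a • f x := by
  refine DGAlgebra.hom_induction A.grading
    (f := f ∘ₗ (LinearMap.toSpanSingleton A M x).restrictScalars k)
    (g := (LinearMap.toSpanSingleton A N (f x)).restrictScalars k ∘ₗ signTwist A.grading n)
    (fun i a ha => ?_) a
  simp only [LinearMap.comp_apply, LinearMap.restrictScalars_apply,
    LinearMap.toSpanSingleton_apply]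
  rw [hf.2 i a ha, signTwist_of_mem A.grading ha, smul_assoc]

theorem comp_mem_homDeg {m n p : ℤ} (h : m + n = p) {f : N →ₗ[k] P} {g : M →ₗ[k] N}
    (hf : f ∈ homDeg N P m) (hg : g ∈ homDeg M N n) : f ∘ₗ g ∈ homDeg M P p := by
  subst h
  refine ⟨fun i x hx => ?_, fun i a ha x => ?_⟩
  · rw [add_comm m, ← add_assoc]
    exact hf.1 _ _ (hg.1 i x hx)
  · rw [LinearMap.comp_apply, LinearMap.comp_apply, hg.2 i a ha, map_smul, hf.2 i a ha, smul_smul,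
      add_mul, add_comm (m * i), sign_add]

/-- The Leibniz rule for the composition of homomorphisms. -/
theorem homDiff_comp {m n p : ℤ} (h : m + n = p) (f : N →ₗ[k] P) (g : M →ₗ[k] N) :
    homDiff M P p (f ∘ₗ g) =
      homDiff N P m f ∘ₗ g + (-1 : k) ^ m • (f ∘ₗ homDiff M N n g) := by
  subst h
  ext x
  simp only [homDiff_apply, LinearMap.sub_apply, LinearMap.comp_apply, LinearMap.smul_apply,
    LinearMap.add_apply, map_sub, map_smul, smul_sub, smul_smul, sign_add]
  abel

theorem DGHom.mem_homCocycles (g : DGHom M N) :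
    g.toLinearMap.restrictScalars k ∈ homCocycles M N 0 := by
  refine ⟨⟨fun i x hx => ?_, fun i a ha x => ?_⟩, ?_⟩
  · rw [add_zero]; exact g.map_mem hx
  · simp
  · refine LinearMap.mem_ker.2 (LinearMap.ext fun x => ?_)
    simp [homDiff_apply, g.comm]

theorem homDiff_mem_homCoboundaries {m n : ℤ} (h : m + 1 = n) {f : M →ₗ[k] N}
    (hf : f ∈ homDeg M N m) : homDiff M N m f ∈ homCoboundaries M N n := by
  obtain rfl : m = n - 1 := by omega
  exact ⟨f, hf, rfl⟩

theorem comp_mem_homCocycles {m n p : ℤ} (h : m + n = p) {f : N →ₗ[k] P} {g : M →ₗ[k] N}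
    (hf : f ∈ homCocycles N P m) (hg : g ∈ homCocycles M N n) : f ∘ₗ g ∈ homCocycles M P p := by
  refine ⟨comp_mem_homDeg h hf.1 hg.1, LinearMap.mem_ker.2 ?_⟩
  rw [homDiff_comp h, LinearMap.mem_ker.1 hf.2, LinearMap.mem_ker.1 hg.2]
  simp

theorem comp_mem_homCoboundaries_left {m n p : ℤ} (h : m + n = p) {f : N →ₗ[k] P}
    {g : M →ₗ[k] N} (hf : f ∈ homCocycles N P m) (hg : g ∈ homCoboundaries M N n) :
    f ∘ₗ g ∈ homCoboundaries M P p := by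
  obtain ⟨s, hs, rfl⟩ := hg
  have hd := homDiff_comp (show m + (n - 1) = p - 1 by omega) f s
  rw [LinearMap.mem_ker.1 hf.2, LinearMap.zero_comp, zero_add] at hd
  have e : f ∘ₗ homDiff M N (n - 1) s =
      (-1 : k) ^ m • homDiff M P (p - 1) (f ∘ₗ s) := by
    rw [hd, smul_smul, sign_sq, one_smul]
  rw [e]
  exact Submodule.smul_mem _ _ ⟨_, comp_mem_homDeg (by omega) hf.1 hs, rfl⟩

theorem comp_mem_homCoboundaries_right {m n p : ℤ} (h : m + n = p) {f : N →ₗ[k] P}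
    {g : M →ₗ[k] N} (hf : f ∈ homCoboundaries N P m) (hg : g ∈ homCocycles M N n) :
    f ∘ₗ g ∈ homCoboundaries M P p := by
  obtain ⟨s, hs, rfl⟩ := hf
  have hd := homDiff_comp (show m - 1 + n = p - 1 by omega) s g
  rw [LinearMap.mem_ker.1 hg.2, LinearMap.comp_zero, smul_zero, add_zero] at hd
  rw [← hd]
  exact ⟨_, comp_mem_homDeg (by omega) hs hg.1, rfl⟩

end HomCalculus

/-! ### Homomorphisms from semi-free modules -/

section SemiFree

variable {k : Type u} [Field k] {A : DGAlgebra k} {F N : DGModule A} {I : Type*}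
  {b : Module.Basis I A F} {deg : I → ℤ}

theorem hom_ext_smul_basis {V : Type*} [AddCommGroup V] [Module k V]
    (b : Module.Basis I A F) {f g : F →ₗ[k] V}
    (h : ∀ (i : ℤ), ∀ a ∈ A.grading i, ∀ j, f (a • b j) = g (a • b j)) : f = g := by
  have h' (a : A) (j : I) : f (a • b j) = g (a • b j) :=
    DGAlgebra.hom_induction A.grading
      (f := f ∘ₗ (LinearMap.toSpanSingleton A F (b j)).restrictScalars k)
      (g := g ∘ₗ (LinearMap.toSpanSingleton A F (b j)).restrictScalars k)
      (fun i a ha => h i a ha j) a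
  ext x
  rw [← b.linearCombination_repr x, Finsupp.linearCombination_apply, Finsupp.sum, map_sum,
    map_sum]
  exact Finset.sum_congr rfl fun j _ => h' _ _

theorem homDeg_ext_basis (b : Module.Basis I A F) {n : ℤ} {f g : F →ₗ[k] N}
    (hf : f ∈ homDeg F N n) (hg : g ∈ homDeg F N n) (h : ∀ j, f (b j) = g (b j)) : f = g :=
  hom_ext_smul_basis b fun i a ha j => by rw [hf.2 i a ha, hg.2 i a ha, h]

theorem homDeg_apply_eq_zero_of_mem_span {n : ℤ} {f : F →ₗ[k] N} (hf : f ∈ homDeg F N n)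
    {S : Set F} (hS : ∀ x ∈ S, f x = 0) {x : F} (hx : x ∈ Submodule.span A S) : f x = 0 := by
  induction hx using Submodule.span_induction with
  | zero => exact map_zero f
  | add x y _ _ hx hy => rw [map_add, hx, hy, add_zero]
  | smul a x _ hx => rw [homDeg_map_smul hf, hx, smul_zero]
  | mem x hx => exact hS x hx

/-- The components of a semi-free module are spanned by the homogeneous multiples of the elements
of a semi-basis. -/
theorem mem_span_smul_basis (hb : ∀ j, b j ∈ F.grading (deg j)) {m : ℤ} {x : F}
    (hx : x ∈ F.grading m) :
    x ∈ Submodule.span k {y | ∃ i, ∃ a ∈ A.grading i, ∃ j, i + deg j = m ∧ y = a • b j} := by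
  set S := Submodule.span k {y | ∃ i, ∃ a ∈ A.grading i, ∃ j, i + deg j = m ∧ y = a • b j} with hS
  have h : S.mkQ ∘ₗ F.proj m = 0 := by
    refine hom_ext_smul_basis b fun i a ha j => ?_
    rw [LinearMap.comp_apply, LinearMap.zero_apply, Submodule.mkQ_apply,
      Submodule.Quotient.mk_eq_zero]
    have hab := F.smul_mem ha (hb j)
    by_cases h : i + deg j = m
    · subst h
      rw [DGModule.proj_of_mem hab]
      exact Submodule.subset_span ⟨i, a, ha, j, rfl, rfl⟩
    · rw [DGModule.proj_of_mem_ne hab h]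
      exact Submodule.zero_mem _
  have hx' := LinearMap.congr_fun h x
  rwa [LinearMap.comp_apply, LinearMap.zero_apply, Submodule.mkQ_apply,
    Submodule.Quotient.mk_eq_zero, DGModule.proj_of_mem hx] at hx'

/-- The homomorphism of degree `n` with the values `c` on a basis. -/
def homOfBasis (b : Module.Basis I A F) (n : ℤ) (c : I → N) : F →ₗ[k] N :=
  (Finsupp.lsum k fun i => (LinearMap.toSpanSingleton A N (c i)).restrictScalars k ∘ₗ
    signTwist A.grading n) ∘ₗ b.repr.toLinearMap.restrictScalars k

theorem homOfBasis_smul_basis (n : ℤ) (c : I → N) (a : A) (j : I) :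
    homOfBasis b n c (a • b j) = signTwist A.grading n a • c j := by
  simp [homOfBasis]

theorem homOfBasis_basis (n : ℤ) (c : I → N) (j : I) : homOfBasis b n c (b j) = c j := by
  have h := homOfBasis_smul_basis (b := b) n c 1 j
  rw [signTwist_of_mem A.grading (SetLike.one_mem_graded A.grading)] at h
  simpa using h

theorem homOfBasis_mem_homDeg (hb : ∀ j, b j ∈ F.grading (deg j)) {n : ℤ} {c : I → N}
    (hc : ∀ j, c j ∈ N.grading (deg j + n)) : homOfBasis b n c ∈ homDeg F N n := by
  refine ⟨fun i x hx => ?_, fun i a ha x => ?_⟩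
  · have hx' := mem_span_smul_basis hb hx
    clear hx
    induction hx' using Submodule.span_induction with
    | zero => rw [map_zero]; exact Submodule.zero_mem _
    | add x y _ _ hx hy => rw [map_add]; exact Submodule.add_mem _ hx hy
    | smul r x _ hx => rw [map_smul]; exact Submodule.smul_mem _ _ hx
    | mem x hx =>
      obtain ⟨l, a, ha, j, rfl, rfl⟩ := hx
      rw [homOfBasis_smul_basis, signTwist_of_mem A.grading ha, smul_assoc, add_assoc]
      exact Submodule.smul_mem _ _ (N.smul_mem ha (hc j))
  · refine LinearMap.congr_fun (f := homOfBasis b n c ∘ₗ Algebra.lsmul k k F a)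
      (g := (-1 : k) ^ (n * i) • (Algebra.lsmul k k N a ∘ₗ homOfBasis b n c)) ?_ x
    refine hom_ext_smul_basis b fun l a' ha' j => ?_
    simp only [LinearMap.comp_apply, LinearMap.smul_apply, Algebra.lsmul_coe]
    rw [← mul_smul, homOfBasis_smul_basis, homOfBasis_smul_basis, signTwist_of_mem A.grading ha',
      signTwist_of_mem A.grading (SetLike.mul_mem_graded ha ha'), smul_assoc, smul_assoc, mul_smul,
      smul_comm a ((-1 : k) ^ (n * l)), mul_add, sign_add, mul_smul]

end SemiFree

/-! ### Lifting through quasi-isomorphisms -/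

section Lifting

variable {k : Type u} [Field k] {A : DGAlgebra k} {F N N' : DGModule A} {I : Type u}
  {b : Module.Basis I A F} {deg : I → ℤ}

/-- The data `h`, `s` solve the equations `∂h = z`, `∂s = f - gh` on the part of the basis that
satisfies `p`. -/
structure IsPartialLift (b : Module.Basis I A F) (g : DGHom N N') (n : ℤ) (z : F →ₗ[k] N)
    (f : F →ₗ[k] N') (p : I → Prop) (h : F →ₗ[k] N) (s : F →ₗ[k] N') : Prop where
  left_mem : h ∈ homDeg F N n
  right_mem : s ∈ homDeg F N' (n - 1)
  left_eq : ∀ i, p i → homDiff F N n h (b i) = z (b i)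
  right_eq : ∀ i, p i → homDiff F N' (n - 1) s (b i) = f (b i) - g.toLinearMap (h (b i))

/-- If the equations `∂h = z`, `∂s = f - gh` have the solution zero on the first `m` layers of a
semi-basis, they have a solution on `m + 1` layers that is supported on the last one. -/
theorem exists_isPartialLift_of_vanishing (hb : ∀ j, b j ∈ F.grading (deg j)) {r : I → ℕ}
    (hr : ∀ i, F.d (b i) ∈ Submodule.span A {x | ∃ j, r j < r i ∧ x = b j}) {g : DGHom N N'}
    (hg : g.IsQuasiIso) {n : ℤ} {z : F →ₗ[k] N} {f : F →ₗ[k] N'} (hz : z ∈ homDeg F N (n + 1))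
    (hf : f ∈ homDeg F N' n) (hdz : homDiff F N (n + 1) z = 0)
    (hdf : homDiff F N' n f = g.toLinearMap.restrictScalars k ∘ₗ z) {m : ℕ}
    (hz₀ : ∀ i, r i < m → z (b i) = 0) (hf₀ : ∀ i, r i < m → f (b i) = 0) :
    ∃ h s, IsPartialLift b g n z f (fun i => r i < m + 1) h s ∧
      ∀ i, r i < m → h (b i) = 0 ∧ s (b i) = 0 := by
  have van {V : DGModule A} {l : ℤ} {q : F →ₗ[k] V} (hq : q ∈ homDeg F V l)
      (hq₀ : ∀ i, r i < m → q (b i) = 0) {i : I} (hi : r i < m + 1) : q (F.d (b i)) = 0 := by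
    refine homDeg_apply_eq_zero_of_mem_span hq ?_ (hr i)
    rintro _ ⟨j, hj, rfl⟩
    exact hq₀ j (by omega)
  have key (i : I) : ∃ u ∈ N.grading (deg i + n), ∃ v ∈ N'.grading (deg i + (n - 1)),
      (r i < m → u = 0 ∧ v = 0) ∧
      (r i < m + 1 → N.d u = z (b i) ∧ N'.d v = f (b i) - g.toLinearMap u) := by
    by_cases hi : r i = m
    · have h₁ : N.d (z (b i)) = 0 := by
        have h := LinearMap.congr_fun hdz (b i)
        simpa [homDiff_apply, van hz hz₀ (show r i < m + 1 by omega)] using h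
      have h₂ : g.toLinearMap (z (b i)) = N'.d (f (b i)) := by
        have h := LinearMap.congr_fun hdf (b i)
        simpa [homDiff_apply, van hf hf₀ (show r i < m + 1 by omega)] using h.symm
      have h₃ := hz.1 _ _ (hb i)
      rw [← add_assoc] at h₃
      obtain ⟨x, hx, y, hy, e₁, e₂⟩ := hg.exists_cone_primitive h₃ (hf.1 _ _ (hb i)) h₁ h₂
      rw [add_sub_assoc] at hy
      exact ⟨x, hx, y, hy, fun h => absurd h (by omega), fun _ => ⟨e₁, e₂⟩⟩
    · refine ⟨0, Submodule.zero_mem _, 0, Submodule.zero_mem _, fun _ => ⟨rfl, rfl⟩, fun h => ?_⟩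
      rw [hz₀ i (by omega), hf₀ i (by omega)]
      simp
  choose x hx y hy hxy₀ hxy using key
  have hX := homOfBasis_mem_homDeg (b := b) hb hx
  have hY := homOfBasis_mem_homDeg (b := b) hb hy
  have hX₀ (i : I) (hi : r i < m) : homOfBasis b n x (b i) = 0 := by
    rw [homOfBasis_basis, (hxy₀ i hi).1]
  have hY₀ (i : I) (hi : r i < m) : homOfBasis b (n - 1) y (b i) = 0 := by
    rw [homOfBasis_basis, (hxy₀ i hi).2]
  refine ⟨_, _, ⟨hX, hY, fun i hi => ?_, fun i hi => ?_⟩, fun i hi => ⟨hX₀ i hi, hY₀ i hi⟩⟩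
  · rw [homDiff_apply, LinearMap.sub_apply, LinearMap.smul_apply, LinearMap.comp_apply,
      LinearMap.comp_apply, van hX hX₀ hi, homOfBasis_basis, (hxy i hi).1, smul_zero, sub_zero]
  · rw [homDiff_apply, LinearMap.sub_apply, LinearMap.smul_apply, LinearMap.comp_apply,
      LinearMap.comp_apply, van hY hY₀ hi, homOfBasis_basis, homOfBasis_basis, (hxy i hi).2,
      smul_zero, sub_zero]

/-- Let `F` be semi-free and `g : N → N'` a quasi-isomorphism. Then the cone of
`Hom(F, N) → Hom(F, N')` is acyclic: if `∂z = 0` and `∂f = gz`, there are `h` and `s` with `∂h = z`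
and `∂s = f - gh`. They are constructed along the layers of a semi-basis. -/
theorem IsSemiBasis.exists_lift (hb : IsSemiBasis b deg) {g : DGHom N N'}
    (hg : g.IsQuasiIso) {n : ℤ} {z : F →ₗ[k] N} {f : F →ₗ[k] N'} (hz : z ∈ homDeg F N (n + 1))
    (hf : f ∈ homDeg F N' n) (hdz : homDiff F N (n + 1) z = 0)
    (hdf : homDiff F N' n f = g.toLinearMap.restrictScalars k ∘ₗ z) :
    ∃ h ∈ homDeg F N n, ∃ s ∈ homDeg F N' (n - 1), homDiff F N n h = z ∧
      homDiff F N' (n - 1) s = f - g.toLinearMap.restrictScalars k ∘ₗ h := by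
  obtain ⟨r, hr⟩ := hb.filtration
  have hbd := hb.mem_grading
  set γ := g.toLinearMap.restrictScalars k with hγ
  have hγ₀ : γ ∈ homCocycles N N' 0 := g.mem_homCocycles
  -- A solution on `m` layers extends to `m + 1` layers: correct it by a solution of the equations
  -- for the defects `z - ∂h` and `f - gh - ∂s`.
  have step (m : ℕ) (p : {p : (F →ₗ[k] N) × (F →ₗ[k] N') //
      IsPartialLift b g n z f (fun i => r i < m) p.1 p.2}) :
      ∃ q : {p : (F →ₗ[k] N) × (F →ₗ[k] N') //
        IsPartialLift b g n z f (fun i => r i < m + 1) p.1 p.2},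
        ∀ i, r i < m → q.1.1 (b i) = p.1.1 (b i) ∧ q.1.2 (b i) = p.1.2 (b i) := by
    obtain ⟨⟨h, s⟩, hp⟩ := p
    have hs := homDiff_mem hp.right_mem
    have hds := homDiff_homDiff F N' (n - 1) s
    rw [sub_add_cancel] at hs hds
    have hdγ := homDiff_comp (zero_add n) γ h
    rw [LinearMap.mem_ker.1 hγ₀.2, LinearMap.zero_comp, zero_add, zpow_zero, one_smul] at hdγ
    obtain ⟨h', s', hp', hv⟩ := exists_isPartialLift_of_vanishing hbd hr hg (m := m)
      (z := z - homDiff F N n h) (f := f - γ ∘ₗ h - homDiff F N' (n - 1) s)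
      (Submodule.sub_mem _ hz (homDiff_mem hp.left_mem))
      (Submodule.sub_mem _ (Submodule.sub_mem _ hf
        (comp_mem_homDeg (zero_add n) hγ₀.1 hp.left_mem)) hs)
      (by rw [map_sub, hdz, homDiff_homDiff, sub_zero])
      (by rw [map_sub, map_sub, hdf, hds, hdγ, sub_zero, LinearMap.comp_sub])
      (fun i hi => by rw [LinearMap.sub_apply, hp.left_eq i hi, sub_self])
      (fun i hi => by
        rw [LinearMap.sub_apply, LinearMap.sub_apply, hp.right_eq i hi]
        exact sub_self _)
    refine ⟨⟨(h + h', s + s'), ⟨Submodule.add_mem _ hp.left_mem hp'.left_mem,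
      Submodule.add_mem _ hp.right_mem hp'.right_mem, fun i hi => ?_, fun i hi => ?_⟩⟩,
      fun i hi => ?_⟩
    · rw [map_add, LinearMap.add_apply, hp'.left_eq i hi, LinearMap.sub_apply, add_sub_cancel]
    · rw [map_add, LinearMap.add_apply, hp'.right_eq i hi, LinearMap.sub_apply,
        LinearMap.sub_apply, LinearMap.add_apply, map_add, LinearMap.comp_apply,
        show γ (h (b i)) = g.toLinearMap (h (b i)) from rfl]
      abel
    · simp [(hv i hi).1, (hv i hi).2]
  choose next hnext using step
  -- The solutions are constant on a layer from some index on, so they have a limit `(H, S)`.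
  let seq (m : ℕ) : {p : (F →ₗ[k] N) × (F →ₗ[k] N') //
      IsPartialLift b g n z f (fun i => r i < m) p.1 p.2} :=
    Nat.rec ⟨(0, 0), Submodule.zero_mem _, Submodule.zero_mem _,
      fun i hi => absurd hi (Nat.not_lt_zero _), fun i hi => absurd hi (Nat.not_lt_zero _)⟩
      next m
  have hseq (i : I) (m : ℕ) (hm : r i + 1 ≤ m) :
      (seq m).1.1 (b i) = (seq (r i + 1)).1.1 (b i) ∧
        (seq m).1.2 (b i) = (seq (r i + 1)).1.2 (b i) := by
    induction m, hm using Nat.le_induction with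
    | base => exact ⟨rfl, rfl⟩
    | succ m hm ih =>
      have h := hnext m (seq m) i (by omega)
      exact ⟨h.1.trans ih.1, h.2.trans ih.2⟩
  set H := homOfBasis b n fun i => (seq (r i + 1)).1.1 (b i) with hH
  set S := homOfBasis b (n - 1) fun i => (seq (r i + 1)).1.2 (b i) with hS
  have mH : H ∈ homDeg F N n :=
    homOfBasis_mem_homDeg hbd fun i => (seq (r i + 1)).2.left_mem.1 _ _ (hbd i)
  have mS : S ∈ homDeg F N' (n - 1) :=
    homOfBasis_mem_homDeg hbd fun i => (seq (r i + 1)).2.right_mem.1 _ _ (hbd i)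
  have eH (i : I) : H (b i) = (seq (r i + 1)).1.1 (b i) := homOfBasis_basis _ _ _
  have eS (i : I) : S (b i) = (seq (r i + 1)).1.2 (b i) := homOfBasis_basis _ _ _
  have dH (i : I) : H (F.d (b i)) = (seq (r i + 1)).1.1 (F.d (b i)) := by
    rw [← sub_eq_zero, ← LinearMap.sub_apply]
    refine homDeg_apply_eq_zero_of_mem_span
      (Submodule.sub_mem _ mH (seq (r i + 1)).2.left_mem) ?_ (hr i)
    rintro _ ⟨j, hj, rfl⟩
    rw [LinearMap.sub_apply, eH, (hseq j (r i + 1) (by omega)).1, sub_self]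
  have dS (i : I) : S (F.d (b i)) = (seq (r i + 1)).1.2 (F.d (b i)) := by
    rw [← sub_eq_zero, ← LinearMap.sub_apply]
    refine homDeg_apply_eq_zero_of_mem_span
      (Submodule.sub_mem _ mS (seq (r i + 1)).2.right_mem) ?_ (hr i)
    rintro _ ⟨j, hj, rfl⟩
    rw [LinearMap.sub_apply, eS, (hseq j (r i + 1) (by omega)).2, sub_self]
  refine ⟨H, mH, S, mS, homDeg_ext_basis b (homDiff_mem mH) hz fun i => ?_, ?_⟩
  · rw [← (seq (r i + 1)).2.left_eq i (Nat.lt_succ_self _), homDiff_apply, homDiff_apply]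
    simp only [LinearMap.sub_apply, LinearMap.smul_apply, LinearMap.comp_apply, eH, dH]
  · have h := homDiff_mem mS
    rw [sub_add_cancel] at h
    refine homDeg_ext_basis b h (Submodule.sub_mem _ hf
      (comp_mem_homDeg (zero_add n) hγ₀.1 mH)) fun i => ?_
    have e := (seq (r i + 1)).2.right_eq i (Nat.lt_succ_self _)
    rw [LinearMap.sub_apply, LinearMap.comp_apply, eH,
      show γ ((seq (r i + 1)).1.1 (b i)) = g.toLinearMap ((seq (r i + 1)).1.1 (b i)) from rfl,
      ← e, homDiff_apply, homDiff_apply]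
    simp only [LinearMap.sub_apply, LinearMap.smul_apply, LinearMap.comp_apply, eS, dS]

end Lifting

/-! ### Comparison of semi-free resolutions -/

section Comparison

variable {k : Type u} [Field k] {A : DGAlgebra k} {F F' M N N' : DGModule A}

/-- `Hom(F, -)` maps quasi-isomorphisms to maps that are surjective on cohomology. -/
theorem DGModule.IsSemiFree.exists_lift_cocycle (hF : F.IsSemiFree) {g : DGHom N N'}
    (hg : g.IsQuasiIso) {n : ℤ} {f : F →ₗ[k] N'} (hf : f ∈ homCocycles F N' n) :
    ∃ h ∈ homCocycles F N n,
      f - g.toLinearMap.restrictScalars k ∘ₗ h ∈ homCoboundaries F N' n := by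
  obtain ⟨I, b, deg, hb⟩ := hF
  obtain ⟨h, hh, s, hs, e₁, e₂⟩ := hb.exists_lift hg (z := 0) (Submodule.zero_mem _) hf.1
    (map_zero _) (by rw [LinearMap.mem_ker.1 hf.2, LinearMap.comp_zero])
  exact ⟨h, ⟨hh, e₁⟩, s, hs, e₂⟩

/-- `Hom(F, -)` maps quasi-isomorphisms to maps that are injective on cohomology. -/
theorem DGModule.IsSemiFree.mem_homCoboundaries_of_comp (hF : F.IsSemiFree) {g : DGHom N N'}
    (hg : g.IsQuasiIso) {n : ℤ} {z : F →ₗ[k] N} (hz : z ∈ homCocycles F N n)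
    (h : g.toLinearMap.restrictScalars k ∘ₗ z ∈ homCoboundaries F N' n) :
    z ∈ homCoboundaries F N n := by
  obtain ⟨I, b, deg, hb⟩ := hF
  obtain ⟨f, hf, e⟩ := h
  have hz₁ := hz.1
  have hz₂ := LinearMap.mem_ker.1 hz.2
  rw [← sub_add_cancel n 1] at hz₁ hz₂
  obtain ⟨h, hh, s, hs, e₁, e₂⟩ := hb.exists_lift hg hz₁ hf hz₂ e
  exact ⟨h, hh, e₁⟩

/-- Two semi-free resolutions of the same module are homotopy equivalent over it. -/
theorem IsSemiFreeResolution.exists_homotopyEquiv {ε : DGHom F M} {ε' : DGHom F' M}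
    (hε : IsSemiFreeResolution ε) (hε' : IsSemiFreeResolution ε') :
    ∃ φ ∈ homCocycles F F' 0, ∃ ψ ∈ homCocycles F' F 0,
      ε.toLinearMap.restrictScalars k - ε'.toLinearMap.restrictScalars k ∘ₗ φ ∈
        homCoboundaries F M 0 ∧
      ψ ∘ₗ φ - LinearMap.id ∈ homCoboundaries F F 0 ∧
      φ ∘ₗ ψ - LinearMap.id ∈ homCoboundaries F' F' 0 := by
  obtain ⟨φ, hφ, h₁⟩ := hε.semiFree.exists_lift_cocycle hε'.quasiIso ε.mem_homCocycles
  obtain ⟨ψ, hψ, h₂⟩ := hε'.semiFree.exists_lift_cocycle hε.quasiIso ε'.mem_homCocycles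
  have id_mem (M : DGModule A) : LinearMap.id ∈ homCocycles M M 0 :=
    DGHom.mem_homCocycles (⟨LinearMap.id, fun h => h, fun _ => rfl⟩ : DGHom M M)
  refine ⟨φ, hφ, ψ, hψ, h₁, ?_, ?_⟩
  · refine hε.semiFree.mem_homCoboundaries_of_comp hε.quasiIso (Submodule.sub_mem _
      (comp_mem_homCocycles (zero_add 0) hψ hφ) (id_mem F)) ?_
    have h := Submodule.add_mem _ (comp_mem_homCoboundaries_right (zero_add 0) h₂ hφ) h₁
    rw [← Submodule.neg_mem_iff]
    convert h using 1
    ext x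
    simp
  · refine hε'.semiFree.mem_homCoboundaries_of_comp hε'.quasiIso (Submodule.sub_mem _
      (comp_mem_homCocycles (zero_add 0) hφ hψ) (id_mem F')) ?_
    have h := Submodule.add_mem _ (comp_mem_homCoboundaries_right (zero_add 0) h₁ hψ) h₂
    rw [← Submodule.neg_mem_iff]
    convert h using 1
    ext x
    simp

end Comparison

/-! ### Finite twisted free modules -/

section TwistedFree

variable {k : Type u} [Field k]

theorem signTwist_mul (B : DGAlgebra k) (n : ℤ) (a a' : B) :
    signTwist B.grading n (a * a') = signTwist B.grading n a * signTwist B.grading n a' := by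
  refine DGAlgebra.hom_induction B.grading (f := signTwist B.grading n ∘ₗ LinearMap.mulRight k a')
    (g := LinearMap.mulRight k (signTwist B.grading n a') ∘ₗ signTwist B.grading n)
    (fun i a ha => ?_) a
  refine DGAlgebra.hom_induction B.grading (f := signTwist B.grading n ∘ₗ LinearMap.mulLeft k a)
    (g := LinearMap.mulLeft k (signTwist B.grading n a) ∘ₗ signTwist B.grading n)
    (fun j a' ha' => ?_) a'
  simp only [LinearMap.comp_apply, LinearMap.mulLeft_apply]
  rw [signTwist_of_mem B.grading ha, signTwist_of_mem B.grading ha',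
    signTwist_of_mem B.grading (SetLike.mul_mem_graded ha ha'), smul_mul_smul_comm, mul_add,
    sign_add]

theorem signTwist_mem {M : Type u} [AddCommGroup M] [Module k M] (ℳ : ℤ → Submodule k M)
    [DirectSum.Decomposition ℳ] (i : ℤ) {n : ℤ} {x : M} (hx : x ∈ ℳ n) :
    signTwist ℳ i x ∈ ℳ n := by
  rw [signTwist_of_mem ℳ hx]
  exact Submodule.smul_mem _ _ hx

/-- The Leibniz rule for an element `a` that need not be homogeneous. -/
theorem DGModule.leibniz_signTwist {B : DGAlgebra k} (N : DGModule B) (a : B) (x : N) :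
    N.d (a • x) = B.d a • x + signTwist B.grading 1 a • N.d x := by
  refine DGAlgebra.hom_induction B.grading
    (f := N.d ∘ₗ (LinearMap.toSpanSingleton B N x).restrictScalars k)
    (g := (LinearMap.toSpanSingleton B N x).restrictScalars k ∘ₗ B.d +
      (LinearMap.toSpanSingleton B N (N.d x)).restrictScalars k ∘ₗ signTwist B.grading 1)
    (fun i a ha => ?_) a
  simp only [LinearMap.comp_apply, LinearMap.add_apply, LinearMap.restrictScalars_apply,
    LinearMap.toSpanSingleton_apply]
  rw [N.leibniz x ha, signTwist_of_mem B.grading ha, one_mul, smul_assoc]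

variable (B : DGAlgebra k) (I : Type)

/-- The componentwise grading on `Bᴵ`. -/
def piGrading (n : ℤ) : Submodule k (I → B) where
  carrier := {f | ∀ i, f i ∈ B.grading n}
  zero_mem' _ := Submodule.zero_mem _
  add_mem' hf hg i := Submodule.add_mem _ (hf i) (hg i)
  smul_mem' c _ hf i := Submodule.smul_mem _ c (hf i)

variable {B I} in
theorem single_mem_piGrading [DecidableEq I] {n : ℤ} (i : I) {a : B} (ha : a ∈ B.grading n) :
    (Pi.single i a : I → B) ∈ piGrading B I n := by
  intro j
  rcases eq_or_ne j i with rfl | h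
  · rwa [Pi.single_eq_same]
  · rw [Pi.single_eq_of_ne h]
    exact Submodule.zero_mem _

/-- The differential `(∂f)ⱼ = ∂fⱼ + ∑ᵢ (-1) ^ |fᵢ| fᵢ δᵢⱼ` on `Bᴵ`. -/
def twistedD {B : DGAlgebra k} {I : Type} [Fintype I] (δ : I → I → B) : (I → B) →ₗ[k] I → B :=
  LinearMap.pi fun j => B.d ∘ₗ LinearMap.proj j +
    ∑ i, LinearMap.mulRight k (δ i j) ∘ₗ signTwist B.grading 1 ∘ₗ LinearMap.proj i

theorem twistedD_apply {B : DGAlgebra k} {I : Type} [Fintype I] (δ : I → I → B) (f : I → B)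
    (j : I) :
    twistedD δ f j = B.d (f j) + ∑ i, signTwist B.grading 1 (f i) * δ i j := by
  simp [twistedD]

variable [Fintype I] [DecidableEq I]

/-- The decomposition of a tuple into its homogeneous components. -/
def piDecompose : (I → B) →ₗ[k] ⨁ n, piGrading B I n :=
  ∑ i, DirectSum.toModule k ℤ (⨁ n, piGrading B I n) (fun n =>
      DirectSum.lof k ℤ (fun n => piGrading B I n) n ∘ₗ
        (LinearMap.single k (fun _ : I => B.carrier) i).restrict
          fun _ ha => single_mem_piGrading i ha) ∘ₗ
    (DirectSum.decomposeLinearEquiv B.grading).toLinearMap ∘ₗ LinearMap.proj i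

variable {B I} in
theorem piDecompose_of_mem {n : ℤ} {f : I → B} (hf : f ∈ piGrading B I n) :
    piDecompose B I f = DirectSum.lof k ℤ (fun n => piGrading B I n) n ⟨f, hf⟩ := by
  rw [piDecompose, LinearMap.sum_apply]
  have h (i : I) : (DirectSum.decomposeLinearEquiv B.grading) (f i) =
      DirectSum.lof k ℤ (fun n => B.grading n) n ⟨f i, hf i⟩ :=
    DirectSum.decompose_of_mem B.grading (hf i)
  simp only [LinearMap.comp_apply, LinearMap.proj_apply, LinearEquiv.coe_coe, h,
    DirectSum.toModule_lof]
  rw [← map_sum]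
  congr 1
  refine Subtype.ext ?_
  rw [AddSubmonoidClass.coe_finsetSum]
  exact Finset.univ_sum_single f

instance : DirectSum.Decomposition (piGrading B I) :=
  DirectSum.Decomposition.ofLinearMap _ (piDecompose B I)
    (by
      refine LinearMap.pi_ext' fun i => LinearMap.ext fun a => ?_
      refine DGAlgebra.hom_induction B.grading
        (f := (DirectSum.coeLinearMap (piGrading B I) ∘ₗ piDecompose B I) ∘ₗ
          LinearMap.single k (fun _ : I => B.carrier) i)
        (g := LinearMap.id ∘ₗ LinearMap.single k (fun _ : I => B.carrier) i) (fun n a ha => ?_) a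
      simp only [LinearMap.comp_apply, LinearMap.single_apply]
      rw [piDecompose_of_mem (single_mem_piGrading i ha), DirectSum.coeLinearMap_lof]
      rfl)
    (by
      ext n ⟨f, hf⟩ : 2
      rw [LinearMap.comp_apply, LinearMap.comp_apply, DirectSum.coeLinearMap_lof]
      exact piDecompose_of_mem hf)

variable {B I} (δ : I → I → B)
variable (hδ : ∀ i j, δ i j ∈ B.grading 1)
  (hδδ : ∀ i j, B.d (δ i j) = ∑ l, δ i l * δ l j)

/-- The free module over `B` with a finite basis `(eᵢ)` in degree `0` and the differential
`∂eᵢ = ∑ⱼ δᵢⱼ eⱼ`, whose square vanishes by the Maurer–Cartan equation for the matrix `δ`. -/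
abbrev twistedFree : DGModule B where
  carrier := I → B
  grading := piGrading B I
  smul_mem ha hf i := SetLike.mul_mem_graded ha (hf i)
  d := twistedD δ
  d_mem {n f} hf j := by
    rw [twistedD_apply]
    exact Submodule.add_mem _ (B.d_mem (hf j)) (Submodule.sum_mem _ fun i _ =>
      SetLike.mul_mem_graded (signTwist_mem _ _ (hf i)) (hδ i j))
  d_d f := by
    funext j
    have hs (i l : I) : signTwist B.grading 1 (δ i l) = -δ i l := by
      rw [signTwist_of_mem B.grading (hδ i l)]
      simp
    simp only [twistedD_apply, map_add, B.d_d, map_sum, B.leibniz_signTwist, B.d_signTwist,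
      B.signTwist_signTwist, signTwist_mul, hδδ, hs, Finset.sum_mul, add_mul, Finset.mul_sum,
      Finset.sum_add_distrib]
    rw [Finset.sum_comm (f := fun i l => f l * -δ l i * δ i j)]
    simp only [zero_add, neg_mul, mul_neg, Finset.sum_neg_distrib, mul_assoc, Pi.zero_apply]
    abel
  leibniz {n a} f ha := by
    funext j
    change twistedD δ (a • f) j = B.d a * f j + (-1 : k) ^ n • (a * twistedD δ f j)
    simp only [twistedD_apply, Pi.smul_apply, smul_eq_mul, B.leibniz _ ha, signTwist_mul,
      signTwist_of_mem B.grading ha, one_mul, smul_add, mul_add, Finset.mul_sum,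
      Finset.smul_sum, smul_mul_assoc, mul_assoc, add_assoc]

/-- The morphism from a twisted free module that maps the basis elements `eᵢ` to given elements
`mᵢ` of degree `0` with `∂mᵢ = ∑ⱼ δᵢⱼ mⱼ`. -/
def twistedFreeLift (N : DGModule B) (m : I → N) (hm : ∀ i, m i ∈ N.grading 0)
    (hd : ∀ i, N.d (m i) = ∑ j, δ i j • m j) : DGHom (twistedFree δ hδ hδδ) N where
  toLinearMap := Fintype.linearCombination B m
  map_mem {n f} hf := by
    rw [Fintype.linearCombination_apply]
    refine Submodule.sum_mem _ fun i _ => ?_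
    have h := N.smul_mem (hf i) (hm i)
    rwa [add_zero] at h
  comm f := by
    simp only [Fintype.linearCombination_apply, map_sum, N.leibniz_signTwist, hd]
    change ∑ i, twistedD δ f i • m i = _
    simp only [twistedD_apply, add_smul, Finset.sum_add_distrib, Finset.sum_smul, Finset.smul_sum,
      mul_smul]
    rw [Finset.sum_comm]

variable {δ hδ hδδ} in
theorem twistedFreeLift_apply {N : DGModule B} {m : I → N} {hm : ∀ i, m i ∈ N.grading 0}
    {hd : ∀ i, N.d (m i) = ∑ j, δ i j • m j} (f : I → B) :
    (twistedFreeLift δ hδ hδδ N m hm hd).toLinearMap f = ∑ i, f i • m i :=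
  Fintype.linearCombination_apply _ _ _

/-- The standard basis of a twisted free module, indexed by a type in the universe of `B`. -/
def twistedBasis : Module.Basis (ULift.{u} I) B (twistedFree δ hδ hδδ) :=
  (Pi.basisFun B I).reindex Equiv.ulift.symm

theorem twistedBasis_apply (i : ULift.{u} I) :
    twistedBasis δ hδ hδδ i = (Pi.single i.down 1 : I → B) := by
  rw [twistedBasis, Module.Basis.reindex_apply, Pi.basisFun_apply]
  rfl

theorem twistedD_single_one (i : I) :
    twistedD δ (Pi.single i 1) = ∑ j, δ i j • (Pi.single j 1 : I → B) := by
  have h1 : signTwist B.grading 1 (1 : B) = 1 := by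
    rw [signTwist_of_mem B.grading (SetLike.one_mem_graded B.grading)]
    simp
  funext j
  rw [twistedD_apply, Finset.sum_apply, Finset.sum_eq_single i, Finset.sum_eq_single j]
  · rcases eq_or_ne j i with rfl | h
    · simp [B.d_one, h1]
    · simp [Pi.single_eq_of_ne h, h1]
  · intro l _ hl
    simp [Pi.single_eq_of_ne hl.symm]
  · simp
  · intro l _ hl
    simp [Pi.single_eq_of_ne hl]
  · simp

theorem isSemiBasis_twistedBasis (r : I → ℕ) (hr : ∀ i j, δ i j ≠ 0 → r j < r i) :
    IsSemiBasis (twistedBasis δ hδ hδδ) fun _ => 0 where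
  mem_grading i := by
    rw [twistedBasis_apply]
    exact single_mem_piGrading _ (SetLike.one_mem_graded B.grading)
  filtration := by
    refine ⟨fun i => r i.down, fun i => ?_⟩
    rw [twistedBasis_apply]
    change twistedD δ (Pi.single i.down 1) ∈ _
    rw [twistedD_single_one]
    refine Submodule.sum_mem _ fun j _ => ?_
    by_cases h : δ i.down j = 0
    · rw [h, zero_smul]
      exact Submodule.zero_mem _
    · refine Submodule.smul_mem _ _ (Submodule.subset_span ⟨⟨j⟩, hr _ _ h, ?_⟩)
      rw [twistedBasis_apply]

end TwistedFree

/-! ### Compactness of modules with a finite semi-free resolution -/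

section FiniteCompact

variable {k : Type u} [Field k] {A : DGAlgebra k}

/-- The projection of a direct sum onto a summand. -/
def directSumProj {ι : Type u} (N : ι → DGModule A) (i : ι) : DGHom (directSum N) (N i) where
  toLinearMap := DirectSum.component A ι (fun i => N i) i
  map_mem hx := hx i
  comm _ := rfl

open Classical in
theorem directSumIncl_apply {ι : Type u} (N : ι → DGModule A) (i j : ι) (x : N i) :
    (directSumIncl N i).toLinearMap x j = if h : i = j then h ▸ x else 0 := by
  change DirectSum.lof A ι (fun i => N i) i x j = _
  rw [DirectSum.lof_eq_of]
  split_ifs with h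
  · subst h
    exact DirectSum.of_eq_same _ _
  · exact DirectSum.of_eq_of_ne _ _ _ (Ne.symm h)

/-- A module with a finite semi-free resolution is compact: a homomorphism from a module with a
finite basis into a direct sum has its values on the basis in finitely many summands. -/
theorem DGModule.isCompact_of_finite_semiBasis {F M : DGModule A} (ε : DGHom F M)
    (hε : ε.IsQuasiIso) {I : Type u} [Finite I] {b : Module.Basis I A F} {deg : I → ℤ}
    (hb : IsSemiBasis b deg) : M.IsCompact := by
  classical
  refine ⟨F, ε, ⟨⟨I, b, deg, hb⟩, hε⟩, fun ι N => ⟨?_, ?_⟩⟩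
  · intro x x' hx
    refine DFinsupp.ext fun i => ?_
    have key : homCohomologyMap F (directSumProj N i) 0 ∘ₗ
        (DirectSum.toModule k ι (HomCohomology F (directSum N) 0) fun i =>
          homCohomologyMap F (directSumIncl N i) 0) =
        DirectSum.component k ι (fun i => HomCohomology F (N i) 0) i := by
      refine DirectSum.linearMap_ext k fun j => LinearMap.ext fun y => ?_
      rw [LinearMap.comp_apply, LinearMap.comp_apply, DirectSum.toModule_lof,
        LinearMap.comp_apply, DirectSum.component.of]
      obtain ⟨⟨f, hf⟩, rfl⟩ := Submodule.Quotient.mk_surjective _ y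
      split_ifs with h
      · subst h
        refine congrArg Submodule.Quotient.mk (Subtype.ext (LinearMap.ext fun x => ?_))
        exact (directSumIncl_apply N j j (f x)).trans (dif_pos rfl)
      · refine (Submodule.Quotient.mk_eq_zero _).2 ?_
        convert Submodule.zero_mem _ using 1
        refine Subtype.ext (LinearMap.ext fun x => ?_)
        exact (directSumIncl_apply N j i (f x)).trans (dif_neg h)
    have h := LinearMap.congr_fun key x
    rw [LinearMap.comp_apply, hx] at h
    exact h.symm.trans (LinearMap.congr_fun key x')
  · intro y
    obtain ⟨⟨f, hf⟩, rfl⟩ := Submodule.Quotient.mk_surjective _ y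
    cases nonempty_fintype I
    let S : Finset ι := Finset.univ.biUnion fun j => DFinsupp.support (f (b j))
    let p (i : ι) : homCocycles F (N i) 0 :=
      ⟨(directSumProj N i).toLinearMap.restrictScalars k ∘ₗ f,
        comp_mem_homCocycles (zero_add 0) (directSumProj N i).mem_homCocycles hf⟩
    let q (i : ι) : homCocycles F (directSum N) 0 :=
      ⟨(directSumIncl N i).toLinearMap.restrictScalars k ∘ₗ (p i : F →ₗ[k] N i),
        comp_mem_homCocycles (zero_add 0) (directSumIncl N i).mem_homCocycles (p i).2⟩
    refine ⟨∑ i ∈ S, DirectSum.lof k ι (fun i => HomCohomology F (N i) 0) i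
      (Submodule.Quotient.mk (p i)), ?_⟩
    rw [map_sum]
    simp only [DirectSum.toModule_lof]
    have e : (⟨f, hf⟩ : homCocycles F (directSum N) 0) = ∑ i ∈ S, q i := by
      refine Subtype.ext (homDeg_ext_basis b hf.1 (∑ i ∈ S, q i).2.1 fun j => ?_)
      rw [AddSubmonoidClass.coe_finsetSum, LinearMap.sum_apply]
      refine DFinsupp.ext fun i => ?_
      refine Eq.trans ?_
        (DFinsupp.finsetSum_apply S (fun l => (q l : F →ₗ[k] ⨁ i, N i) (b j)) i).symm
      have hq (l : ι) : ((q l : F →ₗ[k] ⨁ i, N i) (b j)) i =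
          if h : l = i then h ▸ (f (b j)) l else 0 := directSumIncl_apply N l i _
      by_cases hi : i ∈ S
      · rw [Finset.sum_eq_single_of_mem i hi fun l _ hl => (hq l).trans (dif_neg hl), hq,
          dif_pos rfl]
      · rw [Finset.sum_eq_zero fun l hl => (hq l).trans (dif_neg (by rintro rfl; exact hi hl))]
        by_contra h
        exact hi (Finset.mem_biUnion.2 ⟨j, Finset.mem_univ _, DFinsupp.mem_support_iff.2 h⟩)
    rw [e]
    exact (map_sum (Submodule.mkQ _) q S).symm

end FiniteCompact

/-! ### Recursion on words in the free algebra -/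

section FreeRecursion

variable {k : Type u} [Field k] {X : Type}

theorem freeAlgebra_mem_of_left_mul {S : Submodule k (FreeAlgebra k X)} (h1 : 1 ∈ S)
    (hmul : ∀ x, ∀ a ∈ S, FreeAlgebra.ι k x * a ∈ S) (a : FreeAlgebra k X) : a ∈ S := by
  suffices h : ∀ b ∈ S, a * b ∈ S by simpa using h 1 h1
  induction a using FreeAlgebra.induction with
  | grade0 r => intro b hb; rw [← Algebra.smul_def]; exact Submodule.smul_mem _ _ hb
  | grade1 x => exact hmul x
  | mul a b ha hb => intro c hc; rw [mul_assoc]; exact ha _ (hb c hc)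
  | add a b ha hb => intro c hc; rw [add_mul]; exact Submodule.add_mem _ (ha c hc) (hb c hc)

/-- Two linear maps on the free algebra agree if they agree at `1` and agree at `xa` for each
generator `x` whenever they agree at `a`. -/
theorem freeAlgebra_hom_ext_left {V : Type*} [AddCommGroup V] [Module k V]
    {f g : FreeAlgebra k X →ₗ[k] V} (h1 : f 1 = g 1)
    (hmul : ∀ x a, f a = g a → f (FreeAlgebra.ι k x * a) = g (FreeAlgebra.ι k x * a))
    (a : FreeAlgebra k X) : f a = g a :=
  freeAlgebra_mem_of_left_mul (S := LinearMap.eqLocus f g) h1 hmul a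

variable {V W : Type u} [AddCommGroup V] [Module k V] [AddCommGroup W] [Module k W]
  (l : X → Module.End k V) (m : X → Module.End k W) (c : X → W →ₗ[k] V)

/-- The action of the free algebra on `V × W` in which a generator `x` maps `(v, w)` to
`(c_x w - l_x v, m_x w)`. -/
def skewAction : FreeAlgebra k X →ₐ[k] Module.End k (V × W) :=
  FreeAlgebra.lift k fun x =>
    LinearMap.prod (c x ∘ₗ LinearMap.snd k V W - l x ∘ₗ LinearMap.fst k V W)
      (m x ∘ₗ LinearMap.snd k V W)

/-- The skew derivation with `1 ↦ 0` and `xa ↦ c_x ∘ m_a - l_x ∘ D(a)` for each generator `x`. -/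
def skewDerivation : FreeAlgebra k X →ₗ[k] W →ₗ[k] V :=
  LinearMap.compr₂ ((skewAction l m c).toLinearMap.compl₂ (LinearMap.inr k V W))
    (LinearMap.fst k V W)

theorem skewDerivation_one : skewDerivation l m c 1 = 0 := by
  ext w
  simp [skewDerivation]

theorem skewDerivation_ι_mul (x : X) (a : FreeAlgebra k X) (w : W) :
    skewDerivation l m c (FreeAlgebra.ι k x * a) w =
      c x (FreeAlgebra.lift k m a w) - l x (skewDerivation l m c a w) := by
  have h : (skewAction l m c a (0, w)).2 = FreeAlgebra.lift k m a w := by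
    refine freeAlgebra_hom_ext_left
      (f := LinearMap.snd k V W ∘ₗ (skewAction l m c).toLinearMap.flip (0, w))
      (g := (FreeAlgebra.lift k m).toLinearMap.flip w) (by simp) (fun x a ha => ?_) a
    simp only [LinearMap.comp_apply, LinearMap.flip_apply, AlgHom.toLinearMap_apply, map_mul,
      Module.End.mul_apply] at ha ⊢
    rw [← ha, skewAction, FreeAlgebra.lift_ι_apply, FreeAlgebra.lift_ι_apply]
    rfl
  rw [← h]
  simp only [skewDerivation, LinearMap.compr₂_apply, LinearMap.compl₂_apply,
    AlgHom.toLinearMap_apply, map_mul, Module.End.mul_apply, LinearMap.inr_apply]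
  conv_lhs => rw [skewAction, FreeAlgebra.lift_ι_apply]
  rfl

end FreeRecursion

/-! ### The augmentation of a connected algebra -/

namespace DGAlgebra

variable {k : Type u} [Field k] (A : DGAlgebra k) [A.IsConnected]

theorem aug_of_mem {n : ℤ} (hn : n ≠ 0) {a : A} (ha : a ∈ A.grading n) : A.aug a = 0 :=
  A.augLinear_of_ne hn ha

theorem aug_d (a : A) : A.aug (A.d a) = 0 := by
  refine hom_induction A.grading (f := A.aug.toLinearMap ∘ₗ A.d) (g := 0) (fun n a ha => ?_) a
  rcases eq_or_ne (n + 1) 0 with hn | hn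
  · rw [IsConnected.grading_neg n (by omega), Submodule.mem_bot] at ha
    simp [ha]
  · exact A.aug_of_mem hn (A.d_mem ha)

/-- A multiple `a • x` lies in `𝔪 M` if `a` lies in the augmentation ideal `𝔪`. -/
theorem smul_mem_span_of_aug_eq_zero (M : DGModule A) {a : A} (ha : A.aug a = 0) (x : M) :
    a • x ∈ Submodule.span k {y : M | ∃ n : ℤ, 0 < n ∧ ∃ a ∈ A.grading n, ∃ z : M, y = a • z} := by
  set S := Submodule.span k
    {y : M | ∃ n : ℤ, 0 < n ∧ ∃ a ∈ A.grading n, ∃ z : M, y = a • z} with hS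
  have h (a : A) : S.mkQ (a • x) = S.mkQ (A.aug a • x) := by
    refine hom_induction A.grading
      (f := S.mkQ ∘ₗ (LinearMap.toSpanSingleton A M x).restrictScalars k)
      (g := S.mkQ ∘ₗ LinearMap.toSpanSingleton k M x ∘ₗ A.aug.toLinearMap) (fun n a ha => ?_) a
    simp only [LinearMap.comp_apply, LinearMap.restrictScalars_apply,
      LinearMap.toSpanSingleton_apply, AlgHom.toLinearMap_apply]
    rcases lt_trichotomy n 0 with hn | rfl | hn
    · rw [IsConnected.grading_neg n hn, Submodule.mem_bot] at ha
      simp [ha]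
    · obtain ⟨c, rfl⟩ := IsConnected.grading_zero (A := A) a ha
      rw [AlgHom.commutes, algebraMap_smul]
      rfl
    · rw [A.aug_of_mem hn.ne' ha, zero_smul, map_zero, Submodule.mkQ_apply,
        Submodule.Quotient.mk_eq_zero]
      exact Submodule.subset_span ⟨n, hn, a, ha, x, rfl⟩
  have := h a
  rwa [ha, zero_smul, map_zero, Submodule.mkQ_apply, Submodule.Quotient.mk_eq_zero] at this

end DGAlgebra

/-! ### The minimal resolution of the trivial module -/

section TrivialResolution

variable (k : Type u) [Field k]

theorem exampleDiff_zero : exampleDiff k 0 = FreeAlgebra.ι k 1 * FreeAlgebra.ι k 2 := rfl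

theorem exampleDiff_one : exampleDiff k 1 = 0 := rfl

theorem exampleDiff_two : exampleDiff k 2 = 0 := rfl

theorem exampleAlgebra_aug_ι (x : Fin 3) : (exampleAlgebra k).aug (FreeAlgebra.ι k x) = 0 :=
  (exampleAlgebra k).aug_of_mem one_ne_zero (ι_mem k x)

/-- The matrix of the differential `∂e₀ = 0`, `∂e₁ = x₁e₀ + x₂e₃`, `∂e₂ = x₂e₀`, `∂e₃ = x₃e₀`.
The index `none` belongs to `e₀`, and the generators `x₁, x₂, x₃` have the indices `0, 1, 2`. -/
def resMatrix : Option (Fin 3) → Option (Fin 3) → exampleAlgebra k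
  | none, _ => 0
  | some i, none => FreeAlgebra.ι k i
  | some i, some j => if i = 0 ∧ j = 2 then FreeAlgebra.ι k 1 else 0

theorem resMatrix_mem (i j : Option (Fin 3)) :
    resMatrix k i j ∈ (exampleAlgebra k).grading 1 := by
  match i, j with
  | none, _ => exact Submodule.zero_mem _
  | some i, none => exact ι_mem k i
  | some i, some j =>
    rw [resMatrix]
    split_ifs
    · exact ι_mem k 1
    · exact Submodule.zero_mem _

theorem d_resMatrix (i j : Option (Fin 3)) :
    (exampleAlgebra k).d (resMatrix k i j) = ∑ l, resMatrix k i l * resMatrix k l j := by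
  rw [Fintype.sum_option, Fin.sum_univ_three]
  match i, j with
  | none, _ => simp [resMatrix]
  | some i, none =>
    fin_cases i <;> simp [resMatrix, freeDiff_ι, exampleDiff_zero, exampleDiff_one,
      exampleDiff_two]
  | some i, some j =>
    fin_cases i <;> fin_cases j <;> simp [resMatrix, freeDiff_ι, exampleDiff_one]

/-- The semi-free module on `e₀, e₁, e₂, e₃` that resolves the trivial module. -/
abbrev trivialRes : DGModule (exampleAlgebra k) :=
  twistedFree (resMatrix k) (resMatrix_mem k) (d_resMatrix k)

/-- The number of the layer of a basis element of the resolution. -/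
def resLayer : Option (Fin 3) → ℕ
  | none => 0
  | some i => if i = 0 then 2 else 1

theorem resLayer_lt (i j : Option (Fin 3)) (h : resMatrix k i j ≠ 0) :
    resLayer j < resLayer i := by
  match i, j with
  | none, _ => exact absurd rfl h
  | some i, none =>
    simp only [resLayer]
    split_ifs <;> omega
  | some i, some j =>
    rw [resMatrix] at h
    split_ifs at h with hij
    · simp [resLayer, hij.1, hij.2]
    · exact absurd rfl h

/-- The morphism from the resolution to the trivial module with `e₀ ↦ 1` and `eᵢ ↦ 0`. -/
def trivialResAug : DGHom (trivialRes k) (exampleAlgebra k).trivialModule :=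
  twistedFreeLift (resMatrix k) (resMatrix_mem k) (d_resMatrix k) _
    (fun i => if i = none then (1 : k) else 0)
    (fun i => by simp [DGAlgebra.trivialGrading])
    (fun i => by
      change (0 : k) =
        ∑ j, (exampleAlgebra k).aug (resMatrix k i j) * (if j = none then (1 : k) else 0)
      rw [Fintype.sum_option]
      match i with
      | none => simp [resMatrix]
      | some i => simpa [resMatrix] using (exampleAlgebra_aug_ι k i).symm)

theorem trivialResAug_apply (f : trivialRes k) :
    (trivialResAug k).toLinearMap f = (exampleAlgebra k).aug (f none) := by
  rw [trivialResAug, twistedFreeLift_apply]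
  change ∑ j, (exampleAlgebra k).aug (f j) * (if j = none then (1 : k) else 0) = _
  rw [Fintype.sum_option]
  simp

/-- The basis element `eᵢ` of the resolution. -/
abbrev resBasis (i : Option (Fin 3)) : trivialRes k :=
  (Pi.single i (1 : FreeAlgebra k (Fin 3)) : Option (Fin 3) → FreeAlgebra k (Fin 3))

theorem trivialRes_d_resBasis (i : Option (Fin 3)) :
    (trivialRes k).d (resBasis k i) = ∑ j, resMatrix k i j • resBasis k j :=
  twistedD_single_one (resMatrix k) i

/-- The contraction `a e₀ ↦ D(a)` of the resolution: the linear map `D` has the values `D(1) = 0`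
and `D(xᵢa) = ε(a)eᵢ - xᵢD(a)`. -/
def resContraction : exampleAlgebra k →ₗ[k] trivialRes k :=
  (skewDerivation (fun x => Algebra.lsmul k k (trivialRes k) (FreeAlgebra.ι k x))
    (fun _ => (0 : Module.End k k))
    (fun x => LinearMap.toSpanSingleton k (trivialRes k) (resBasis k (some x)))).flip 1

theorem resContraction_one : resContraction k 1 = 0 := by
  rw [resContraction, LinearMap.flip_apply, skewDerivation_one, LinearMap.zero_apply]

theorem resContraction_ι_mul (x : Fin 3) (a : exampleAlgebra k) :
    resContraction k (FreeAlgebra.ι k x * a) =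
      (exampleAlgebra k).aug a • resBasis k (some x) -
        (FreeAlgebra.ι k x : exampleAlgebra k) • resContraction k a := by
  have h : FreeAlgebra.lift k (fun _ : Fin 3 => (0 : Module.End k k)) a 1 =
      (exampleAlgebra k).aug a := by
    refine freeAlgebra_hom_ext_left
      (f := (FreeAlgebra.lift k (fun _ : Fin 3 => (0 : Module.End k k))).toLinearMap.flip 1)
      (g := (exampleAlgebra k).aug.toLinearMap) (by simp) (fun x a _ => ?_) a
    have h := map_mul (exampleAlgebra k).aug (FreeAlgebra.ι k x) a
    rw [exampleAlgebra_aug_ι, zero_mul] at h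
    simpa using h.symm
  rw [resContraction, LinearMap.flip_apply, skewDerivation_ι_mul, h]
  rfl

/-- The contraction inverts the component `aeᵢ ↦ ± axᵢe₀` of the differential of the resolution. -/
theorem resContraction_mul_ι (a : exampleAlgebra k) (i : Fin 3) :
    resContraction k (signTwist (exampleAlgebra k).grading 1 a * FreeAlgebra.ι k i) =
      a • resBasis k (some i) := by
  refine freeAlgebra_hom_ext_left
    (f := resContraction k ∘ₗ LinearMap.mulRight k (FreeAlgebra.ι k i) ∘ₗ
      signTwist (exampleAlgebra k).grading 1)
    (g := (LinearMap.toSpanSingleton (exampleAlgebra k) (trivialRes k)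
      (resBasis k (some i))).restrictScalars k) ?_ (fun x a ha => ?_) a
  · simp only [LinearMap.comp_apply, LinearMap.mulRight_apply, LinearMap.restrictScalars_apply,
      LinearMap.toSpanSingleton_apply]
    rw [signTwist_of_mem (exampleAlgebra k).grading
      (SetLike.one_mem_graded (exampleAlgebra k).grading)]
    have h := resContraction_ι_mul k i 1
    rw [resContraction_one, smul_zero, sub_zero, map_one, one_smul, mul_one] at h
    simpa using h
  · simp only [LinearMap.comp_apply, LinearMap.mulRight_apply, LinearMap.restrictScalars_apply,
      LinearMap.toSpanSingleton_apply] at ha ⊢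
    rw [signTwist_mul (exampleAlgebra k), signTwist_of_mem (exampleAlgebra k).grading (ι_mem k x),
      mul_one, zpow_one, smul_mul_assoc, smul_mul_assoc, map_smul, mul_assoc,
      resContraction_ι_mul, map_mul (exampleAlgebra k).aug,
      exampleAlgebra_aug_ι, mul_zero, zero_smul, ha, zero_sub, mul_smul]
    simp

theorem trivialRes_d_ι_smul (x : Fin 3) (f : trivialRes k) :
    (trivialRes k).d ((FreeAlgebra.ι k x : exampleAlgebra k) • f) =
      exampleDiff k x • f - (FreeAlgebra.ι k x : exampleAlgebra k) • (trivialRes k).d f := by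
  rw [(trivialRes k).leibniz (n := 1) f (ι_mem k x), zpow_one, neg_one_smul, ← sub_eq_add_neg]
  congr 2
  exact freeDiff_ι k _ x

/-- The contraction is a homotopy between the identity and the augmentation on the submodule
generated by `e₀`. -/
theorem d_resContraction (a : exampleAlgebra k) :
    (trivialRes k).d (resContraction k a) + resContraction k ((exampleAlgebra k).d a) =
      a • resBasis k none - (exampleAlgebra k).aug a • resBasis k none := by
  refine freeAlgebra_hom_ext_left
    (f := (trivialRes k).d ∘ₗ resContraction k + resContraction k ∘ₗ (exampleAlgebra k).d)
    (g := (LinearMap.toSpanSingleton (exampleAlgebra k) (trivialRes k)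
      (resBasis k none)).restrictScalars k -
      LinearMap.toSpanSingleton k (trivialRes k) (resBasis k none) ∘ₗ
        (exampleAlgebra k).aug.toLinearMap) ?_ (fun x a ha => ?_) a
  · simp only [LinearMap.add_apply, LinearMap.comp_apply, LinearMap.sub_apply,
      LinearMap.restrictScalars_apply, LinearMap.toSpanSingleton_apply, AlgHom.toLinearMap_apply]
    rw [(exampleAlgebra k).d_one, resContraction_one, map_one, one_smul, one_smul]
    simp
  · simp only [LinearMap.add_apply, LinearMap.comp_apply, LinearMap.sub_apply,
      LinearMap.restrictScalars_apply, LinearMap.toSpanSingleton_apply,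
      AlgHom.toLinearMap_apply] at ha ⊢
    -- The defect of the differential on the generators is matched by the extra term of `∂e₁`.
    have key : resContraction k (exampleDiff k x * a) = exampleDiff k x • resContraction k a -
        (exampleAlgebra k).aug a • ((trivialRes k).d (resBasis k (some x)) -
          (FreeAlgebra.ι k x : exampleAlgebra k) • resBasis k none) := by
      rw [trivialRes_d_resBasis, Fintype.sum_option, Fin.sum_univ_three]
      fin_cases x
      · have h₁ := resContraction_ι_mul k 1 (FreeAlgebra.ι k 2 * a)
        rw [resContraction_ι_mul k 2, map_mul (exampleAlgebra k).aug, exampleAlgebra_aug_ι,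
          zero_mul, zero_smul, zero_sub, smul_sub, smul_comm _ ((exampleAlgebra k).aug a),
          ← mul_smul] at h₁
        simp only [exampleDiff, resMatrix]
        simp only [Fin.isValue, Fin.zero_eta, Matrix.cons_val_zero, mul_assoc]
        refine h₁.trans ?_
        simp
      · simp [exampleDiff, resMatrix]
      · simp [exampleDiff, resMatrix]
    have hda : (exampleAlgebra k).d (FreeAlgebra.ι k x * a) =
        exampleDiff k x * a - FreeAlgebra.ι k x * (exampleAlgebra k).d a := by
      refine (freeDiff_ι_mul k _ x a).trans ?_
      rfl
    rw [resContraction_ι_mul, hda, map_sub, map_sub, map_smul, trivialRes_d_ι_smul, key,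
      resContraction_ι_mul, (exampleAlgebra k).aug_d, zero_smul, map_mul, exampleAlgebra_aug_ι,
      zero_mul, zero_smul, mul_smul, ← sub_eq_iff_eq_add'.2 ha.symm, smul_sub]
    simp only [smul_sub, smul_comm _ ((exampleAlgebra k).aug a)]
    abel

end TrivialResolution

section Koszul

variable (k : Type u) [Field k]

theorem trivialRes_eq_sum (f : trivialRes k) : f = ∑ i, f i • resBasis k i := by
  refine (Finset.univ_sum_single f).symm.trans (Finset.sum_congr rfl fun i _ => ?_)
  rw [← Pi.single_smul, smul_eq_mul, mul_one]

theorem trivialRes_d_apply (f : trivialRes k) (j : Option (Fin 3)) :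
    (trivialRes k).d f j = (exampleAlgebra k).d (f j) +
      ∑ i, signTwist (exampleAlgebra k).grading 1 (f i) * resMatrix k i j :=
  twistedD_apply (resMatrix k) f j

/-- The contraction `∑ aᵢeᵢ ↦ D(a₀)` is a homotopy between the identity and the augmentation. -/
theorem trivialResAug_isQuasiIso : (trivialResAug k).IsQuasiIso := by
  refine DGHom.isQuasiIso_of_contraction _
    (LinearMap.toSpanSingleton k (trivialRes k) (resBasis k none))
    (resContraction k ∘ₗ LinearMap.proj none) (fun y => ?_) (fun y => ?_) (fun f => ?_)
  · refine ((trivialRes k).d.map_smul _ _).trans ?_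
    rw [trivialRes_d_resBasis]
    simp [resMatrix]
  · rw [trivialResAug_apply]
    change (exampleAlgebra k).aug ((y : k) • (1 : exampleAlgebra k)) = y
    rw [map_smul, map_one]
    exact mul_one _
  · rw [trivialResAug_apply, LinearMap.comp_apply, LinearMap.comp_apply, LinearMap.proj_apply,
      LinearMap.proj_apply, trivialRes_d_apply, map_add, map_sum, ← add_assoc, d_resContraction,
      Fintype.sum_option]
    have h (i : Fin 3) := resContraction_mul_ι k (f (some i)) i
    simp only [resMatrix, h, mul_zero, map_zero, zero_add]
    have hf := trivialRes_eq_sum k f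
    rw [Fintype.sum_option] at hf
    rw [LinearMap.toSpanSingleton_apply, eq_sub_of_add_eq' hf.symm]
    abel

theorem trivialResAug_isSemiFreeResolution : IsSemiFreeResolution (trivialResAug k) :=
  ⟨⟨_, _, _, isSemiBasis_twistedBasis _ _ _ resLayer (resLayer_lt k)⟩,
    trivialResAug_isQuasiIso k⟩

theorem trivialRes_isMinimal : (trivialRes k).IsMinimal := by
  intro f
  rw [trivialRes_eq_sum k ((trivialRes k).d f)]
  refine Submodule.sum_mem _ fun j _ =>
    DGAlgebra.smul_mem_span_of_aug_eq_zero _ (trivialRes k) ?_ _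
  rw [trivialRes_d_apply, map_add, (exampleAlgebra k).aug_d, map_sum, zero_add]
  refine Finset.sum_eq_zero fun i _ => ?_
  rw [map_mul (exampleAlgebra k).aug,
    (exampleAlgebra k).aug_of_mem one_ne_zero (resMatrix_mem k i j), mul_zero]

theorem exampleAlgebra_isKoszul : (exampleAlgebra k).IsKoszul :=
  ⟨_, trivialResAug k, trivialResAug_isQuasiIso k, trivialRes_isMinimal k, _, _,
    isSemiBasis_twistedBasis _ _ _ resLayer (resLayer_lt k)⟩

end Koszul

/-! ### The cohomology algebra -/

section Cohomology

/-- A homomorphism of algebras vanishes on the coboundaries if it vanishes on the differentials of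
the generators. -/
theorem algHom_freeDiff_eq_zero {k : Type u} [Field k] {X : Type} {R : Type*} [Ring R]
    [Algebra k R] (D : X → FreeAlgebra k X) (θ : FreeAlgebra k X →ₐ[k] R)
    (h : ∀ x, θ (D x) = 0) (a : FreeAlgebra k X) : θ (freeDiff k D a) = 0 := by
  refine freeAlgebra_hom_ext_left (f := θ.toLinearMap ∘ₗ freeDiff k D) (g := 0)
    (by simp [freeDiff_one]) (fun x a ha => ?_) a
  have ha' : θ (freeDiff k D a) = 0 := ha
  simp [freeDiff_ι_mul, h, ha']

/-- The projection from the cocycles to the cohomology algebra. -/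
def toCohomology {k : Type u} [Field k] (A : DGAlgebra k) : A.cocycles →ₐ[k] A.Cohomology :=
  Ideal.Quotient.mkₐ k A.coboundaries

theorem toCohomology_surjective {k : Type u} [Field k] (A : DGAlgebra k) :
    Function.Surjective (toCohomology A) :=
  Ideal.Quotient.mk_surjective (I := A.coboundaries)

theorem toCohomology_eq_zero_iff {k : Type u} [Field k] {A : DGAlgebra k} {z : A.cocycles} :
    toCohomology A z = 0 ↔ ∃ x, A.d x = z :=
  Ideal.Quotient.eq_zero_iff_mem (I := A.coboundaries)

/-- The homomorphism from the cohomology algebra defined by a homomorphism from the cocycles that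
vanishes on the coboundaries. -/
def cohomologyLift {k : Type u} [Field k] {A : DGAlgebra k} {R : Type*} [Ring R] [Algebra k R]
    (θ : A.cocycles →ₐ[k] R) (h : ∀ z : A.cocycles, (∃ x, A.d x = z) → θ z = 0) :
    A.Cohomology →ₐ[k] R :=
  Ideal.Quotient.liftₐ A.coboundaries θ h

variable (k : Type u) [Field k]

/-- The linear map from the vector space with basis `ℕ × ℕ` to the algebra that maps the basis
vector `(a, b)` to the cocycle `x₃ᵃ x₂ᵇ`. -/
def normalForm : (ℕ × ℕ →₀ k) →ₗ[k] exampleAlgebra k :=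
  Finsupp.linearCombination k fun p =>
    FreeAlgebra.ι k (2 : Fin 3) ^ p.1 * FreeAlgebra.ι k (1 : Fin 3) ^ p.2

theorem normalForm_single (p : ℕ × ℕ) : normalForm k (Finsupp.single p 1) =
    FreeAlgebra.ι k (2 : Fin 3) ^ p.1 * FreeAlgebra.ι k (1 : Fin 3) ^ p.2 := by
  rw [normalForm, Finsupp.linearCombination_single, one_smul]

/-- The representation of `k⟨x₁, x₂, x₃⟩ / (x₁, x₂x₃)` on the span of the normal forms
`x₃ᵃ x₂ᵇ`, by left multiplication. -/
def normalAction : FreeAlgebra k (Fin 3) →ₐ[k] Module.End k (ℕ × ℕ →₀ k) :=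
  FreeAlgebra.lift k ![0,
    Finsupp.linearCombination k fun p => if p.1 = 0 then Finsupp.single (0, p.2 + 1) 1 else 0,
    Finsupp.linearCombination k fun p => Finsupp.single (p.1 + 1, p.2) 1]

/-- The coordinates in the normal forms `x₃ᵃ x₂ᵇ`, as a linear map that vanishes on the
coboundaries. -/
def normalCoord : exampleAlgebra k →ₗ[k] (ℕ × ℕ →₀ k) :=
  (normalAction k).toLinearMap.flip (Finsupp.single (0, 0) 1)

theorem normalCoord_normalForm (v : ℕ × ℕ →₀ k) : normalCoord k (normalForm k v) = v := by
  have h₁ (b : ℕ) : (normalAction k (FreeAlgebra.ι k 1) ^ b) (Finsupp.single (0, 0) 1) =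
      Finsupp.single (0, b) 1 := by
    induction b with
    | zero => simp
    | succ b ih =>
      rw [pow_succ', Module.End.mul_apply, ih, normalAction, FreeAlgebra.lift_ι_apply]
      simp
  have h₂ (a b : ℕ) : (normalAction k (FreeAlgebra.ι k 2) ^ a) (Finsupp.single (0, b) 1) =
      Finsupp.single (a, b) 1 := by
    induction a with
    | zero => simp
    | succ a ih =>
      rw [pow_succ', Module.End.mul_apply, ih, normalAction, FreeAlgebra.lift_ι_apply]
      simp
  have h : normalCoord k ∘ₗ normalForm k = LinearMap.id := by
    refine Finsupp.lhom_ext' fun p => LinearMap.ext_ring ?_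
    simp only [LinearMap.comp_apply, Finsupp.lsingle_apply, LinearMap.id_apply]
    rw [normalForm_single, normalCoord, LinearMap.flip_apply, AlgHom.toLinearMap_apply, map_mul,
      map_pow, map_pow, Module.End.mul_apply, h₁, h₂]
  exact LinearMap.congr_fun h v

theorem normalCoord_d (a : exampleAlgebra k) : normalCoord k ((exampleAlgebra k).d a) = 0 := by
  have h : normalAction k (freeDiff k (exampleDiff k) a) = 0 := by
    refine algHom_freeDiff_eq_zero (R := Module.End k (ℕ × ℕ →₀ k)) (exampleDiff k)
      (normalAction k) (fun x => ?_) a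
    match x with
    | 0 =>
      rw [exampleDiff_zero, map_mul]
      refine Finsupp.lhom_ext' fun p => LinearMap.ext_ring ?_
      simp [normalAction]
    | 1 => exact map_zero _
    | 2 => exact map_zero _
  exact LinearMap.congr_fun h _

/-- The sum of the span of the normal forms `x₃ᵃ x₂ᵇ` and the space of coboundaries. -/
def normalSpace : Submodule k (exampleAlgebra k) :=
  LinearMap.range (normalForm k) ⊔ LinearMap.range (exampleAlgebra k).d

theorem normalForm_mul_x₂ (v : ℕ × ℕ →₀ k) : normalForm k v * FreeAlgebra.ι k 1 =
    normalForm k (Finsupp.lmapDomain k k (fun p => (p.1, p.2 + 1)) v) := by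
  refine LinearMap.congr_fun
    (f := LinearMap.mulRight k (FreeAlgebra.ι k 1 : exampleAlgebra k) ∘ₗ normalForm k)
    (g := normalForm k ∘ₗ Finsupp.lmapDomain k k fun p => (p.1, p.2 + 1)) ?_ v
  refine Finsupp.lhom_ext' fun p => LinearMap.ext_ring ?_
  simp only [LinearMap.comp_apply, Finsupp.lsingle_apply, Finsupp.lmapDomain_apply,
    Finsupp.mapDomain_single, LinearMap.mulRight_apply]
  refine (congrArg (· * _) (normalForm_single k p)).trans
    (Eq.trans ?_ (normalForm_single k (p.1, p.2 + 1)).symm)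
  simp only [pow_succ, mul_assoc]

theorem d_mul_ι {x : Fin 3} (hx : exampleDiff k x = 0) (w : exampleAlgebra k) :
    (exampleAlgebra k).d (w * FreeAlgebra.ι k x) =
      (exampleAlgebra k).d w * FreeAlgebra.ι k x := by
  have hx' : (exampleAlgebra k).d (FreeAlgebra.ι k x) = 0 := (freeDiff_ι k _ x).trans hx
  rw [(exampleAlgebra k).leibniz_signTwist, hx', mul_zero, add_zero]

theorem mul_x₂_mem_normalSpace {a : exampleAlgebra k} (ha : a ∈ normalSpace k) :
    a * FreeAlgebra.ι k 1 ∈ normalSpace k := by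
  obtain ⟨_, ⟨v, rfl⟩, _, ⟨w, rfl⟩, rfl⟩ := Submodule.mem_sup.1 ha
  rw [add_mul, normalForm_mul_x₂, ← d_mul_ι k (exampleDiff_one k)]
  exact Submodule.add_mem_sup ⟨_, rfl⟩ ⟨_, rfl⟩

/-- The product `x₃ᵃx₂ᵇ⁺¹x₃` is, up to sign, the differential of `x₃ᵃx₂ᵇx₁`. -/
theorem mul_x₃_mem_normalSpace {a : exampleAlgebra k} (ha : a ∈ normalSpace k) :
    a * FreeAlgebra.ι k 2 ∈ normalSpace k := by
  obtain ⟨_, ⟨v, rfl⟩, _, ⟨w, rfl⟩, rfl⟩ := Submodule.mem_sup.1 ha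
  rw [add_mul, ← d_mul_ι k (exampleDiff_two k)]
  refine Submodule.add_mem _ ?_ (Submodule.mem_sup_right ⟨_, rfl⟩)
  have h : (normalSpace k).mkQ ∘ₗ LinearMap.mulRight k (FreeAlgebra.ι k (2 : Fin 3)) ∘ₗ
      normalForm k = 0 := by
    refine Finsupp.lhom_ext' fun p => LinearMap.ext_ring ?_
    simp only [LinearMap.comp_apply, Finsupp.lsingle_apply, LinearMap.mulRight_apply,
      LinearMap.zero_apply]
    rw [normalForm_single, Submodule.mkQ_apply, Submodule.Quotient.mk_eq_zero]
    obtain ⟨a, b⟩ := p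
    cases b with
    | zero =>
      refine Submodule.mem_sup_left ⟨Finsupp.single (a + 1, 0) 1, ?_⟩
      rw [normalForm_single]
      simp [pow_succ]
    | succ b =>
      -- `x₃ᵃ x₂ᵇ x₂x₃` is, up to the sign, the differential of `x₃ᵃ x₂ᵇ x₁`.
      set c : exampleAlgebra k := FreeAlgebra.ι k (2 : Fin 3) ^ a * FreeAlgebra.ι k 1 ^ b with hc
      have hx₂ : (FreeAlgebra.ι k 1 : exampleAlgebra k) ∈ (exampleAlgebra k).cocycles :=
        exampleAlgebra_d_x₂ k
      have hx₃ : (FreeAlgebra.ι k 2 : exampleAlgebra k) ∈ (exampleAlgebra k).cocycles :=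
        exampleAlgebra_d_x₃ k
      have hdc : (exampleAlgebra k).d (signTwist (exampleAlgebra k).grading 1 c) = 0 := by
        have h : (exampleAlgebra k).d c = 0 := mul_mem (pow_mem hx₃ a) (pow_mem hx₂ b)
        rw [(exampleAlgebra k).d_signTwist, h, map_zero, neg_zero]
      refine Submodule.mem_sup_right
        ⟨signTwist (exampleAlgebra k).grading 1 c * FreeAlgebra.ι k 0, ?_⟩
      rw [(exampleAlgebra k).leibniz_signTwist, hdc, zero_mul, zero_add,
        (exampleAlgebra k).signTwist_signTwist, exampleAlgebra_d_x₁, hc]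
      simp only [pow_succ, mul_assoc]
  have h' := LinearMap.congr_fun h v
  simpa using h'

theorem resContraction_mem {n : ℤ} {a : exampleAlgebra k}
    (ha : a ∈ (exampleAlgebra k).grading (n + 1)) :
    resContraction k a ∈ (trivialRes k).grading n := by
  induction ha using Submodule.span_induction with
  | zero => rw [map_zero]; exact Submodule.zero_mem _
  | add x y _ _ hx hy => rw [map_add]; exact Submodule.add_mem _ hx hy
  | smul r x _ hx => rw [map_smul]; exact Submodule.smul_mem _ _ hx
  | mem x hx =>
  obtain ⟨l, hl, rfl⟩ := hx
  induction l generalizing n with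
  | nil =>
    rw [List.map_nil, List.prod_nil, resContraction_one]
    exact Submodule.zero_mem _
  | cons x l ih =>
    rw [List.map_cons, List.prod_cons, resContraction_ι_mul]
    rw [List.length_cons, Nat.cast_succ] at hl
    refine Submodule.sub_mem _ ?_ ?_
    · rcases eq_or_ne n 0 with rfl | hn
      · exact Submodule.smul_mem _ _
          (single_mem_piGrading _ (SetLike.one_mem_graded (exampleAlgebra k).grading))
      · rw [(exampleAlgebra k).aug_of_mem (n := l.length) (by omega) (word_mem k l), zero_smul]
        exact Submodule.zero_mem _
    · have h := (trivialRes k).smul_mem (ι_mem k x) (ih (n := n - 1) (by omega))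
      rwa [add_sub_cancel] at h

/-- Each homogeneous cocycle is cohomologous to a combination of the normal forms `x₃ᵃ x₂ᵇ`: the
exactness of the resolution of the trivial module expresses it by cocycles of smaller degree. -/
theorem mem_normalSpace_of_mem_grading (n : ℕ) {z : exampleAlgebra k}
    (hz : z ∈ (exampleAlgebra k).grading n) (hdz : (exampleAlgebra k).d z = 0) :
    z ∈ normalSpace k := by
  induction n generalizing z with
  | zero =>
    obtain ⟨c, rfl⟩ := DGAlgebra.IsConnected.grading_zero z hz
    refine Submodule.mem_sup_left ⟨Finsupp.single (0, 0) c, ?_⟩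
    rw [normalForm, Finsupp.linearCombination_single]
    simp [Algebra.algebraMap_eq_smul_one]
  | succ n ih =>
    set f := resContraction k z with hf
    have hfn : f ∈ (trivialRes k).grading n := resContraction_mem k (by exact_mod_cast hz)
    have hD : (trivialRes k).d f = z • resBasis k none := by
      have h := d_resContraction k z
      rw [hdz, map_zero, add_zero,
        (exampleAlgebra k).aug_of_mem (n := ((n + 1 : ℕ) : ℤ)) (by omega) hz, zero_smul,
        sub_zero] at h
      exact h
    have hs (i) : signTwist (exampleAlgebra k).grading 1 (f i) = (-1 : k) ^ (n : ℤ) • f i := by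
      rw [signTwist_of_mem (exampleAlgebra k).grading (hfn i), one_mul]
    have hc (j) := (trivialRes_d_apply k f j).symm.trans (congrFun hD j)
    simp only [Fintype.sum_option, Fin.sum_univ_three, hs] at hc
    have h₀ : (exampleAlgebra k).d (f (some 0)) = 0 := by
      simpa [resMatrix, resBasis] using hc (some 0)
    have h₁ : (exampleAlgebra k).d (f (some 1)) = 0 := by
      simpa [resMatrix, resBasis] using hc (some 1)
    have h₂ : (exampleAlgebra k).d (f (some 2)) +
        (-1 : k) ^ (n : ℤ) • (f (some 0) * FreeAlgebra.ι k 1) = 0 := by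
      simpa [resMatrix, resBasis] using hc (some 2)
    have h₃ : (exampleAlgebra k).d (f none) + (-1 : k) ^ (n : ℤ) •
        (f (some 0) * FreeAlgebra.ι k 0 + f (some 1) * FreeAlgebra.ι k 1 +
          f (some 2) * FreeAlgebra.ι k 2) = z := by
      simpa [resMatrix, resBasis] using hc none
    -- The coefficient of `x₁` is a coboundary, since its product with `x₂` is one.
    obtain ⟨w, hw, hdw⟩ : ∃ w ∈ (exampleAlgebra k).grading (n - 1),
        (exampleAlgebra k).d w = f (some 0) := by
      obtain ⟨_, ⟨v, rfl⟩, _, ⟨w, rfl⟩, e⟩ := Submodule.mem_sup.1 (ih (hfn (some 0)) h₀)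
      have hv : normalCoord k (f (some 0) * FreeAlgebra.ι k 1) = 0 := by
        have h := congrArg (normalCoord k) h₂
        rw [map_add, normalCoord_d, zero_add, map_smul, map_zero] at h
        exact (smul_eq_zero.1 h).resolve_left (zpow_ne_zero _ (by simp))
      rw [← e, add_mul, normalForm_mul_x₂, ← d_mul_ι k (exampleDiff_one k), map_add,
        normalCoord_d, add_zero, normalCoord_normalForm, Finsupp.lmapDomain_apply] at hv
      have hinj : Function.Injective fun p : ℕ × ℕ => (p.1, p.2 + 1) := by
        rintro ⟨a, b⟩ ⟨a', b'⟩ h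
        simpa using h
      have hv₀ : v = 0 := Finsupp.mapDomain_injective hinj (hv.trans Finsupp.mapDomain_zero.symm)
      rw [hv₀, map_zero, zero_add] at e
      refine DGModule.exists_homogeneous_primitive (M := (exampleAlgebra k).regular)
        (m := n - 1) (x := w) ?_ e
      rw [sub_add_cancel]
      exact hfn (some 0)
    have hsw : signTwist (exampleAlgebra k).grading 1 w = -(-1 : k) ^ (n : ℤ) • w := by
      rw [signTwist_of_mem (exampleAlgebra k).grading hw, one_mul, sub_eq_add_neg, sign_add]
      simp
    have h₄ : f (some 2) + (-1 : k) ^ (n : ℤ) • (w * FreeAlgebra.ι k 1) ∈ normalSpace k := by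
      refine ih (Submodule.add_mem _ (hfn (some 2)) (Submodule.smul_mem _ _ ?_)) ?_
      · have h := SetLike.mul_mem_graded hw (ι_mem k (1 : Fin 3))
        rwa [sub_add_cancel] at h
      · rw [map_add, map_smul, d_mul_ι k (exampleDiff_one k), hdw, h₂]
    have h₅ : f (some 0) * FreeAlgebra.ι k 0 = (exampleAlgebra k).d (w * FreeAlgebra.ι k 0) +
        (-1 : k) ^ (n : ℤ) • (w * FreeAlgebra.ι k 1 * FreeAlgebra.ι k 2) := by
      rw [(exampleAlgebra k).leibniz_signTwist, hdw, exampleAlgebra_d_x₁, hsw]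
      simp [mul_assoc]
    rw [← h₃, h₅]
    refine Submodule.add_mem _ (Submodule.mem_sup_right ⟨_, rfl⟩) (Submodule.smul_mem _ _ ?_)
    have h₆ := Submodule.add_mem _ (Submodule.add_mem _
      (Submodule.mem_sup_right (LinearMap.mem_range_self (exampleAlgebra k).d
        (w * FreeAlgebra.ι k 0)))
      (mul_x₂_mem_normalSpace k (ih (hfn (some 1)) h₁))) (mul_x₃_mem_normalSpace k h₄)
    rw [add_mul, smul_mul_assoc] at h₆
    have e (a b c e : FreeAlgebra k (Fin 3)) : a + b + c + e = a + c + (e + b) := by abel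
    exact (congrArg (· ∈ normalSpace k) (e _ _ _ _)).mpr h₆

theorem mem_normalSpace {z : exampleAlgebra k} (hdz : (exampleAlgebra k).d z = 0) :
    z ∈ normalSpace k := by
  classical
  rw [← DirectSum.sum_support_decompose (exampleAlgebra k).grading z]
  refine Submodule.sum_mem _ fun n _ => ?_
  rcases lt_or_ge n 0 with hn | hn
  · have h := (DirectSum.decompose (exampleAlgebra k).grading z n).2
    rw [(Submodule.mem_bot k).1 ((DGAlgebra.IsConnected.grading_neg n hn).le h)]
    exact Submodule.zero_mem _
  · lift n to ℕ using hn
    refine mem_normalSpace_of_mem_grading k n (Subtype.mem _) ?_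
    have h := (exampleAlgebra k).regular.d_proj n z
    exact h.trans ((congrArg _ hdz).trans (map_zero _))

/-- The homomorphism from the free algebra on `y₁, y₂` to the cocycles with `y₁ ↦ x₂`
and `y₂ ↦ x₃`. -/
def cocycleHom : FreeAlgebra k (Fin 2) →ₐ[k] (exampleAlgebra k).cocycles :=
  FreeAlgebra.lift k ![⟨FreeAlgebra.ι k 1, exampleAlgebra_d_x₂ k⟩,
    ⟨FreeAlgebra.ι k 2, exampleAlgebra_d_x₃ k⟩]

theorem cocycleHom_zero : cocycleHom k (FreeAlgebra.ι k 0) =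
    ⟨FreeAlgebra.ι k 1, exampleAlgebra_d_x₂ k⟩ := by
  rw [cocycleHom, FreeAlgebra.lift_ι_apply]
  rfl

theorem cocycleHom_one : cocycleHom k (FreeAlgebra.ι k 1) =
    ⟨FreeAlgebra.ι k 2, exampleAlgebra_d_x₃ k⟩ := by
  rw [cocycleHom, FreeAlgebra.lift_ι_apply]
  rfl

/-- The homomorphism from `k⟨y₁, y₂⟩ / (y₁y₂)` to the cohomology algebra with `y₁ ↦ ⌈x₂⌉` and
`y₂ ↦ ⌈x₃⌉`. -/
def presentationHom : RingQuot (ExampleRel k) →ₐ[k] (exampleAlgebra k).Cohomology :=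
  RingQuot.liftAlgHom k ⟨(toCohomology _).comp (cocycleHom k), by
    rintro a b ⟨rfl, rfl⟩
    rw [map_zero, AlgHom.comp_apply, map_mul, cocycleHom_zero, cocycleHom_one]
    exact toCohomology_eq_zero_iff.2 ⟨FreeAlgebra.ι k 0, exampleAlgebra_d_x₁ k⟩⟩

theorem presentationHom_mk (a : FreeAlgebra k (Fin 2)) :
    presentationHom k (RingQuot.mkAlgHom k (ExampleRel k) a) =
      toCohomology _ (cocycleHom k a) :=
  RingQuot.liftAlgHom_mkAlgHom_apply _ _ _ _

theorem presentationHom_surjective : Function.Surjective (presentationHom k) := by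
  intro y
  obtain ⟨⟨z, hz⟩, rfl⟩ := toCohomology_surjective (exampleAlgebra k) y
  obtain ⟨_, ⟨v, rfl⟩, _, ⟨w, rfl⟩, e⟩ := Submodule.mem_sup.1 (mem_normalSpace k hz)
  have hv : normalForm k v ∈
      LinearMap.range ((exampleAlgebra k).cocycles.val.comp (cocycleHom k)).toLinearMap := by
    rw [normalForm, Finsupp.linearCombination_apply]
    refine Submodule.sum_mem _ fun p _ => Submodule.smul_mem _ _
      ⟨FreeAlgebra.ι k 1 ^ p.1 * FreeAlgebra.ι k 0 ^ p.2, ?_⟩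
    rw [AlgHom.toLinearMap_apply, AlgHom.comp_apply, map_mul, map_pow, map_pow, cocycleHom_zero,
      cocycleHom_one]
    rfl
  obtain ⟨a, ha⟩ := hv
  refine ⟨RingQuot.mkAlgHom k (ExampleRel k) a, ?_⟩
  rw [presentationHom_mk]
  rw [← sub_eq_zero, ← map_sub]
  refine toCohomology_eq_zero_iff.2 ⟨-w, ?_⟩
  have ha' : ((cocycleHom k a : (exampleAlgebra k).cocycles) : exampleAlgebra k) =
      normalForm k v := ha
  subst e
  rw [map_neg, AddSubgroupClass.coe_sub, ha', sub_add_cancel_left]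

/-- The homomorphism to `k⟨y₁, y₂⟩ / (y₁y₂)` with `x₁ ↦ 0`, `x₂ ↦ y₁` and `x₃ ↦ y₂`. -/
def toPresentation : FreeAlgebra k (Fin 3) →ₐ[k] RingQuot (ExampleRel k) :=
  FreeAlgebra.lift k ![0, RingQuot.mkAlgHom k (ExampleRel k) (FreeAlgebra.ι k 0),
    RingQuot.mkAlgHom k (ExampleRel k) (FreeAlgebra.ι k 1)]

theorem toPresentation_d (a : exampleAlgebra k) :
    toPresentation k ((exampleAlgebra k).d a) = 0 := by
  refine algHom_freeDiff_eq_zero (exampleDiff k) (toPresentation k) (fun x => ?_) a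
  match x with
  | 0 =>
    have h : RingQuot.mkAlgHom k (ExampleRel k) (FreeAlgebra.ι k 0 * FreeAlgebra.ι k 1) =
        RingQuot.mkAlgHom k (ExampleRel k) 0 := RingQuot.mkAlgHom_rel k ⟨rfl, rfl⟩
    rw [map_mul, map_zero] at h
    rw [exampleDiff_zero, map_mul, toPresentation, FreeAlgebra.lift_ι_apply,
      FreeAlgebra.lift_ι_apply]
    exact h
  | 1 => exact map_zero _
  | 2 => exact map_zero _

/-- The projection of the algebra to `k⟨y₁, y₂⟩ / (y₁y₂)` induces a left inverse. -/
theorem presentationHom_injective : Function.Injective (presentationHom k) := by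
  let ψ : (exampleAlgebra k).Cohomology →ₐ[k] RingQuot (ExampleRel k) :=
    cohomologyLift ((toPresentation k).comp (exampleAlgebra k).cocycles.val) (by
      rintro z ⟨x, hx⟩
      exact (congrArg (toPresentation k) hx.symm).trans (toPresentation_d k x))
  have h : ψ.comp (presentationHom k) = AlgHom.id k _ := by
    refine RingQuot.ringQuot_ext' k _ _ (FreeAlgebra.hom_ext (funext fun i => ?_))
    have e : ψ (presentationHom k (RingQuot.mkAlgHom k (ExampleRel k) (FreeAlgebra.ι k i))) =
        toPresentation k (cocycleHom k (FreeAlgebra.ι k i)).1 := by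
      rw [presentationHom_mk]
      rfl
    refine e.trans ?_
    match i with
    | 0 =>
      rw [cocycleHom_zero, toPresentation, FreeAlgebra.lift_ι_apply]
      rfl
    | 1 =>
      rw [cocycleHom_one, toPresentation, FreeAlgebra.lift_ι_apply]
      rfl
  exact Function.LeftInverse.injective (g := ψ) fun x => AlgHom.congr_fun h x

theorem exists_presentation_equiv :
    ∃ e : RingQuot (ExampleRel k) ≃ₐ[k] (exampleAlgebra k).Cohomology,
      e (RingQuot.mkAlgHom k (ExampleRel k) (FreeAlgebra.ι k 0)) =
        (exampleAlgebra k).cohomologyClass (FreeAlgebra.ι k 1) (exampleAlgebra_d_x₂ k) ∧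
      e (RingQuot.mkAlgHom k (ExampleRel k) (FreeAlgebra.ι k 1)) =
        (exampleAlgebra k).cohomologyClass (FreeAlgebra.ι k 2) (exampleAlgebra_d_x₃ k) := by
  refine ⟨AlgEquiv.ofBijective (presentationHom k)
    ⟨presentationHom_injective k, presentationHom_surjective k⟩, ?_, ?_⟩
  · refine (presentationHom_mk k _).trans ?_
    rw [cocycleHom_zero]
    rfl
  · refine (presentationHom_mk k _).trans ?_
    rw [cocycleHom_one]
    rfl

end Cohomology

/-! ### The enveloping algebra -/

section Enveloping

variable {k : Type u} [Field k] {A : DGAlgebra k}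

/-- The pure tensor `a ⊗ b` in the enveloping algebra, for elements `a` and `b` of `A`. -/
def envT (a b : A) : A.env := DGAlgebra.tmul (B := A.op) a (A.toOp b)

/-- The tensors `a ⊗ b` as a bilinear map. -/
def envTBilin (A : DGAlgebra k) : A →ₗ[k] A →ₗ[k] A.env :=
  ((TensorProduct.mk k A A.op).compl₂ A.toOp.toLinearMap).compr₂
    (A.tensorEquiv A.op).toLinearMap

theorem envT_mem {i j n : ℤ} (h : i + j = n) {a b : A} (ha : a ∈ A.grading i)
    (hb : b ∈ A.grading j) : envT a b ∈ A.env.grading n := by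
  subst h
  exact DGAlgebra.tmul_mem (B := A.op) ha hb

theorem env_hom_ext {V : Type*} [AddCommGroup V] [Module k V] {f g : A.env →ₗ[k] V}
    (h : ∀ a b, f (envT a b) = g (envT a b)) : f = g :=
  DGAlgebra.tensor_induction fun _ a _ _ b _ => h a (A.toOp.symm b)

theorem bilin_ext_homogeneous {V : Type*} [AddCommGroup V] [Module k V]
    {f g : A →ₗ[k] A →ₗ[k] V}
    (h : ∀ i, ∀ a ∈ A.grading i, ∀ j, ∀ b ∈ A.grading j, f a b = g a b) (a b : A) :
    f a b = g a b :=
  DGAlgebra.hom_induction A.grading (f := f.flip b) (g := g.flip b) (fun i a ha =>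
    DGAlgebra.hom_induction A.grading (fun j b hb => h i a ha j b hb) b) a

theorem envT_mul_envT {i j : ℤ} (a : A) {b a' : A} (b' : A) (hb : b ∈ A.grading j)
    (ha' : a' ∈ A.grading i) :
    envT a b * envT a' b' = (-1 : k) ^ (j * i) • envT (a * a') (A.opMul b b') :=
  DGAlgebra.tmul_mul_tmul (B := A.op) a (A.toOp b') hb ha'

theorem envT_left_mul (u a b : A) : envT u 1 * envT a b = envT (u * a) b := by
  refine bilin_ext_homogeneous (f := (envTBilin A).compr₂ (LinearMap.mulLeft k (envT u 1)))
    (g := envTBilin A ∘ₗ LinearMap.mulLeft k u) (fun i a ha j b hb => ?_) a b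
  have h := envT_mul_envT u b (SetLike.one_mem_graded A.grading) ha
  rw [zero_mul, zpow_zero, one_smul, A.one_opMul] at h
  exact h

theorem signTwist_envT {i j : ℤ} {a b : A} (n : ℤ) (ha : a ∈ A.grading i) (hb : b ∈ A.grading j) :
    signTwist A.env.grading n (envT a b) = (-1 : k) ^ (n * (i + j)) • envT a b :=
  signTwist_of_mem A.env.grading (envT_mem rfl ha hb)

theorem envT_smul_left (r : k) (a b : A) : envT (r • a) b = r • envT a b :=
  LinearMap.congr_fun ((envTBilin A).map_smul r a) b

theorem envT_smul_right (r : k) (a b : A) : envT a (r • b) = r • envT a b :=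
  (envTBilin A a).map_smul r b

/-- Right multiplication by `x ⊗ 1`, for an element `x` of degree `1`. -/
theorem signTwist_envT_mul_left {x : A} (hx : x ∈ A.grading 1) (a b : A) :
    signTwist A.env.grading 1 (envT a b) * envT x 1 =
      envT (signTwist A.grading 1 a * x) b := by
  refine bilin_ext_homogeneous
    (f := (envTBilin A).compr₂
      (LinearMap.mulRight k (envT x 1) ∘ₗ signTwist A.env.grading 1))
    (g := envTBilin A ∘ₗ LinearMap.mulRight k x ∘ₗ signTwist A.grading 1)
    (fun i a ha j b hb => ?_) a b
  change signTwist A.env.grading 1 (envT a b) * envT x 1 =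
      envT (signTwist A.grading 1 a * x) b
  rw [signTwist_envT 1 ha hb, signTwist_of_mem A.grading ha, smul_mul_assoc, smul_mul_assoc,
    envT_mul_envT a 1 hb hx, A.opMul_one, envT_smul_left, smul_smul, one_mul, one_mul, mul_one,
    sign_add, mul_assoc, sign_sq, mul_one]

/-- Right multiplication by `1 ⊗ x`, for an element `x` of degree `1`. -/
theorem signTwist_envT_mul_right {x : A} (hx : x ∈ A.grading 1) (a b : A) :
    signTwist A.env.grading 1 (envT a b) * envT 1 x =
      envT (signTwist A.grading 1 a) (x * b) := by
  refine bilin_ext_homogeneous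
    (f := (envTBilin A).compr₂
      (LinearMap.mulRight k (envT 1 x) ∘ₗ signTwist A.env.grading 1))
    (g := (envTBilin A).compl₁₂ (signTwist A.grading 1) (LinearMap.mulLeft k x))
    (fun i a ha j b hb => ?_) a b
  change signTwist A.env.grading 1 (envT a b) * envT 1 x =
      envT (signTwist A.grading 1 a) (x * b)
  rw [signTwist_envT 1 ha hb, signTwist_of_mem A.grading ha, smul_mul_assoc,
    envT_mul_envT a x hb (SetLike.one_mem_graded A.grading), A.opMul_of_mem hb hx,
    envT_smul_left, envT_smul_right, smul_smul, smul_smul, one_mul, one_mul, mul_one, mul_zero,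
    zpow_zero, mul_one, mul_one, sign_add, mul_assoc, sign_sq, mul_one]

theorem env_d_envT (a b : A) :
    A.env.d (envT a b) = envT (A.d a) b + envT (signTwist A.grading 1 a) (A.d b) := by
  refine bilin_ext_homogeneous (f := (envTBilin A).compr₂ A.env.d)
    (g := envTBilin A ∘ₗ A.d + (envTBilin A).compl₁₂ (signTwist A.grading 1) A.d)
    (fun i a ha j b hb => ?_) a b
  change A.env.d (envT a b) = envT (A.d a) b + envT (signTwist A.grading 1 a) (A.d b)
  rw [signTwist_of_mem A.grading ha, one_mul, envT_smul_left]
  exact A.tensorD_tmul A.op (A.toOp b) ha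

theorem signTwist_one (n : ℤ) : signTwist A.grading n 1 = 1 := by
  rw [signTwist_of_mem A.grading (SetLike.one_mem_graded A.grading), mul_zero, zpow_zero, one_smul]

theorem envT_right_mul_left {x y : A} (hx : x ∈ A.grading 1) (hy : y ∈ A.grading 1) :
    envT 1 x * envT y 1 = -envT y x := by
  have h := signTwist_envT_mul_left hy 1 x
  rw [signTwist_envT 1 (SetLike.one_mem_graded A.grading) hx, signTwist_one, one_mul] at h
  simpa [neg_eq_iff_eq_neg] using h

theorem envT_right_mul_right {x y : A} (hx : x ∈ A.grading 1) (hy : y ∈ A.grading 1) :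
    envT 1 x * envT 1 y = -envT 1 (y * x) := by
  have h := signTwist_envT_mul_right hy 1 x
  rw [signTwist_envT 1 (SetLike.one_mem_graded A.grading) hx, signTwist_one] at h
  simpa [neg_eq_iff_eq_neg] using h

theorem envAct_envT_one (a b : A) : A.envAct (envT a b) 1 = a * b := by
  rw [envT, DGAlgebra.envAct_tmul, A.opMul_one]

end Enveloping

/-! ### The resolution of the diagonal bimodule -/

section DiagonalResolution

variable (k : Type u) [Field k]

/-- The matrix of the differential `∂e₀ = 0`, `∂e₁ = x₁e₀ - e₀x₁ - e₂x₃ + x₂e₃`,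
`∂e₂ = x₂e₀ - e₀x₂`, `∂e₃ = x₃e₀ - e₀x₃`, in bimodule notation. The index `none` belongs to `e₀`,
and the generators `x₁, x₂, x₃` have the indices `0, 1, 2`. -/
def diagMatrix : Option (Fin 3) → Option (Fin 3) → (exampleAlgebra k).env
  | none, _ => 0
  | some i, none => envT (A := exampleAlgebra k) (FreeAlgebra.ι k i) 1 -
      envT (A := exampleAlgebra k) 1 (FreeAlgebra.ι k i)
  | some i, some j =>
      if i = 0 ∧ j = 1 then -envT (A := exampleAlgebra k) 1 (FreeAlgebra.ι k 2)
      else if i = 0 ∧ j = 2 then envT (A := exampleAlgebra k) (FreeAlgebra.ι k 1) 1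
      else 0

theorem diagMatrix_mem (i j : Option (Fin 3)) :
    diagMatrix k i j ∈ (exampleAlgebra k).env.grading 1 := by
  have h₁ (x : Fin 3) : envT (A := exampleAlgebra k) (FreeAlgebra.ι k x) 1 ∈
      (exampleAlgebra k).env.grading 1 :=
    envT_mem (add_zero 1) (ι_mem k x) (SetLike.one_mem_graded (exampleAlgebra k).grading)
  have h₂ (x : Fin 3) : envT (A := exampleAlgebra k) 1 (FreeAlgebra.ι k x) ∈
      (exampleAlgebra k).env.grading 1 :=
    envT_mem (zero_add 1) (SetLike.one_mem_graded (exampleAlgebra k).grading) (ι_mem k x)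
  match i, j with
  | none, _ => exact Submodule.zero_mem _
  | some i, none => exact Submodule.sub_mem _ (h₁ i) (h₂ i)
  | some i, some j =>
    rw [diagMatrix]
    split_ifs
    · exact Submodule.neg_mem _ (h₂ 2)
    · exact h₁ 1
    · exact Submodule.zero_mem _

theorem env_d_ι_left (x : Fin 3) :
    (exampleAlgebra k).env.d (envT (A := exampleAlgebra k) (FreeAlgebra.ι k x) 1) =
      envT (A := exampleAlgebra k) (exampleDiff k x) 1 := by
  rw [env_d_envT, (exampleAlgebra k).d_one, show (exampleAlgebra k).d (FreeAlgebra.ι k x) =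
    exampleDiff k x from freeDiff_ι k _ x]
  exact (congrArg (_ + ·) ((envTBilin (exampleAlgebra k) _).map_zero)).trans (add_zero _)

theorem env_d_ι_right (x : Fin 3) :
    (exampleAlgebra k).env.d (envT (A := exampleAlgebra k) 1 (FreeAlgebra.ι k x)) =
      envT (A := exampleAlgebra k) 1 (exampleDiff k x) := by
  rw [env_d_envT, (exampleAlgebra k).d_one, signTwist_one,
    show (exampleAlgebra k).d (FreeAlgebra.ι k x) = exampleDiff k x from freeDiff_ι k _ x]
  exact (congrArg (· + _) ((envTBilin (exampleAlgebra k)).map_zero₂ _)).trans (zero_add _)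

theorem envT_zero_left (b : exampleAlgebra k) : envT (0 : exampleAlgebra k) b = 0 :=
  (envTBilin (exampleAlgebra k)).map_zero₂ b

theorem envT_zero_right (a : exampleAlgebra k) : envT a (0 : exampleAlgebra k) = 0 :=
  (envTBilin (exampleAlgebra k) a).map_zero

theorem d_diagMatrix (i j : Option (Fin 3)) :
    (exampleAlgebra k).env.d (diagMatrix k i j) = ∑ l, diagMatrix k i l * diagMatrix k l j := by
  rw [Fintype.sum_option, Fin.sum_univ_three]
  match i, j with
  | none, _ => simp [diagMatrix]
  | some i, none =>
    have hd : (exampleAlgebra k).env.d (diagMatrix k (some i) none) =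
        envT (A := exampleAlgebra k) (exampleDiff k i) 1 -
          envT (A := exampleAlgebra k) 1 (exampleDiff k i) := by
      rw [← env_d_ι_left, ← env_d_ι_right, ← map_sub]
      rfl
    rw [hd]
    obtain rfl | rfl | rfl : i = 0 ∨ i = 1 ∨ i = 2 := by fin_cases i <;> simp
    · have h₁ := envT_right_mul_left (A := exampleAlgebra k) (ι_mem k (2 : Fin 3))
        (ι_mem k (1 : Fin 3))
      have h₂ := envT_right_mul_right (A := exampleAlgebra k) (ι_mem k (2 : Fin 3))
        (ι_mem k (1 : Fin 3))
      have h₃ := envT_left_mul (A := exampleAlgebra k) (FreeAlgebra.ι k 1) (FreeAlgebra.ι k 2) 1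
      have h₄ := envT_left_mul (A := exampleAlgebra k) (FreeAlgebra.ι k 1) 1 (FreeAlgebra.ι k 2)
      rw [mul_one] at h₄
      simp [diagMatrix, mul_sub, h₁, h₂, h₃, h₄, exampleDiff_zero]
    · rw [exampleDiff_one, envT_zero_left, envT_zero_right]
      simp [diagMatrix]
    · rw [exampleDiff_two, envT_zero_left, envT_zero_right]
      simp [diagMatrix]
  | some i, some j =>
    have hd : (exampleAlgebra k).env.d (diagMatrix k (some i) (some j)) = 0 := by
      rw [diagMatrix]
      split_ifs
      · rw [map_neg, env_d_ι_right, exampleDiff_two, envT_zero_right, neg_zero]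
      · rw [env_d_ι_left, exampleDiff_one, envT_zero_left]
      · exact map_zero _
    rw [hd]
    fin_cases i <;> fin_cases j <;> simp [diagMatrix]

/-- The semi-free module on `e₀, e₁, e₂, e₃` that resolves the diagonal bimodule. -/
abbrev diagRes : DGModule (exampleAlgebra k).env :=
  twistedFree (diagMatrix k) (diagMatrix_mem k) (d_diagMatrix k)

theorem resLayer_lt_of_diagMatrix (i j : Option (Fin 3)) (h : diagMatrix k i j ≠ 0) :
    resLayer j < resLayer i := by
  match i, j with
  | none, _ => exact absurd rfl h
  | some i, none =>
    simp only [resLayer]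
    split_ifs <;> omega
  | some i, some j =>
    rw [diagMatrix] at h
    split_ifs at h with h₁ h₂
    · simp [resLayer, h₁.1, h₁.2]
    · simp [resLayer, h₂.1, h₂.2]
    · exact absurd rfl h

/-- The basis element `eᵢ` of the resolution of the diagonal bimodule. -/
abbrev diagBasis (i : Option (Fin 3)) : diagRes k :=
  (Pi.single i (1 : (exampleAlgebra k).env) : Option (Fin 3) → (exampleAlgebra k).env)

theorem diagRes_d_diagBasis (i : Option (Fin 3)) :
    (diagRes k).d (diagBasis k i) = ∑ j, diagMatrix k i j • diagBasis k j :=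
  twistedD_single_one (diagMatrix k) i

theorem diagRes_eq_sum (f : diagRes k) : f = ∑ i, f i • diagBasis k i := by
  refine (Finset.univ_sum_single f).symm.trans (Finset.sum_congr rfl fun i _ => ?_)
  rw [← Pi.single_smul, smul_eq_mul, mul_one]

theorem diagRes_d_apply (f : diagRes k) (j : Option (Fin 3)) :
    (diagRes k).d f j = (exampleAlgebra k).env.d (f j) +
      ∑ i, signTwist (exampleAlgebra k).env.grading 1 (f i) * diagMatrix k i j :=
  twistedD_apply (diagMatrix k) f j

/-- The multiplication morphism from the resolution to the diagonal bimodule with `e₀ ↦ 1` and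
`eᵢ ↦ 0`. -/
def diagResAug : DGHom (diagRes k) (exampleAlgebra k).diagonal :=
  twistedFreeLift (diagMatrix k) (diagMatrix_mem k) (d_diagMatrix k) _
    (fun i => if i = none then (1 : exampleAlgebra k) else 0)
    (fun i => by
      split_ifs
      · exact SetLike.one_mem_graded (exampleAlgebra k).grading
      · exact Submodule.zero_mem _)
    (fun i => by
      have h : (exampleAlgebra k).d (if i = none then (1 : exampleAlgebra k) else 0) = 0 := by
        split_ifs
        · exact (exampleAlgebra k).d_one
        · exact map_zero _
      refine h.trans ?_
      change (0 : exampleAlgebra k) = ∑ j, (exampleAlgebra k).envAct (diagMatrix k i j)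
        (if j = none then (1 : exampleAlgebra k) else 0)
      rw [Fintype.sum_option]
      match i with
      | none => simp [diagMatrix]
      | some i =>
        have h₁ := envAct_envT_one (A := exampleAlgebra k) (FreeAlgebra.ι k i) 1
        have h₂ := envAct_envT_one (A := exampleAlgebra k) 1 (FreeAlgebra.ι k i)
        rw [mul_one] at h₁
        rw [one_mul] at h₂
        simp [diagMatrix, h₁, h₂])

theorem diagResAug_apply (f : diagRes k) :
    (diagResAug k).toLinearMap f = (exampleAlgebra k).envAct (f none) 1 := by
  rw [diagResAug, twistedFreeLift_apply]
  change ∑ j, (exampleAlgebra k).envAct (f j) (if j = none then (1 : exampleAlgebra k) else 0) = _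
  rw [Fintype.sum_option]
  simp

/-- The bilinear map underlying the contraction of the resolution of the diagonal bimodule. -/
def diagContractionBilin : exampleAlgebra k →ₗ[k] exampleAlgebra k →ₗ[k] diagRes k :=
  skewDerivation
    (fun x => Algebra.lsmul k k (diagRes k) (envT (A := exampleAlgebra k) (FreeAlgebra.ι k x) 1))
    (fun x => LinearMap.mulLeft k (FreeAlgebra.ι k x : exampleAlgebra k))
    (fun x => (LinearMap.toSpanSingleton (exampleAlgebra k).env (diagRes k)
      (diagBasis k (some x))).restrictScalars k ∘ₗ envTBilin (exampleAlgebra k) 1)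

theorem diagContractionBilin_one (b : exampleAlgebra k) : diagContractionBilin k 1 b = 0 := by
  rw [diagContractionBilin, skewDerivation_one, LinearMap.zero_apply]

theorem diagContractionBilin_ι_mul (x : Fin 3) (a b : exampleAlgebra k) :
    diagContractionBilin k (FreeAlgebra.ι k x * a) b =
      envT 1 (a * b) • diagBasis k (some x) -
        envT (A := exampleAlgebra k) (FreeAlgebra.ι k x) 1 • diagContractionBilin k a b := by
  have h : FreeAlgebra.lift k
      (fun x => LinearMap.mulLeft k (FreeAlgebra.ι k x : FreeAlgebra k (Fin 3))) =
      Algebra.lmul k (FreeAlgebra k (Fin 3)) := by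
    refine FreeAlgebra.hom_ext (funext fun x => ?_)
    rw [Function.comp_apply, FreeAlgebra.lift_ι_apply]
    rfl
  refine (skewDerivation_ι_mul _ _ _ x a b).trans ?_
  rw [h]
  rfl

/-- The contraction of the resolution of the diagonal bimodule: it is linear over the right
multiplication by `A`, and `a e₀ b ↦ D(a) b` for the universal derivation `D` with `D(xᵢ) = eᵢ`. -/
def diagContraction : (exampleAlgebra k).env →ₗ[k] diagRes k :=
  TensorProduct.lift
      ((diagContractionBilin k).compl₂ (exampleAlgebra k).toOp.symm.toLinearMap) ∘ₗ
    ((exampleAlgebra k).tensorEquiv (exampleAlgebra k).op).symm.toLinearMap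

theorem diagRes_d_envT_smul (x : Fin 3) (f : diagRes k) :
    (diagRes k).d (envT (A := exampleAlgebra k) (FreeAlgebra.ι k x) 1 • f) =
      envT (A := exampleAlgebra k) (exampleDiff k x) 1 • f -
        envT (A := exampleAlgebra k) (FreeAlgebra.ι k x) 1 • (diagRes k).d f := by
  have hx : envT (A := exampleAlgebra k) (FreeAlgebra.ι k x) 1 ∈
      (exampleAlgebra k).env.grading 1 :=
    envT_mem (add_zero 1) (ι_mem k x) (SetLike.one_mem_graded (exampleAlgebra k).grading)
  rw [(diagRes k).leibniz f hx, env_d_ι_left, zpow_one, neg_one_smul, ← sub_eq_add_neg]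

/-- The differential of `eₓ c` without the term that contains `∂c`, in bimodule notation. -/
theorem signTwist_envT_one_smul_d (c : exampleAlgebra k) (x : Fin 3) :
    signTwist (exampleAlgebra k).env.grading 1 (envT (A := exampleAlgebra k) 1 c) •
        (diagRes k).d (diagBasis k (some x)) =
      envT (A := exampleAlgebra k) (FreeAlgebra.ι k x) c • diagBasis k none -
        envT (A := exampleAlgebra k) 1 (FreeAlgebra.ι k x * c) • diagBasis k none +
        if x = 0 then
          envT (A := exampleAlgebra k) (FreeAlgebra.ι k 1) c • diagBasis k (some 2) -
          envT (A := exampleAlgebra k) 1 (FreeAlgebra.ι k 2 * c) • diagBasis k (some 1)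
        else 0 := by
  have h₁ (y : Fin 3) : signTwist (exampleAlgebra k).env.grading 1
      (envT (A := exampleAlgebra k) 1 c) * envT (A := exampleAlgebra k) (FreeAlgebra.ι k y) 1 =
      envT (A := exampleAlgebra k) (FreeAlgebra.ι k y) c := by
    rw [signTwist_envT_mul_left (A := exampleAlgebra k) (ι_mem k y), signTwist_one, one_mul]
  have h₂ (y : Fin 3) : signTwist (exampleAlgebra k).env.grading 1
      (envT (A := exampleAlgebra k) 1 c) * envT (A := exampleAlgebra k) 1 (FreeAlgebra.ι k y) =
      envT (A := exampleAlgebra k) 1 (FreeAlgebra.ι k y * c) := by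
    rw [signTwist_envT_mul_right (A := exampleAlgebra k) (ι_mem k y), signTwist_one]
  rw [diagRes_d_diagBasis, Fintype.sum_option, Fin.sum_univ_three, smul_add, smul_add, smul_add]
  simp only [← mul_smul]
  obtain rfl | rfl | rfl : x = 0 ∨ x = 1 ∨ x = 2 := by fin_cases x <;> simp
  · simp only [diagMatrix, mul_sub, h₁, h₂, sub_smul, if_true, true_and]
    simp [h₁, h₂]
    abel
  · simp [diagMatrix, mul_sub, h₁, h₂, sub_smul]
  · simp [diagMatrix, mul_sub, h₁, h₂, sub_smul]

/-- The defect of the linearity of the contraction under the left multiplication by `∂x` is, up to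
sign, the part of `∂eₓ` outside the submodule generated by `e₀`. -/
theorem diagContractionBilin_exampleDiff_mul (x : Fin 3) (a b : exampleAlgebra k) :
    diagContractionBilin k (exampleDiff k x * a) b =
      envT (A := exampleAlgebra k) (exampleDiff k x) 1 • diagContractionBilin k a b -
        if x = 0 then
          envT (A := exampleAlgebra k) (FreeAlgebra.ι k 1) (a * b) • diagBasis k (some 2) -
          envT (A := exampleAlgebra k) 1 (FreeAlgebra.ι k 2 * (a * b)) • diagBasis k (some 1)
        else 0 := by
  obtain rfl | rfl | rfl : x = 0 ∨ x = 1 ∨ x = 2 := by fin_cases x <;> simp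
  · have h := diagContractionBilin_ι_mul k 1 (FreeAlgebra.ι k 2 * a) b
    rw [diagContractionBilin_ι_mul k 2 a b, smul_sub, ← mul_smul, ← mul_smul, envT_left_mul,
      envT_left_mul, mul_one] at h
    rw [exampleDiff_zero, mul_assoc, if_pos rfl]
    refine h.trans ?_
    rw [mul_assoc]
    abel
  · have h : diagContractionBilin k (0 * a) b = 0 := by rw [zero_mul, map_zero]; rfl
    rw [exampleDiff_one, if_neg (by simp), envT_zero_left, zero_smul, sub_zero]
    exact h
  · have h : diagContractionBilin k (0 * a) b = 0 := by rw [zero_mul, map_zero]; rfl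
    rw [exampleDiff_two, if_neg (by simp), envT_zero_left, zero_smul, sub_zero]
    exact h

/-- The contraction is a homotopy between the identity and the map `ae₀b ↦ e₀ab` on the submodule
generated by `e₀`. -/
theorem d_diagContraction (y : (exampleAlgebra k).env) :
    (diagRes k).d (diagContraction k y) + diagContraction k ((exampleAlgebra k).env.d y) =
      y • diagBasis k none -
        envT 1 ((exampleAlgebra k).envAct y 1) • diagBasis k none := by
  let A := exampleAlgebra k
  refine LinearMap.congr_fun
    (f := (diagRes k).d ∘ₗ diagContraction k + diagContraction k ∘ₗ A.env.d)
    (g := (LinearMap.toSpanSingleton A.env (diagRes k) (diagBasis k none)).restrictScalars k -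
      (LinearMap.toSpanSingleton A.env (diagRes k) (diagBasis k none)).restrictScalars k ∘ₗ
        envTBilin A 1 ∘ₗ A.envAct.toLinearMap.flip 1) (env_hom_ext fun a b => ?_) y
  have goal_eq : (diagRes k).d (diagContractionBilin k a b) +
      (diagContractionBilin k (A.d a) b +
        diagContractionBilin k (signTwist A.grading 1 a) (A.d b)) =
      envT a b • diagBasis k none - envT 1 (a * b) • diagBasis k none := by
    refine freeAlgebra_hom_ext_left
      (f := (diagRes k).d ∘ₗ (diagContractionBilin k).flip b +
        ((diagContractionBilin k).flip b ∘ₗ A.d +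
          (diagContractionBilin k).flip (A.d b) ∘ₗ signTwist A.grading 1))
      (g := (LinearMap.toSpanSingleton A.env (diagRes k) (diagBasis k none)).restrictScalars k ∘ₗ
        ((envTBilin A).flip b - envTBilin A 1 ∘ₗ LinearMap.mulRight k b)) ?_
      (fun x a ha => ?_) a |>.trans
      (sub_smul (envT a b : A.env) (envT 1 (a * b)) (diagBasis k none))
    · change (diagRes k).d (diagContractionBilin k 1 b) +
        (diagContractionBilin k (A.d 1) b +
          diagContractionBilin k (signTwist A.grading 1 1) (A.d b)) =
        (envT 1 b - envT 1 (1 * b)) • diagBasis k none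
      rw [A.d_one, signTwist_one, diagContractionBilin_one, diagContractionBilin_one, one_mul,
        sub_self, zero_smul, map_zero, map_zero]
      simp
    · have ha' : (diagRes k).d (diagContractionBilin k a b) +
          (diagContractionBilin k (A.d a) b +
            diagContractionBilin k (signTwist A.grading 1 a) (A.d b)) =
          (envT a b - envT 1 (a * b)) • diagBasis k none := ha
      change (diagRes k).d (diagContractionBilin k (FreeAlgebra.ι k x * a) b) +
          (diagContractionBilin k (A.d (FreeAlgebra.ι k x * a)) b +
            diagContractionBilin k (signTwist A.grading 1 (FreeAlgebra.ι k x * a)) (A.d b)) =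
          (envT (FreeAlgebra.ι k x * a) b - envT 1 (FreeAlgebra.ι k x * a * b)) • diagBasis k none
      have hda : A.d (FreeAlgebra.ι k x * a) =
          exampleDiff k x * a - FreeAlgebra.ι k x * A.d a := freeDiff_ι_mul k _ x a
      have hsa : signTwist A.grading 1 (FreeAlgebra.ι k x * a) =
          -(FreeAlgebra.ι k x * signTwist A.grading 1 a) := by
        rw [signTwist_mul A, signTwist_of_mem A.grading (ι_mem k x), mul_one, zpow_one,
          neg_one_smul, neg_mul]
      have hd₁ : (diagRes k).d (diagContractionBilin k (FreeAlgebra.ι k x * a) b) =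
          envT 1 (A.d a * b + signTwist A.grading 1 a * A.d b) • diagBasis k (some x) +
          signTwist A.env.grading 1 (envT (A := A) 1 (a * b)) •
            (diagRes k).d (diagBasis k (some x)) -
          (envT (A := A) (exampleDiff k x) 1 • diagContractionBilin k a b -
            envT (A := A) (FreeAlgebra.ι k x) 1 •
              (diagRes k).d (diagContractionBilin k a b)) := by
        rw [diagContractionBilin_ι_mul, map_sub, diagRes_d_envT_smul,
          (diagRes k).leibniz_signTwist, env_d_envT, A.d_one, envT_zero_left, zero_add,
          signTwist_one, A.leibniz_signTwist]
      have hd₂ : diagContractionBilin k (A.d (FreeAlgebra.ι k x * a)) b =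
          diagContractionBilin k (exampleDiff k x * a) b -
          (envT 1 (A.d a * b) • diagBasis k (some x) -
            envT (A := A) (FreeAlgebra.ι k x) 1 • diagContractionBilin k (A.d a) b) := by
        rw [hda, map_sub, LinearMap.sub_apply, diagContractionBilin_ι_mul]
      have hd₃ : diagContractionBilin k (signTwist A.grading 1 (FreeAlgebra.ι k x * a)) (A.d b) =
          -(envT 1 (signTwist A.grading 1 a * A.d b) • diagBasis k (some x) -
            envT (A := A) (FreeAlgebra.ι k x) 1 •
              diagContractionBilin k (signTwist A.grading 1 a) (A.d b)) := by
        rw [hsa, map_neg, LinearMap.neg_apply, diagContractionBilin_ι_mul]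
      have hadd : (envT 1 (A.d a * b + signTwist A.grading 1 a * A.d b) : A.env) =
          envT 1 (A.d a * b) + envT 1 (signTwist A.grading 1 a * A.d b) :=
        (envTBilin A 1).map_add _ _
      have hx₁ : (envT (FreeAlgebra.ι k x * a) b : A.env) =
          envT (A := A) (FreeAlgebra.ι k x) 1 * envT a b := (envT_left_mul _ _ _).symm
      have hx₂ : (envT (FreeAlgebra.ι k x) (a * b) : A.env) =
          envT (A := A) (FreeAlgebra.ι k x) 1 * envT 1 (a * b) := by
        rw [envT_left_mul, mul_one]
      have hx₃ := congrArg (envT (A := A) (FreeAlgebra.ι k x) 1 • ·) ha'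
      simp only [smul_add, sub_smul, smul_sub, ← mul_smul] at hx₃
      rw [hd₁, hd₂, hd₃, signTwist_envT_one_smul_d, diagContractionBilin_exampleDiff_mul, hadd,
        hx₁, hx₂, mul_assoc, sub_smul, add_smul, ← sub_eq_zero]
      rw [← sub_eq_zero] at hx₃
      rw [← hx₃]
      abel
  refine Eq.trans ?_ (goal_eq.trans ?_)
  · simp only [LinearMap.add_apply, LinearMap.comp_apply]
    rw [env_d_envT, map_add]
    rfl
  · simp only [LinearMap.sub_apply, LinearMap.comp_apply]
    rw [← envAct_envT_one]
    rfl

/-- The contraction inverts the component `aeᵢb ↦ ± a(xᵢe₀ - e₀xᵢ)b` of the differential. -/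
theorem diagContraction_mul_diagMatrix (y : (exampleAlgebra k).env) (i : Fin 3) :
    diagContraction k (signTwist (exampleAlgebra k).env.grading 1 y * diagMatrix k (some i) none) =
      y • diagBasis k (some i) := by
  let A := exampleAlgebra k
  refine LinearMap.congr_fun
    (f := diagContraction k ∘ₗ LinearMap.mulRight k (diagMatrix k (some i) none) ∘ₗ
      signTwist A.env.grading 1)
    (g := (LinearMap.toSpanSingleton A.env (diagRes k)
      (diagBasis k (some i))).restrictScalars k) (env_hom_ext fun a b => ?_) y
  have h₁ := signTwist_envT_mul_left (A := A) (ι_mem k i) a b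
  have h₂ := signTwist_envT_mul_right (A := A) (ι_mem k i) a b
  have goal_eq : diagContractionBilin k (signTwist A.grading 1 a * FreeAlgebra.ι k i) b -
      diagContractionBilin k (signTwist A.grading 1 a) (FreeAlgebra.ι k i * b) =
      envT a b • diagBasis k (some i) := by
    refine freeAlgebra_hom_ext_left
      (f := (diagContractionBilin k).flip b ∘ₗ LinearMap.mulRight k (FreeAlgebra.ι k i : A) ∘ₗ
          signTwist A.grading 1 -
        (diagContractionBilin k).flip (FreeAlgebra.ι k i * b) ∘ₗ signTwist A.grading 1)
      (g := (LinearMap.toSpanSingleton A.env (diagRes k)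
        (diagBasis k (some i))).restrictScalars k ∘ₗ (envTBilin A).flip b) ?_
      (fun x a ha => ?_) a
    · change diagContractionBilin k (signTwist A.grading 1 1 * FreeAlgebra.ι k i) b -
        diagContractionBilin k (signTwist A.grading 1 1) (FreeAlgebra.ι k i * b) =
        envT 1 b • diagBasis k (some i)
      have h := diagContractionBilin_ι_mul k i 1 b
      rw [mul_one, one_mul, diagContractionBilin_one, smul_zero, sub_zero] at h
      rw [signTwist_one, one_mul, h, diagContractionBilin_one, sub_zero]
    · have ha' : diagContractionBilin k (signTwist A.grading 1 a * FreeAlgebra.ι k i) b -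
          diagContractionBilin k (signTwist A.grading 1 a) (FreeAlgebra.ι k i * b) =
          envT a b • diagBasis k (some i) := ha
      change diagContractionBilin k
          (signTwist A.grading 1 (FreeAlgebra.ι k x * a) * FreeAlgebra.ι k i) b -
        diagContractionBilin k (signTwist A.grading 1 (FreeAlgebra.ι k x * a))
          (FreeAlgebra.ι k i * b) =
        envT (FreeAlgebra.ι k x * a) b • diagBasis k (some i)
      have hsa : signTwist A.grading 1 (FreeAlgebra.ι k x * a) =
          -(FreeAlgebra.ι k x * signTwist A.grading 1 a) := by
        rw [signTwist_mul A, signTwist_of_mem A.grading (ι_mem k x), mul_one, zpow_one,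
          neg_one_smul, neg_mul]
      have hx : (envT (FreeAlgebra.ι k x * a) b : A.env) =
          envT (A := A) (FreeAlgebra.ι k x) 1 * envT a b := (envT_left_mul _ _ _).symm
      rw [hsa, neg_mul, map_neg, map_neg, LinearMap.neg_apply, LinearMap.neg_apply,
        mul_assoc (FreeAlgebra.ι k x), diagContractionBilin_ι_mul, diagContractionBilin_ι_mul,
        hx, mul_smul, ← ha', smul_sub, mul_assoc]
      abel
  refine Eq.trans ?_ goal_eq
  simp only [LinearMap.comp_apply, LinearMap.mulRight_apply]
  rw [show diagMatrix k (some i) none = envT (A := A) (FreeAlgebra.ι k i) 1 -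
    envT (A := A) 1 (FreeAlgebra.ι k i) from rfl, mul_sub, h₁, h₂, map_sub]
  rfl

theorem diagResAug_isQuasiIso : (diagResAug k).IsQuasiIso := by
  refine DGHom.isQuasiIso_of_contraction _
    ((LinearMap.toSpanSingleton (exampleAlgebra k).env (diagRes k)
      (diagBasis k none)).restrictScalars k ∘ₗ envTBilin (exampleAlgebra k) 1)
    (diagContraction k ∘ₗ LinearMap.proj none) (fun y => ?_) (fun y => ?_) (fun f => ?_)
  · change (diagRes k).d (envT (A := exampleAlgebra k) 1 y • diagBasis k none) =
      envT (A := exampleAlgebra k) 1 ((exampleAlgebra k).d y) • diagBasis k none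
    rw [(diagRes k).leibniz_signTwist, diagRes_d_diagBasis, env_d_envT, (exampleAlgebra k).d_one,
      envT_zero_left, zero_add, signTwist_one]
    simp [diagMatrix]
  · rw [diagResAug_apply]
    change (exampleAlgebra k).envAct (envT (A := exampleAlgebra k) 1 y * 1) 1 = y
    rw [mul_one, envAct_envT_one, one_mul]
  · have key : diagContraction k ((diagRes k).d f none) =
        diagContraction k ((exampleAlgebra k).env.d (f none)) +
          ∑ i : Fin 3, f (some i) • diagBasis k (some i) := by
      rw [diagRes_d_apply, map_add, map_sum, Fintype.sum_option,
        show diagMatrix k none none = 0 from rfl, mul_zero, map_zero, zero_add]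
      exact congrArg (_ + ·)
        (Finset.sum_congr rfl fun i _ => diagContraction_mul_diagMatrix k (f (some i)) i)
    have hf := diagRes_eq_sum k f
    rw [Fintype.sum_option] at hf
    have e (a b c : diagRes k) : a - b + (c - a) = c - b := by abel
    rw [diagResAug_apply]
    change (diagRes k).d (diagContraction k (f none)) + diagContraction k ((diagRes k).d f none) =
      f - envT 1 ((exampleAlgebra k).envAct (f none) 1) • diagBasis k none
    rw [key, ← add_assoc, d_diagContraction, eq_sub_of_add_eq' hf.symm]
    exact e _ _ _

theorem exampleAlgebra_isHomologicallySmooth : (exampleAlgebra k).IsHomologicallySmooth :=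
  DGModule.isCompact_of_finite_semiBasis (diagResAug k) (diagResAug_isQuasiIso k)
    (isSemiBasis_twistedBasis (diagMatrix k) (diagMatrix_mem k) (d_diagMatrix k) resLayer
      (resLayer_lt_of_diagMatrix k))

end DiagonalResolution

/-! ### Failure of the Gorenstein property -/

section Gorenstein

theorem finrank_directSum_ne_one {k : Type u} [Field k] {M : ℤ → Type u}
    [∀ n, AddCommGroup (M n)] [∀ n, Module k (M n)] {i j : ℤ} (hij : i ≠ j) {a : M i} (ha : a ≠ 0)
    {b : M j} (hb : b ≠ 0) : Module.finrank k (⨁ n, M n) ≠ 1 := by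
  intro h
  obtain ⟨v, -, hv⟩ := finrank_eq_one_iff'.1 h
  obtain ⟨r, hr⟩ := hv (DirectSum.lof k ℤ M i a)
  obtain ⟨s, hs⟩ := hv (DirectSum.lof k ℤ M j b)
  have h₁ : r • v i = a := by
    have := DFunLike.congr_fun hr i
    rwa [DirectSum.lof_apply] at this
  have h₂ : r • v j = 0 := by
    have := DFunLike.congr_fun hr j
    rwa [DirectSum.lof_eq_of, DirectSum.of_eq_of_ne _ _ _ hij.symm] at this
  have h₃ : s • v j = b := by
    have := DFunLike.congr_fun hs j
    rwa [DirectSum.lof_apply] at this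
  rcases smul_eq_zero.1 h₂ with h | h
  · exact ha (by rw [← h₁, h, zero_smul])
  · exact hb (by rw [← h₃, h, smul_zero])

/-- Precomposition with a homotopy equivalence reflects coboundaries. -/
theorem mem_homCoboundaries_of_comp_homotopyEquiv {k : Type u} [Field k] {A : DGAlgebra k}
    {F F' N : DGModule A} {φ : F →ₗ[k] F'} {ψ : F' →ₗ[k] F} (hψ : ψ ∈ homCocycles F' F 0)
    (h : φ ∘ₗ ψ - LinearMap.id ∈ homCoboundaries F' F' 0) {n : ℤ} {g : F' →ₗ[k] N}
    (hg : g ∈ homCocycles F' N n) (hgφ : g ∘ₗ φ ∈ homCoboundaries F N n) :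
    g ∈ homCoboundaries F' N n := by
  have h₁ := comp_mem_homCoboundaries_right (add_zero n) hgφ hψ
  have h₂ := comp_mem_homCoboundaries_left (add_zero n) hg h
  have h₃ := Submodule.sub_mem _ h₁ h₂
  rw [LinearMap.comp_assoc, ← LinearMap.comp_sub, sub_sub_cancel, LinearMap.comp_id] at h₃
  exact h₃

/-- The values of a homomorphism of degree `n` on the differentials of the basis elements. -/
theorem homDeg_twistedD_single_one {k : Type u} [Field k] {B : DGAlgebra k} {I : Type} [Fintype I]
    [DecidableEq I] {δ : I → I → B} {hδ : ∀ i j, δ i j ∈ B.grading 1}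
    {hδδ : ∀ i j, B.d (δ i j) = ∑ l, δ i l * δ l j} {N : DGModule B} {n : ℤ}
    {h : twistedFree δ hδ hδδ →ₗ[k] N} (hh : h ∈ homDeg (twistedFree δ hδ hδδ) N n) (i : I) :
    h (twistedD δ (Pi.single i 1)) =
      (-1 : k) ^ n • ∑ j, δ i j • h (Pi.single j 1 : I → B) := by
  rw [twistedD_single_one, map_sum, Finset.smul_sum]
  refine Finset.sum_congr rfl fun j _ => ?_
  rw [hh.2 1 _ (hδ i j), mul_one]

variable (k : Type u) [Field k]

theorem homDeg_trivialRes_ext {N : DGModule (exampleAlgebra k)} {n : ℤ}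
    {f g : trivialRes k →ₗ[k] N} (hf : f ∈ homDeg (trivialRes k) N n)
    (hg : g ∈ homDeg (trivialRes k) N n) (h : ∀ j, f (resBasis k j) = g (resBasis k j)) :
    f = g := by
  refine homDeg_ext_basis (twistedBasis (resMatrix k) (resMatrix_mem k) (d_resMatrix k)) hf hg
    fun j => ?_
  rw [twistedBasis_apply]
  exact h j.down

theorem resBasis_mem (i : Option (Fin 3)) : resBasis k i ∈ (trivialRes k).grading 0 :=
  single_mem_piGrading i (SetLike.one_mem_graded (exampleAlgebra k).grading)

/-- The homomorphism of degree `n` to the algebra with `e₁ ↦ c` and `eᵢ ↦ 0` for `i ≠ 1`. -/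
def dualTop (n : ℤ) (c : exampleAlgebra k) : trivialRes k →ₗ[k] (exampleAlgebra k).regular :=
  homOfBasis (N := (exampleAlgebra k).regular)
    (twistedBasis (resMatrix k) (resMatrix_mem k) (d_resMatrix k)) n
    fun i => if i.down = some 0 then c else (0 : exampleAlgebra k)

theorem dualTop_resBasis (n : ℤ) (c : exampleAlgebra k) (i : Option (Fin 3)) :
    dualTop k n c (resBasis k i) = if i = some 0 then c else 0 := by
  have h := homOfBasis_basis (N := (exampleAlgebra k).regular)
    (b := twistedBasis (resMatrix k) (resMatrix_mem k) (d_resMatrix k)) n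
    (fun i => if i.down = some 0 then c else (0 : exampleAlgebra k)) ⟨i⟩
  rw [twistedBasis_apply] at h
  exact h

/-- The homomorphism `e₁ ↦ c` is a cocycle for each cocycle `c`, as no differential of a basis
element involves `e₁`. -/
theorem dualTop_mem_homCocycles {n : ℤ} {c : exampleAlgebra k}
    (hc : c ∈ (exampleAlgebra k).grading n) (hdc : (exampleAlgebra k).d c = 0) :
    dualTop k n c ∈ homCocycles (trivialRes k) (exampleAlgebra k).regular n := by
  have hm : dualTop k n c ∈ homDeg (trivialRes k) (exampleAlgebra k).regular n := by
    refine homOfBasis_mem_homDeg (deg := fun _ => 0) (fun j => ?_) (fun j => ?_)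
    · rw [twistedBasis_apply]
      exact resBasis_mem k j.down
    · rw [zero_add]
      split_ifs
      · exact hc
      · exact Submodule.zero_mem _
  refine ⟨hm, LinearMap.mem_ker.2 (homDeg_trivialRes_ext k (homDiff_mem hm)
    (Submodule.zero_mem _) fun i => ?_)⟩
  have h₁ : (exampleAlgebra k).d (dualTop k n c (resBasis k i)) = 0 := by
    rw [dualTop_resBasis]
    split_ifs
    · exact hdc
    · exact map_zero _
  have h₂ : dualTop k n c ((trivialRes k).d (resBasis k i)) = 0 := by
    refine (homDeg_twistedD_single_one hm i).trans ?_
    rw [Finset.sum_eq_zero, smul_zero]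
    intro j _
    change resMatrix k i j * dualTop k n c (resBasis k j) = 0
    rw [dualTop_resBasis]
    split_ifs with hj
    · subst hj
      match i with
      | none => exact zero_mul c
      | some i =>
        rw [resMatrix, if_neg (by simp)]
        exact zero_mul c
    · exact mul_zero (resMatrix k i j)
  rw [homDiff_apply, LinearMap.sub_apply, LinearMap.comp_apply, LinearMap.smul_apply,
    LinearMap.comp_apply, h₂, smul_zero, sub_zero, LinearMap.zero_apply]
  exact h₁

/-- If `e₁ ↦ c` is the differential of a homomorphism `s`, then `c = ∂p - x₁q - x₂r` for the values
`p`, `q`, `r` of `s` at `e₁`, `e₀` and `e₃`. -/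
theorem exists_of_dualTop_mem_homCoboundaries {n : ℤ} {c : exampleAlgebra k}
    (h : dualTop k n c ∈ homCoboundaries (trivialRes k) (exampleAlgebra k).regular n) :
    ∃ p ∈ (exampleAlgebra k).grading (n - 1), ∃ q ∈ (exampleAlgebra k).grading (n - 1),
      ∃ r ∈ (exampleAlgebra k).grading (n - 1),
      c = (exampleAlgebra k).d p - (FreeAlgebra.ι k 0 * q + FreeAlgebra.ι k 1 * r) := by
  obtain ⟨s, hs, e⟩ := h
  have hmem (i) : s (resBasis k i) ∈ (exampleAlgebra k).grading (n - 1) := by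
    have h := hs.1 0 _ (resBasis_mem k i)
    rwa [zero_add] at h
  refine ⟨_, hmem (some 0), _, hmem none, _, hmem (some 2), ?_⟩
  have h := LinearMap.congr_fun e (resBasis k (some 0))
  have hd : s ((trivialRes k).d (resBasis k (some 0))) = (-1 : k) ^ (n - 1) •
      (FreeAlgebra.ι k 0 * s (resBasis k none) + FreeAlgebra.ι k 1 * s (resBasis k (some 2)) :
        FreeAlgebra k (Fin 3)) := by
    refine (homDeg_twistedD_single_one hs (some 0)).trans (congrArg _ ?_)
    change ∑ j, resMatrix k (some 0) j * s (resBasis k j) = _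
    rw [Fintype.sum_option, Fin.sum_univ_three]
    simp [resMatrix]
  rw [dualTop_resBasis, if_pos rfl, homDiff_apply, LinearMap.sub_apply, LinearMap.smul_apply,
    LinearMap.comp_apply, LinearMap.comp_apply, hd] at h
  refine h.symm.trans (congrArg _ ?_)
  exact (smul_smul _ _ _).trans ((congrArg (· • _) (sign_sq _)).trans (one_smul _ _))

theorem dualTop_one_not_mem_homCoboundaries :
    dualTop k 0 1 ∉ homCoboundaries (trivialRes k) (exampleAlgebra k).regular 0 := by
  intro h
  obtain ⟨p, hp, q, hq, r, hr, e⟩ := exists_of_dualTop_mem_homCoboundaries k h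
  have h₀ (a) (ha : a ∈ (exampleAlgebra k).grading (0 - 1)) : a = 0 := by
    rwa [DGAlgebra.IsConnected.grading_neg _ (by norm_num), Submodule.mem_bot] at ha
  rw [h₀ p hp, h₀ q hq, h₀ r hr] at e
  have e' := congrArg (exampleAlgebra k).aug e
  simp at e'

theorem dualTop_x₃_not_mem_homCoboundaries :
    dualTop k 1 (FreeAlgebra.ι k 2) ∉
      homCoboundaries (trivialRes k) (exampleAlgebra k).regular 1 := by
  intro h
  obtain ⟨p, hp, q, hq, r, hr, e⟩ := exists_of_dualTop_mem_homCoboundaries k h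
  obtain ⟨p, rfl⟩ := DGAlgebra.IsConnected.grading_zero p hp
  have hd : (exampleAlgebra k).d (algebraMap k (exampleAlgebra k) p) = 0 := by
    rw [Algebra.algebraMap_eq_smul_one, map_smul, (exampleAlgebra k).d_one, smul_zero]
  rw [hd, zero_sub] at e
  -- The evaluation at `x₁ = x₂ = 0`, `x₃ = 1` separates `x₃` from `x₁q + x₂r`.
  have e' := congrArg
    (FreeAlgebra.lift k fun x : Fin 3 => if x = 2 then (1 : k) else 0) e
  simp at e'

/-- The cocycles `e₁ ↦ 1` and `e₁ ↦ x₃` of `Hom(F, A)` give nonzero classes in the degrees `0`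
and `1`. -/
theorem exampleAlgebra_not_isLeftGorenstein : ¬ (exampleAlgebra k).IsLeftGorenstein := by
  rintro ⟨F, ε, hε, h⟩
  obtain ⟨φ, hφ, ψ, hψ, -, hψφ, -⟩ :=
    (trivialResAug_isSemiFreeResolution k).exists_homotopyEquiv hε
  have key {n : ℤ} {u : trivialRes k →ₗ[k] (exampleAlgebra k).regular}
      (hu : u ∈ homCocycles (trivialRes k) (exampleAlgebra k).regular n)
      (hu₀ : u ∉ homCoboundaries (trivialRes k) (exampleAlgebra k).regular n) :
      (Submodule.Quotient.mk ⟨u ∘ₗ ψ, comp_mem_homCocycles (add_zero n) hu hψ⟩ :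
        HomCohomology F (exampleAlgebra k).regular n) ≠ 0 := by
    intro h
    have h₁ : u ∘ₗ ψ ∈ homCoboundaries F (exampleAlgebra k).regular n :=
      (Submodule.Quotient.mk_eq_zero
        ((homCoboundaries F (exampleAlgebra k).regular n).submoduleOf _)).1 h
    exact hu₀ (mem_homCoboundaries_of_comp_homotopyEquiv hφ hψφ hu h₁)
  exact finrank_directSum_ne_one (M := fun n => HomCohomology F (exampleAlgebra k).regular n)
    zero_ne_one
    (key (dualTop_mem_homCocycles k (SetLike.one_mem_graded (exampleAlgebra k).grading)
      (exampleAlgebra k).d_one) (dualTop_one_not_mem_homCoboundaries k))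
    (key (dualTop_mem_homCocycles k (ι_mem k 2) (exampleAlgebra_d_x₃ k))
      (dualTop_x₃_not_mem_homCoboundaries k)) h

end Gorenstein

/-! ### The Ext-algebra -/

section Frobenius

/-- An algebra is not Frobenius if every element acts on two linearly independent elements by a
common scalar: the two values of an associative form on them are proportional. -/
theorem not_isFrobenius_of_common_scalar {k E : Type u} [Field k] [Ring E] [Algebra k E] {v w : E}
    (hvw : LinearIndependent k ![v, w]) (h : ∀ x : E, ∃ c : k, x * v = c • v ∧ x * w = c • w) :
    ¬ IsFrobenius k E := by
  rintro ⟨-, B, ⟨-, hB⟩, hass⟩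
  have key (x) : ∃ c : k, B x v = c * B 1 v ∧ B x w = c * B 1 w := by
    obtain ⟨c, hv, hw⟩ := h x
    refine ⟨c, ?_, ?_⟩
    · have := hass 1 x v
      rwa [one_mul, hv, map_smul] at this
    · have := hass 1 x w
      rwa [one_mul, hw, map_smul] at this
  -- This combination of `v` and `w` lies in the radical of the form.
  have h₀ : B 1 w • v + (-B 1 v) • w = 0 := by
    refine hB _ fun x => ?_
    obtain ⟨c, hv, hw⟩ := key x
    rw [map_add, map_smul, map_smul, hv, hw, smul_eq_mul, smul_eq_mul]
    ring
  obtain ⟨-, h₁⟩ := LinearIndependent.pair_iff.1 hvw _ _ h₀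
  have hv : v = 0 := by
    refine hB v fun x => ?_
    obtain ⟨c, hc, -⟩ := key x
    rw [hc, neg_eq_zero.1 h₁, mul_zero]
  exact hvw.ne_zero 0 hv

end Frobenius

/-- Two linear maps agree on the cocycles if they agree on the homogeneous cocycles. -/
theorem DGAlgebra.cocycle_hom_ext {k : Type u} [Field k] (A : DGAlgebra k) {V : Type*}
    [AddCommGroup V] [Module k V] {f g : A →ₗ[k] V}
    (h : ∀ n, ∀ x ∈ A.grading n, A.d x = 0 → f x = g x) {x : A} (hx : A.d x = 0) :
    f x = g x := by
  classical
  change x ∈ LinearMap.eqLocus f g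
  rw [← DirectSum.sum_support_decompose A.grading x]
  refine Submodule.sum_mem _ fun n _ => h n _ (Subtype.mem _) ?_
  exact (A.regular.d_proj n x).trans ((congrArg _ hx).trans (map_zero _))

section EndRealization

variable {k : Type u} [Field k] {A : DGAlgebra k} (F : DGModule A)

/-- The endomorphism that underlies an element of the endomorphism algebra: the sum of its
homogeneous components. -/
def endRealize : EndCarrier F →ₗ[k] Module.End k F :=
  extLift fun n => (endDeg F n).subtype

theorem endRealize_extOf {n : ℤ} (f : endDeg F n) : endRealize F (extOf (endDeg F) n f) = f :=
  extLift_extOf _ _ _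

theorem endRealize_one : endRealize F 1 = 1 := by
  rw [← extOf_one, endRealize_extOf]

theorem endRealize_mul (x y : EndCarrier F) :
    endRealize F (x * y) = endRealize F x * endRealize F y := by
  refine ext_induction (f := endRealize F ∘ₗ LinearMap.mulRight k y)
    (g := LinearMap.mulRight k (endRealize F y) ∘ₗ endRealize F) (fun m f => ?_) x
  refine ext_induction (f := endRealize F ∘ₗ LinearMap.mulLeft k (extOf (endDeg F) m f))
    (g := LinearMap.mulLeft k (endRealize F (extOf (endDeg F) m f)) ∘ₗ endRealize F)
    (fun n g => ?_) y
  simp only [LinearMap.comp_apply, LinearMap.mulLeft_apply]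
  rw [extOf_mul _ _ _ (endDeg_mul_mem F f.2 g.2), endRealize_extOf, endRealize_extOf,
    endRealize_extOf]

theorem mem_homCocycles_of_endD_eq_zero {n : ℤ} {f : Module.End k F} {hf : f ∈ endDeg F n}
    (h : endD F (extOf (endDeg F) n ⟨f, hf⟩) = 0) : f ∈ homCocycles F F n := by
  rw [endD_extOf] at h
  exact ⟨hf, LinearMap.mem_ker.2 (congrArg Subtype.val (DirectSum.of_injective
    (β := fun n => endDeg F n) (n + 1) (h.trans (map_zero (extOf _ (n + 1))).symm)))⟩

theorem extOf_mem_cocycles {n : ℤ} {f : Module.End k F} (hf : f ∈ homCocycles F F n) :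
    extOf (endDeg F) n ⟨f, hf.1⟩ ∈ (endAlgebra F).cocycles := by
  change endD F _ = 0
  rw [endD_extOf]
  exact (congrArg (extOf (endDeg F) (n + 1)) (Subtype.ext (LinearMap.mem_ker.1 hf.2))).trans
    (map_zero _)

/-- The linear map over the ground field that underlies a morphism. -/
abbrev DGHom.toHom {M N : DGModule A} (g : DGHom M N) : M →ₗ[k] N :=
  g.toLinearMap.restrictScalars k

end EndRealization

section ExtAlgebra

variable (k : Type u) [Field k]

theorem trivialModule_apply_eq_zero {A : DGAlgebra k} [A.IsConnected] {n : ℤ} (hn : n ≠ 0)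
    {x : A.trivialModule} (hx : x ∈ A.trivialModule.grading n) : x = 0 := by
  have hx' : (x : k) ∈ DGAlgebra.trivialGrading k n := hx
  rwa [DGAlgebra.trivialGrading, if_neg hn, Submodule.mem_bot] at hx'

/-- The differential on `Hom(F, k)` vanishes for the minimal resolution `F`. -/
theorem eq_zero_of_mem_homCoboundaries_trivialRes {n : ℤ}
    {f : trivialRes k →ₗ[k] (exampleAlgebra k).trivialModule}
    (hf : f ∈ homCoboundaries (trivialRes k) (exampleAlgebra k).trivialModule n) : f = 0 := by
  obtain ⟨s, hs, rfl⟩ := hf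
  refine homDeg_trivialRes_ext k (homDiff_mem hs) (Submodule.zero_mem _) fun i => ?_
  have h : s ((trivialRes k).d (resBasis k i)) = 0 := by
    refine (homDeg_twistedD_single_one hs i).trans ?_
    rw [Finset.sum_eq_zero, smul_zero]
    intro j _
    change (exampleAlgebra k).aug (resMatrix k i j) * s (resBasis k j) = (0 : k)
    rw [(exampleAlgebra k).aug_of_mem one_ne_zero (resMatrix_mem k i j), zero_mul]
  rw [homDiff_apply, LinearMap.sub_apply, LinearMap.smul_apply, LinearMap.comp_apply,
    LinearMap.comp_apply, h, smul_zero, sub_zero]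
  rfl

/-- The values on the basis of an endomorphism of the resolution with the index `i`: it is the
identity for `i = none`, and it is defined by `e₁ ↦ e₀`, by `e₂ ↦ e₀`, and by `e₃ ↦ e₀`, `e₁ ↦ e₂`
for the indices `0`, `1` and `2`, where the other basis elements are mapped to `0`. -/
def resEndValue : Option (Fin 3) → Option (Fin 3) → trivialRes k
  | none, j => resBasis k j
  | some _, none => 0
  | some i, some j =>
    if i = j then resBasis k none else if i = 2 ∧ j = 0 then resBasis k (some 1) else 0

theorem resEndValue_mem (i j : Option (Fin 3)) :
    resEndValue k i j ∈ (trivialRes k).grading 0 := by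
  match i, j with
  | none, j => exact resBasis_mem k j
  | some _, none => exact Submodule.zero_mem _
  | some i, some j =>
    rw [resEndValue]
    split_ifs
    · exact resBasis_mem k none
    · exact resBasis_mem k _
    · exact Submodule.zero_mem _

theorem d_resEndValue (i j : Option (Fin 3)) : (trivialRes k).d (resEndValue k i j) =
    ∑ l, resMatrix k j l • resEndValue k i l := by
  match i, j with
  | none, j => exact trivialRes_d_resBasis k j
  | some i, none =>
    rw [resEndValue, map_zero, Finset.sum_eq_zero]
    intro l _
    exact zero_smul _ _
  | some i, some j =>
    have h₀ : (trivialRes k).d (resBasis k none) = 0 := by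
      rw [trivialRes_d_resBasis, Finset.sum_eq_zero]
      intro l _
      exact zero_smul _ _
    have h₁ : (trivialRes k).d (resBasis k (some 1)) =
        (FreeAlgebra.ι k 1 : exampleAlgebra k) • resBasis k none := by
      rw [trivialRes_d_resBasis, Fintype.sum_option, Fin.sum_univ_three]
      simp [resMatrix]
    rw [Fintype.sum_option, Fin.sum_univ_three]
    fin_cases i <;> fin_cases j <;> simp [resEndValue, resMatrix, h₀, h₁]

/-- The endomorphism of the resolution that lifts the functional dual to `eᵢ`. -/
def resEnd (i : Option (Fin 3)) : DGHom (trivialRes k) (trivialRes k) :=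
  twistedFreeLift (resMatrix k) (resMatrix_mem k) (d_resMatrix k) (trivialRes k)
    (resEndValue k i) (resEndValue_mem k i) (d_resEndValue k i)

theorem resEnd_resBasis (i j : Option (Fin 3)) :
    (resEnd k i).toLinearMap (resBasis k j) = resEndValue k i j := by
  rw [resEnd, twistedFreeLift_apply, Finset.sum_eq_single j]
  · rw [resBasis, Pi.single_eq_same]
    exact one_smul _ _
  · intro l _ hl
    rw [resBasis, Pi.single_eq_of_ne hl]
    exact zero_smul _ _
  · intro h
    exact absurd (Finset.mem_univ j) h

theorem trivialResAug_resBasis (i : Option (Fin 3)) :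
    (trivialResAug k).toLinearMap (resBasis k i) = if i = none then (1 : k) else 0 := by
  rw [trivialResAug_apply, resBasis]
  split_ifs with h
  · rw [h, Pi.single_eq_same, map_one]
  · rw [Pi.single_eq_of_ne (Ne.symm h), map_zero]

theorem trivialResAug_resEndValue (i j : Option (Fin 3)) :
    (trivialResAug k).toLinearMap (resEndValue k i j) = if i = j then (1 : k) else 0 := by
  match i, j with
  | none, j =>
    rw [resEndValue, trivialResAug_resBasis]
    simp only [eq_comm]
  | some _, none => rw [resEndValue, map_zero, if_neg (by simp)]
  | some i, some j =>
    rw [resEndValue]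
    simp only [Option.some.injEq]
    split_ifs
    · rw [trivialResAug_resBasis, if_pos rfl]
    · rw [trivialResAug_resBasis, if_neg (by simp)]
    · exact map_zero _

variable {k} {F : DGModule (exampleAlgebra k)} {ε : DGHom F (exampleAlgebra k).trivialModule}
  {φ : trivialRes k →ₗ[k] F}

/-- The pairing of endomorphisms of a resolution `F` of the trivial module with the basis of the
minimal resolution, where `φ` is a comparison map from the minimal resolution to `F`. -/
def extPairing (ε : DGHom F (exampleAlgebra k).trivialModule) (φ : trivialRes k →ₗ[k] F) :
    EndCarrier F →ₗ[k] Option (Fin 3) → k :=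
  LinearMap.pi fun j =>
    (ε.toHom : F →ₗ[k] k) ∘ₗ
      LinearMap.applyₗ (φ (resBasis k j)) ∘ₗ endRealize F

theorem extPairing_apply (x : EndCarrier F) (j : Option (Fin 3)) :
    extPairing ε φ x j = ε.toHom (endRealize F x (φ (resBasis k j))) := rfl

theorem extPairing_extOf {n : ℤ} (f : endDeg F n) (j : Option (Fin 3)) :
    extPairing ε φ (extOf (endDeg F) n f) j =
      ε.toHom ((f : Module.End k F) (φ (resBasis k j))) := by
  rw [extPairing_apply, endRealize_extOf]

theorem extPairing_endD (hφ : φ ∈ homCocycles (trivialRes k) F 0) (x : EndCarrier F) :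
    extPairing ε φ (endD F x) = 0 := by
  refine ext_induction (f := extPairing ε φ ∘ₗ endD F) (g := 0) (fun n f => ?_) x
  obtain ⟨f, hf⟩ := f
  funext j
  rw [LinearMap.comp_apply, endD_extOf, extPairing_extOf]
  have h : homDiff F F n f ∈ homCoboundaries F F (n + 1) :=
    homDiff_mem_homCoboundaries rfl hf
  have h' := comp_mem_homCoboundaries_right (add_zero (n + 1))
    (comp_mem_homCoboundaries_left (zero_add (n + 1)) ε.mem_homCocycles h) hφ
  exact LinearMap.congr_fun (eq_zero_of_mem_homCoboundaries_trivialRes k h') (resBasis k j)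

theorem extPairing_of_mem_ne (hφ : φ ∈ homCocycles (trivialRes k) F 0) {n : ℤ} (hn : n ≠ 0)
    {x : EndCarrier F} (hx : x ∈ extGrading (endDeg F) n) : extPairing ε φ x = 0 := by
  obtain ⟨f, rfl⟩ := hx
  funext j
  rw [extPairing_extOf]
  refine trivialModule_apply_eq_zero k hn ?_
  have h := ε.map_mem (f.2.1 _ _ (hφ.1.1 0 _ (resBasis_mem k j)))
  rwa [zero_add, zero_add] at h

/-- A homogeneous cocycle in the endomorphism algebra is a coboundary if its pairing vanishes. -/
theorem exists_endD_eq_of_mem (hε : IsSemiFreeResolution ε)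
    (hφ : φ ∈ homCocycles (trivialRes k) F 0) {ψ : F →ₗ[k] trivialRes k}
    (hψ : ψ ∈ homCocycles F (trivialRes k) 0)
    (hφψ : φ ∘ₗ ψ - LinearMap.id ∈ homCoboundaries F F 0) {n : ℤ} {x : EndCarrier F}
    (hx : x ∈ extGrading (endDeg F) n) (hdx : endD F x = 0) (h : extPairing ε φ x = 0) :
    ∃ y, endD F y = x := by
  obtain ⟨⟨f, hf⟩, rfl⟩ := hx
  have hfc := mem_homCocycles_of_endD_eq_zero F hdx
  have hεf := comp_mem_homCocycles (zero_add n) ε.mem_homCocycles hfc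
  have h₀ : (ε.toHom ∘ₗ f) ∘ₗ φ = 0 := by
    refine homDeg_trivialRes_ext k (comp_mem_homCocycles (add_zero n) hεf hφ).1
      (Submodule.zero_mem _) fun j => ?_
    have h := congrFun h j
    rw [extPairing_extOf] at h
    exact h
  have h₁ := mem_homCoboundaries_of_comp_homotopyEquiv hψ hφψ hεf
    (h₀ ▸ Submodule.zero_mem _)
  obtain ⟨s, hs, e⟩ := hε.semiFree.mem_homCoboundaries_of_comp hε.quasiIso hfc h₁
  refine ⟨extOf (endDeg F) (n - 1) ⟨s, hs⟩, ?_⟩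
  rw [endD_extOf]
  exact extOf_congr _ (sub_add_cancel n 1) e _ _

/-- A cocycle in the endomorphism algebra is a coboundary if its pairing vanishes. -/
theorem exists_endD_eq (hε : IsSemiFreeResolution ε)
    (hφ : φ ∈ homCocycles (trivialRes k) F 0) {ψ : F →ₗ[k] trivialRes k}
    (hψ : ψ ∈ homCocycles F (trivialRes k) 0)
    (hφψ : φ ∘ₗ ψ - LinearMap.id ∈ homCoboundaries F F 0) {x : EndCarrier F}
    (hdx : endD F x = 0) (h : extPairing ε φ x = 0) : ∃ y, endD F y = x := by
  classical
  have hproj (n : ℤ) : extPairing ε φ ((endAlgebra F).regular.proj n x) = 0 := by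
    rcases eq_or_ne n 0 with rfl | hn
    · refine Eq.trans ?_ h
      refine DGAlgebra.hom_induction (extGrading (endDeg F))
        (f := extPairing ε φ ∘ₗ (endAlgebra F).regular.proj 0) (g := extPairing ε φ)
        (fun m x hx => ?_) x
      rw [LinearMap.comp_apply]
      rcases eq_or_ne m 0 with rfl | hm
      · exact congrArg _ (DGModule.proj_of_mem (M := (endAlgebra F).regular) hx)
      · rw [extPairing_of_mem_ne hφ hm hx]
        exact (congrArg _ (DGModule.proj_of_mem_ne (M := (endAlgebra F).regular) hx hm)).trans
          (map_zero _)
    · exact extPairing_of_mem_ne hφ hn ((endAlgebra F).regular.proj_mem n x)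
  change x ∈ LinearMap.range (endD F)
  rw [← DirectSum.sum_support_decompose (extGrading (endDeg F)) x]
  refine Submodule.sum_mem _ fun n _ => ?_
  refine exists_endD_eq_of_mem hε hφ hψ hφψ (Subtype.mem _) ?_ (hproj n)
  exact ((endAlgebra F).regular.d_proj n x).trans ((congrArg _ hdx).trans (map_zero _))

/-- Cocycles of `Hom(F, k)` are invariant under the composition with an endomorphism homotopic to
the identity. -/
theorem comp_eq_of_homotopic {u : trivialRes k →ₗ[k] trivialRes k}
    (hu : u - LinearMap.id ∈ homCoboundaries (trivialRes k) (trivialRes k) 0) {n : ℤ}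
    {g : trivialRes k →ₗ[k] (exampleAlgebra k).trivialModule}
    (hg : g ∈ homCocycles (trivialRes k) (exampleAlgebra k).trivialModule n) : g ∘ₗ u = g := by
  have h := eq_zero_of_mem_homCoboundaries_trivialRes k
    (comp_mem_homCoboundaries_left (add_zero n) hg hu)
  rwa [LinearMap.comp_sub, LinearMap.comp_id, sub_eq_zero] at h

/-- The pairing identifies the Ext-algebra with the space of functions on the basis of the minimal
resolution. The left multiplication by a class scales the classes dual to `e₁` and `e₂` by a common
factor, since the corresponding endomorphisms have their values in the submodule generated by
`e₀`. -/
theorem exampleAlgebra_ext (hε : IsSemiFreeResolution ε) :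
    Module.finrank k (endAlgebra F).Cohomology = 4 ∧
      ¬ IsFrobenius k (endAlgebra F).Cohomology := by
  obtain ⟨φ, hφ, ψ, hψ, hεφ, hψφ, hφψ⟩ :=
    (trivialResAug_isSemiFreeResolution k).exists_homotopyEquiv hε
  have hεφ' (x : trivialRes k) : ε.toLinearMap (φ x) = (trivialResAug k).toLinearMap x :=
    (sub_eq_zero.1
      (LinearMap.congr_fun (eq_zero_of_mem_homCoboundaries_trivialRes k hεφ) x)).symm
  -- The kernel of the pairing `P` on the cocycles consists of the coboundaries.
  let P : (endAlgebra F).cocycles →ₗ[k] Option (Fin 3) → k :=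
    extPairing ε φ ∘ₗ (endAlgebra F).cocycles.val.toLinearMap
  have hker : LinearMap.ker P = LinearMap.ker (toCohomology (endAlgebra F)).toLinearMap := by
    ext z
    rw [LinearMap.mem_ker, LinearMap.mem_ker, AlgHom.toLinearMap_apply, toCohomology_eq_zero_iff]
    constructor
    · intro h
      exact exists_endD_eq hε hφ hψ hφψ z.2 h
    · rintro ⟨y, hy⟩
      exact (congrArg (extPairing ε φ) hy.symm).trans (extPairing_endD hφ y)
  have ht (i) : φ ∘ₗ ((resEnd k i).toLinearMap.restrictScalars k) ∘ₗ ψ ∈ homCocycles F F 0 :=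
    comp_mem_homCocycles (zero_add 0) hφ
      (comp_mem_homCocycles (zero_add 0) (resEnd k i).mem_homCocycles hψ)
  let t (i : Option (Fin 3)) : (endAlgebra F).cocycles := ⟨_, extOf_mem_cocycles F (ht i)⟩
  -- The homotopy from `ψφ` to the identity does not contribute, as `Hom(F, k)` has no differential.
  have hmul (z : (endAlgebra F).cocycles) (i j : Option (Fin 3)) :
      P (z * t i) j = ε.toHom (endRealize F z (φ (resEndValue k i j))) := by
    refine (endAlgebra F).cocycle_hom_ext
      (f := (LinearMap.proj j ∘ₗ extPairing ε φ) ∘ₗ LinearMap.mulRight k (t i : EndCarrier F))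
      (g := (ε.toHom : F →ₗ[k] k) ∘ₗ LinearMap.applyₗ (φ (resEndValue k i j)) ∘ₗ endRealize F)
      (fun n x hx hdx => ?_) z.2
    obtain ⟨⟨f, hf⟩, rfl⟩ := hx
    have hfc := mem_homCocycles_of_endD_eq_zero F hdx
    have hg := comp_mem_homCocycles (add_zero n) (comp_mem_homCocycles (add_zero n)
      (comp_mem_homCocycles (zero_add n) ε.mem_homCocycles hfc) hφ) (resEnd k i).mem_homCocycles
    have h := LinearMap.congr_fun (comp_eq_of_homotopic hψφ hg) (resBasis k j)
    refine Eq.trans ?_ (h.trans ?_)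
    · rw [LinearMap.comp_apply, LinearMap.mulRight_apply, LinearMap.comp_apply,
        LinearMap.proj_apply, extPairing_apply, endRealize_mul, endRealize_extOf, endRealize_extOf]
      rfl
    · change ε.toHom (f (φ ((resEnd k i).toLinearMap (resBasis k j)))) =
        ε.toHom (endRealize F (extOf _ n _) _)
      rw [resEnd_resBasis, endRealize_extOf]
  have hPt (i j : Option (Fin 3)) : P (t i) j = if i = j then 1 else 0 := by
    rw [← one_mul (t i), hmul, ← trivialResAug_resEndValue k i j, ← hεφ']
    change ε.toHom (endRealize F 1 _) = _
    rw [endRealize_one]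
    rfl
  have hsurj : Function.Surjective P := by
    intro c
    refine ⟨∑ i, c i • t i, ?_⟩
    funext j
    rw [map_sum, Finset.sum_apply, Finset.sum_eq_single j]
    · rw [map_smul, Pi.smul_apply, hPt, if_pos rfl, smul_eq_mul, mul_one]
    · intro i _ hi
      rw [map_smul, Pi.smul_apply, hPt, if_neg hi, smul_zero]
    · intro h
      exact absurd (Finset.mem_univ j) h
  let e : (endAlgebra F).Cohomology ≃ₗ[k] Option (Fin 3) → k :=
    ((toCohomology (endAlgebra F)).toLinearMap.quotKerEquivOfSurjective
      (toCohomology_surjective _)).symm.trans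
      ((Submodule.quotEquivOfEq _ _ hker.symm).trans (P.quotKerEquivOfSurjective hsurj))
  have he (z) : e (toCohomology _ z) = P z := by
    have h : (toCohomology (endAlgebra F)).toLinearMap.quotKerEquivOfSurjective
        (toCohomology_surjective _) (Submodule.Quotient.mk z) = toCohomology _ z := rfl
    rw [← h]
    simp only [e, LinearEquiv.trans_apply, LinearEquiv.symm_apply_apply]
    rfl
  refine ⟨?_, not_isFrobenius_of_common_scalar (v := toCohomology _ (t (some 1)))
    (w := toCohomology _ (t (some 0))) ?_ fun x => ?_⟩
  · rw [e.finrank_eq, Module.finrank_fintype_fun_eq_card]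
    rfl
  · refine LinearIndependent.pair_iff.2 fun r s h => ?_
    have h' := congrArg e h
    rw [map_add, map_smul, map_smul, he, he, map_zero] at h'
    have h₁ := congrFun h' (some 1)
    have h₀ := congrFun h' (some 0)
    simp [hPt] at h₁ h₀
    exact ⟨h₁, h₀⟩
  · obtain ⟨z, rfl⟩ := toCohomology_surjective _ x
    have h (i : Fin 3) (hi : i ≠ 2) : toCohomology (endAlgebra F) z * toCohomology _ (t (some i)) =
        P z none • toCohomology _ (t (some i)) := by
      refine e.injective ?_
      rw [← map_mul, he, map_smul, he]
      funext j
      rw [hmul, Pi.smul_apply, hPt]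
      match j with
      | none => simp [resEndValue]
      | some j =>
        by_cases hij : i = j
        · simp only [resEndValue, hij, if_true, smul_eq_mul, mul_one]
          rfl
        · simp [resEndValue, hij, hi]
    exact ⟨P z none, h 1 (by decide), h 0 (by decide)⟩

end ExtAlgebra

end

end DG

theorem mainTheorem7 (k : Type*) [Field k] [IsAlgClosed k] [CharZero k] :
    (∃ e : RingQuot (DG.ExampleRel k) ≃ₐ[k] (DG.exampleAlgebra k).Cohomology,
      e (RingQuot.mkAlgHom k (DG.ExampleRel k) (FreeAlgebra.ι k 0)) =
        (DG.exampleAlgebra k).cohomologyClass (FreeAlgebra.ι k 1) (DG.exampleAlgebra_d_x₂ k) ∧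
      e (RingQuot.mkAlgHom k (DG.ExampleRel k) (FreeAlgebra.ι k 1)) =
        (DG.exampleAlgebra k).cohomologyClass (FreeAlgebra.ι k 2) (DG.exampleAlgebra_d_x₃ k)) ∧
    (DG.exampleAlgebra k).IsKoszul ∧
    (DG.exampleAlgebra k).IsHomologicallySmooth ∧
    ¬ (DG.exampleAlgebra k).IsGorenstein ∧
    (∀ (F : DG.DGModule (DG.exampleAlgebra k))
      (ε : DG.DGHom F (DG.exampleAlgebra k).trivialModule), DG.IsSemiFreeResolution ε →
      Module.finrank k (DG.endAlgebra F).Cohomology = 4 ∧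
        ¬ DG.IsFrobenius k (DG.endAlgebra F).Cohomology) :=
  ⟨DG.exists_presentation_equiv k, DG.exampleAlgebra_isKoszul k,
    DG.exampleAlgebra_isHomologicallySmooth k,
    fun h => DG.exampleAlgebra_not_isLeftGorenstein k h.1,
    fun _ _ hε => DG.exampleAlgebra_ext hε⟩
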